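/- **Setting.** Let $d\ge 1$ and let $(\mathbf X_i,\varepsilon_i,Y_i)_{i\ge 1}$ be random variables on one probability space, with $\mathbf X_i=(X_{i1},\dots,X_{id})$ valued in $\mathbb R^d$ and $\varepsilon_i,Y_i$ real, such that almost surely $$Y_i=m(\mathbf X_i)+\sigma(\mathbf X_i)\varepsilon_i,\qquad m(\mathbf x)=c+\sum_{\alpha=1}^d m_\alpha(x_\alpha),\qquad E\,m_\alpha(X_{i\alpha})=0 .$$ Assume: 1. $m_\alpha\in C^{(2)}[0,1]$ for $\alpha=1,\dots,d$. 2. There are $K_0,\lambda_0>0$ with $\alpha(k)\le K_0e^{-\lambda_0k}$ for all $k\ge1$, where, with $\mathbf Z_i=(\mathbf X_i,\varepsilon_i)$, $\alpha(k)=\sup|P(B\cap C)-P(B)P(C)|$ over all $t$, all $B\in\sigma\{\mathbf Z_s,s\le t\}$ and all $C\in\sigma\{\mathbf Z_s,s\ge t+k\}$. 3. Conditionally on the predictors $(\varepsilon_i)$ is a white noise: $E(\varepsilon_i\mid\mathbf X_i)=0$, $E(\varepsilon_i^2\mid\mathbf X_i)=1$, and $E(\varepsilon_i\varepsilon_j\mid\mathbf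 X_i,\mathbf X_j)=0$ for $i\neq j$. Moreover $E(|\varepsilon_i|^{2+\delta}\mid\mathbf X_i)<M_\delta$ for some $\delta>1/2$ and some finite $M_\delta$ not depending on $i$. The function $\sigma$ is continuous on $[0,1]^d$ with $0<c_\sigma\le\sigma\le C_\sigma<\infty$ there. 4. Every $\mathbf X_i$ has the same density $f$, which vanishes outside $[0,1]^d$ and is continuous on $[0,1]^d$ with $0<c_f\le f\le C_f<\infty$ there. The marginal densities $f_\alpha$ of $X_{i\alpha}$ are continuously differentiable on $[0,1]$. 5. The kernel $K$ is nonnegative, symmetric, supported on $[-1,1]$ and Lipschitz continuous on $[-1,1]$, with $\int K(u)\,du=1$. The bandwidths $h=h_n$ satisfy $c_hn^{-1/5}\le h\le C_hn^{-1/5}$ for all large $n$, for some $c_h,C_h>0$. Write $K_h(u)=K(u/h)/h$. 6. The integers $N=N_n\ge0$ satisfy $c_Nn^{2/5}\log n\le N\le C_Nn^{2/5}\log n$ for all large $n$, for some $c_N,C_N>0$. **Estimator.** Let $H=1/(N+1)$, and let $I_{J,\alpha}(x_\alpha)$ be the indicator of $JH\le x_\alpha<(J+1)H$, $J=0,\dots,N$.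 With $\|g\|_2^2=E\,g^2(\mathbf X_1)$ put, for $J=1,\dots,N$, $$b_{J,\alpha}=I_{J,\alpha}-\frac{\|I_{J,\alpha}\|_2}{\|I_{J-1,\alpha}\|_2}I_{J-1,\alpha},\qquad B_{J,\alpha}=\frac{b_{J,\alpha}}{\|b_{J,\alpha}\|_2}.$$ For each $n$ let $(\hat\lambda_0,\hat\lambda_{J,\alpha})_{1\le J\le N,\,1\le\alpha\le d}$ be any measurable minimizer of $$\sum_{i=1}^n\Big\{Y_i-\lambda_0-\sum_{\alpha=1}^d\sum_{J=1}^N\lambda_{J,\alpha}B_{J,\alpha}(X_{i\alpha})\Big\}^2 ,$$ and define $$\hat m_\alpha(x_\alpha)=\sum_{J=1}^N\hat\lambda_{J,\alpha}B_{J,\alpha}(x_\alpha)-\frac1n\sum_{i=1}^n\sum_{J=1}^N\hat\lambda_{J,\alpha}B_{J,\alpha}(X_{i\alpha}),\qquad \hat c=\frac1n\sum_{i=1}^nY_i,$$ $$\hat Y_{i\alpha}=Y_i-\hat c-\sum_{\beta\ne\alpha}\hat m_\beta(X_{i\beta}),\qquad \hat m_\alpha^*(x_\alpha)=\frac{\sum_{i=1}^nK_h(X_{i\alpha}-x_\alpha)\hat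 Y_{i\alpha}}{\sum_{i=1}^nK_h(X_{i\alpha}-x_\alpha)},\qquad \hat m^*(\mathbf x)=\hat c+\sum_{\alpha=1}^d\hat m^*_\alpha(x_\alpha).$$ **Conclusion.** For every fixed $\mathbf x\in(0,1)^d$, as $n\to\infty$, $$\sqrt{nh}\,\{\hat m^*(\mathbf x)-m(\mathbf x)-b(\mathbf x)h^2\}\xrightarrow{\ D\ }N\{0,v^2(\mathbf x)\},$$ where $b(\mathbf x)=\sum_{\alpha=1}^db_\alpha(x_\alpha)$, $v^2(\mathbf x)=\sum_{\alpha=1}^dv_\alpha^2(x_\alpha)$ and $$b_\alpha(x_\alpha)=\int u^2K(u)\,du\;\Big\{\tfrac12m_\alpha''(x_\alpha)f_\alpha(x_\alpha)+m_\alpha'(x_\alpha)f_\alpha'(x_\alpha)\Big\}f_\alpha^{-1}(x_\alpha),$$ $$v_\alpha^2(x_\alpha)=\int K^2(u)\,du\;E[\sigma^2(\mathbf X_1)\mid X_{1\alpha}=x_\alpha]\,f_\alpha^{-1}(x_\alpha),$$ the conditional expectation being its continuous version $\int\sigma^2f\,d\mathbf x_{-\alpha}/f_\alpha(x_\alpha)$.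 -/

import Mathlib

open MeasureTheory ProbabilityTheory Filter

noncomputable section

namespace SPBK

/-! ### Mixing -/

/-- The `σ`-algebra generated by the variables `Z s`, `s ∈ S`. -/
def generatedBy {Ω E : Type*} [MeasurableSpace E] (Z : ℕ → Ω → E) (S : Set ℕ) :
    MeasurableSpace Ω :=
  ⨆ s ∈ S, MeasurableSpace.comap (Z s) inferInstance

/-- The `α`-mixing (strong mixing) coefficient
`α(k) = sup |P(B ∩ C) - P(B) P(C)|`, over all times `t` and all events
`B ∈ σ(Z s, s ≤ t)`, `C ∈ σ(Z s, s ≥ t + k)`. The set of values is non-empty and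
bounded, so that the real supremum is the genuine one. -/
def alphaMixingCoeff {Ω E : Type*} [MeasurableSpace Ω] [MeasurableSpace E]
    (P : Measure Ω) (Z : ℕ → Ω → E) (k : ℕ) : ℝ :=
  sSup {r : ℝ | ∃ (t : ℕ) (B C : Set Ω),
    MeasurableSet[generatedBy Z (Set.Iic t)] B ∧
    MeasurableSet[generatedBy Z (Set.Ici (t + k))] C ∧
    r = |P.real (B ∩ C) - P.real B * P.real C|}

/-! ### The law of the predictors -/

/-- The unit cube `[0,1]^d`. -/
def cube (d : ℕ) : Set (Fin d → ℝ) := {x | ∀ α, x α ∈ Set.Icc (0 : ℝ) 1}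

/-- The measure with Lebesgue density `f` on the unit cube. -/
def densityLaw {d : ℕ} (f : (Fin d → ℝ) → ℝ) : Measure (Fin d → ℝ) :=
  (volume.restrict (cube d)).withDensity fun x => ENNReal.ofReal (f x)

/-- The integral over the cube of `g`, with the coordinate `α` frozen at the value `t`.
The coordinate `y α` does not occur in the integrand and runs over an interval of length one, so
this is the integral of `g` over the remaining `d - 1` coordinates. -/
def sliceIntegral {d : ℕ} (g : (Fin d → ℝ) → ℝ) (α : Fin d) (t : ℝ) : ℝ :=
  ∫ y in cube d, g (Function.update y α t)

/-- The density `f_α` of the coordinate `X_α`, when `X` has density `f` on the cube. -/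
def marginalDensity {d : ℕ} (f : (Fin d → ℝ) → ℝ) (α : Fin d) (t : ℝ) : ℝ :=
  sliceIntegral f α t

/-- `E[s(X)² | X_α = t]`, when `X` has density `f` on the cube (the continuous version, if `f` and
`s` are continuous). -/
def condSecondMoment {d : ℕ} (f s : (Fin d → ℝ) → ℝ) (α : Fin d) (t : ℝ) : ℝ :=
  sliceIntegral (fun x => s x ^ 2 * f x) α t / marginalDensity f α t

/-! ### Constant splines -/

/-- The indicator function of the `J`-th of the `N + 1` intervals
`[J H, (J + 1) H)`, `J = 0, …, N`, where `H = 1 / (N + 1)`. -/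
def cell (N J : ℕ) (t : ℝ) : ℝ :=
  if (J : ℝ) * ((N : ℝ) + 1)⁻¹ ≤ t ∧ t < ((J : ℝ) + 1) * ((N : ℝ) + 1)⁻¹ then 1 else 0

/-- The theoretical norm `(E g(X_α)²)^{1/2}` of a function `g` of the coordinate `α`, where `X` has
law `ν`. -/
def theoNorm {d : ℕ} (ν : Measure (Fin d → ℝ)) (α : Fin d) (g : ℝ → ℝ) : ℝ :=
  Real.sqrt (∫ x, g (x α) ^ 2 ∂ν)

/-- The spline `b_{J,α} = I_{J,α} - (‖I_{J,α}‖ / ‖I_{J-1,α}‖) I_{J-1,α}`, `J = 1, …, N`, where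
`I_{0,α}, …, I_{N,α}` are the indicators of the successive intervals. The index
`J : Fin N` stands for `J + 1`. -/
def splineb {d : ℕ} (ν : Measure (Fin d → ℝ)) (N : ℕ) (α : Fin d) (J : Fin N) (t : ℝ) : ℝ :=
  cell N ((J : ℕ) + 1) t
    - theoNorm ν α (cell N ((J : ℕ) + 1)) / theoNorm ν α (cell N (J : ℕ)) * cell N (J : ℕ) t

/-- The standardized spline `B_{J,α} = b_{J,α} / ‖b_{J,α}‖`. -/
def splineB {d : ℕ} (ν : Measure (Fin d → ℝ)) (N : ℕ) (α : Fin d) (J : Fin N) (t : ℝ) : ℝ :=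
  splineb ν N α J t / theoNorm ν α (splineb ν N α J)

/-- `∑_J l_{J,α} B_{J,α}(t)`, the uncentered component `α` of the additive spline with
coefficients `l`. -/
def splineComponent {d : ℕ} (ν : Measure (Fin d → ℝ)) (N : ℕ) (l : Fin d → Fin N → ℝ)
    (α : Fin d) (t : ℝ) : ℝ :=
  ∑ J, l α J * splineB ν N α J t

/-! ### The estimators

The data `(X 0, Y 0), …, (X (n - 1), Y (n - 1))` are the first `n` terms of two sequences. -/

/-- The residual sum of squares of the additive spline with constant `l₀` and coefficients `l`. -/
def residualSS {d : ℕ} (ν : Measure (Fin d → ℝ)) (N n : ℕ) (X : ℕ → Fin d → ℝ) (Y : ℕ → ℝ)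
    (l₀ : ℝ) (l : Fin d → Fin N → ℝ) : ℝ :=
  ∑ i ∈ Finset.range n, (Y i - l₀ - ∑ α, splineComponent ν N l α (X i α)) ^ 2

/-- `(l₀, l)` solves the least squares problem that defines the spline estimator. -/
def IsLeastSquares {d : ℕ} (ν : Measure (Fin d → ℝ)) (N n : ℕ) (X : ℕ → Fin d → ℝ) (Y : ℕ → ℝ)
    (l₀ : ℝ) (l : Fin d → Fin N → ℝ) : Prop :=
  ∀ (k₀ : ℝ) (k : Fin d → Fin N → ℝ),
    residualSS ν N n X Y l₀ l ≤ residualSS ν N n X Y k₀ k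

/-- The pilot estimator of the component `α`: the spline component, centered empirically. -/
def pilot {d : ℕ} (ν : Measure (Fin d → ℝ)) (N n : ℕ) (X : ℕ → Fin d → ℝ)
    (l : Fin d → Fin N → ℝ) (α : Fin d) (t : ℝ) : ℝ :=
  splineComponent ν N l α t
    - (n : ℝ)⁻¹ * ∑ i ∈ Finset.range n, splineComponent ν N l α (X i α)

/-- The estimator of the constant, i.e. the sample mean of the responses. -/
def sampleMean (n : ℕ) (Y : ℕ → ℝ) : ℝ := (n : ℝ)⁻¹ * ∑ i ∈ Finset.range n, Y i

/-- The pseudo-response: the response `Y i` minus the sample mean and minus the pilot estimates of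
all the components other than `α`. -/
def pseudoResponse {d : ℕ} (ν : Measure (Fin d → ℝ)) (N n : ℕ) (X : ℕ → Fin d → ℝ) (Y : ℕ → ℝ)
    (l : Fin d → Fin N → ℝ) (α : Fin d) (i : ℕ) : ℝ :=
  Y i - sampleMean n Y - ∑ β ∈ Finset.univ.erase α, pilot ν N n X l β (X i β)

/-- `K_h(u) = K(u / h) / h`. -/
def scaledKernel (K : ℝ → ℝ) (h u : ℝ) : ℝ := K (u / h) / h

/-- The spline-backfitted kernel estimator of the component `α` at `t`: the Nadaraya-Watson
smoother of the pseudo-responses. -/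
def spbkComponent {d : ℕ} (ν : Measure (Fin d → ℝ)) (K : ℝ → ℝ) (h : ℝ) (N n : ℕ)
    (X : ℕ → Fin d → ℝ) (Y : ℕ → ℝ) (l : Fin d → Fin N → ℝ) (α : Fin d) (t : ℝ) : ℝ :=
  (∑ i ∈ Finset.range n, scaledKernel K h (X i α - t) * pseudoResponse ν N n X Y l α i)
    / ∑ i ∈ Finset.range n, scaledKernel K h (X i α - t)

/-- The spline-backfitted kernel estimator of the additive regression function at `x`. -/
def spbk {d : ℕ} (ν : Measure (Fin d → ℝ)) (K : ℝ → ℝ) (h : ℝ) (N n : ℕ)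
    (X : ℕ → Fin d → ℝ) (Y : ℕ → ℝ) (l : Fin d → Fin N → ℝ) (x : Fin d → ℝ) : ℝ :=
  sampleMean n Y + ∑ α, spbkComponent ν K h N n X Y l α (x α)

/-! ### The regression function, the asymptotic bias and the asymptotic variance -/

/-- The additive regression function `m(x) = c + ∑_α m_α(x_α)`. -/
def additive {d : ℕ} (c : ℝ) (m : Fin d → ℝ → ℝ) (x : Fin d → ℝ) : ℝ := c + ∑ α, m α (x α)

/-- `b_α(t) = ∫ u² K(u) du {m_α''(t) f_α(t) / 2 + m_α'(t) f_α'(t)} / f_α(t)`, with derivatives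
relative to `[0,1]`. -/
def biasComponent {d : ℕ} (K : ℝ → ℝ) (m : Fin d → ℝ → ℝ) (f : (Fin d → ℝ) → ℝ)
    (α : Fin d) (t : ℝ) : ℝ :=
  (∫ u, u ^ 2 * K u) *
    (iteratedDerivWithin 2 (m α) (Set.Icc 0 1) t * marginalDensity f α t / 2
      + derivWithin (m α) (Set.Icc 0 1) t * derivWithin (marginalDensity f α) (Set.Icc 0 1) t)
    / marginalDensity f α t

/-- `v_α²(t) = ∫ K² · E[σ²(X) | X_α = t] / f_α(t)`. -/
def varComponent {d : ℕ} (K : ℝ → ℝ) (s f : (Fin d → ℝ) → ℝ) (α : Fin d) (t : ℝ) : ℝ :=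
  (∫ u, K u ^ 2) * condSecondMoment f s α t / marginalDensity f α t

/-- `b(x) = ∑_α b_α(x_α)`. -/
def bias {d : ℕ} (K : ℝ → ℝ) (m : Fin d → ℝ → ℝ) (f : (Fin d → ℝ) → ℝ) (x : Fin d → ℝ) : ℝ :=
  ∑ α, biasComponent K m f α (x α)

/-- `v²(x) = ∑_α v_α²(x_α)`. -/
def variance {d : ℕ} (K : ℝ → ℝ) (s f : (Fin d → ℝ) → ℝ) (x : Fin d → ℝ) : ℝ :=
  ∑ α, varComponent K s f α (x α)

/-! ### Assumptions -/

/-- The data follow the additive model `Y i = c + ∑_α m_α(X i α) + s(X i) ε i`; the components have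
mean zero, for identifiability, and are of class `C²` on `[0,1]`. -/
structure AdditiveModel {Ω : Type*} [MeasurableSpace Ω] (P : Measure Ω) {d : ℕ}
    (X : ℕ → Ω → Fin d → ℝ) (ε Y : ℕ → Ω → ℝ) (c : ℝ) (m : Fin d → ℝ → ℝ)
    (s : (Fin d → ℝ) → ℝ) : Prop where
  measurable_X : ∀ i, Measurable (X i)
  measurable_ε : ∀ i, Measurable (ε i)
  measurable_Y : ∀ i, Measurable (Y i)
  model : ∀ i, ∀ᵐ ω ∂P, Y i ω = additive c m (X i ω) + s (X i ω) * ε i ω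
  centered : ∀ i α, ∫ ω, m α (X i ω α) ∂P = 0
  smooth : ∀ α, ContDiffOn ℝ 2 (m α) (Set.Icc 0 1)

/-- Geometric `α`-mixing of the process `Z i = (X i, ε i)`. -/
def GeometricMixing {Ω : Type*} [MeasurableSpace Ω] (P : Measure Ω) {d : ℕ}
    (X : ℕ → Ω → Fin d → ℝ) (ε : ℕ → Ω → ℝ) : Prop :=
  ∃ K₀ > (0 : ℝ), ∃ l₀ > (0 : ℝ), ∀ k : ℕ, 1 ≤ k →
    alphaMixingCoeff P (fun i ω => (X i ω, ε i ω)) k ≤ K₀ * Real.exp (-l₀ * k)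

/-- The assumptions on the noise `ε` and on the conditional standard deviation `s`. Conditionally
on the predictors, `ε` is a white noise: centered, with unit variance and with no correlation
between different times; in addition, its conditional moments of order `2 + δ` are bounded for
some `δ > 1/2`. -/
structure NoiseAssumption {Ω : Type*} [MeasurableSpace Ω] (P : Measure Ω) {d : ℕ}
    (X : ℕ → Ω → Fin d → ℝ) (ε : ℕ → Ω → ℝ) (s : (Fin d → ℝ) → ℝ) : Prop where
  mean : ∀ i, P[ε i | MeasurableSpace.comap (X i) inferInstance] =ᵐ[P] fun _ => 0
  secondMoment : ∀ i,
    P[fun ω => ε i ω ^ 2 | MeasurableSpace.comap (X i) inferInstance] =ᵐ[P] fun _ => 1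
  uncorrelated : ∀ i j, i ≠ j →
    P[fun ω => ε i ω * ε j ω |
      MeasurableSpace.comap (fun ω => (X i ω, X j ω)) inferInstance] =ᵐ[P] fun _ => 0
  highMoment : ∃ δ > (1 / 2 : ℝ), ∃ M : ℝ, ∀ i,
    Integrable (fun ω => |ε i ω| ^ (2 + δ)) P ∧
    ∀ᵐ ω ∂P,
      (P[fun ω => |ε i ω| ^ (2 + δ) | MeasurableSpace.comap (X i) inferInstance]) ω < M
  continuous_s : ContinuousOn s (cube d)
  bounds_s : ∃ c₁ > (0 : ℝ), ∃ c₂ : ℝ, ∀ x ∈ cube d, c₁ ≤ s x ∧ s x ≤ c₂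

/-- Each predictor vector `X i` has the density `f` on the cube; `f` is continuous and
bounded away from zero and infinity there, and its marginal densities are `C¹` on `[0,1]`. (The
marginal densities inherit the bounds of `f`.) -/
structure DensityAssumption {Ω : Type*} [MeasurableSpace Ω] (P : Measure Ω) {d : ℕ}
    (X : ℕ → Ω → Fin d → ℝ) (f : (Fin d → ℝ) → ℝ) : Prop where
  law : ∀ i, P.map (X i) = densityLaw f
  continuous_f : ContinuousOn f (cube d)
  bounds_f : ∃ c₁ > (0 : ℝ), ∃ c₂ : ℝ, ∀ x ∈ cube d, c₁ ≤ f x ∧ f x ≤ c₂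
  smooth_marginal : ∀ α, ContDiffOn ℝ 1 (marginalDensity f α) (Set.Icc 0 1)

/-- `K` is a symmetric probability density supported on `[-1,1]` and Lipschitz there (hence
bounded). -/
structure KernelAssumption (K : ℝ → ℝ) : Prop where
  lipschitz : ∃ C, LipschitzOnWith C K (Set.Icc (-1) 1)
  nonneg : ∀ u, 0 ≤ K u
  symmetric : ∀ u, K (-u) = K u
  support : ∀ u, u ∉ Set.Icc (-1 : ℝ) 1 → K u = 0
  integral_one : ∫ u, K u = 1

/-- The bandwidths satisfy `h n ∼ n^{-1/5}`, up to constants. -/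
def BandwidthAssumption (h : ℕ → ℝ) : Prop :=
  ∃ c₁ > (0 : ℝ), ∃ c₂ > (0 : ℝ), ∀ᶠ n : ℕ in atTop,
    c₁ * (n : ℝ) ^ (-(1 / 5) : ℝ) ≤ h n ∧ h n ≤ c₂ * (n : ℝ) ^ (-(1 / 5) : ℝ)

/-- The numbers of interior knots satisfy `N n ∼ n^{2/5} log n`, up to constants. -/
def KnotAssumption (N : ℕ → ℕ) : Prop :=
  ∃ c₁ > (0 : ℝ), ∃ c₂ > (0 : ℝ), ∀ᶠ n : ℕ in atTop,
    c₁ * ((n : ℝ) ^ (2 / 5 : ℝ) * Real.log n) ≤ (N n : ℝ) ∧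
      (N n : ℝ) ≤ c₂ * ((n : ℝ) ^ (2 / 5 : ℝ) * Real.log n)

end SPBK

end

/-! The estimation error splits by exact algebra (`spbkComponent_eq`). For each coordinate `α` it is
a quotient: the denominator is a kernel density estimate, and the numerator consists of a smoothing
bias, a kernel average of the noise, and kernel averages of the pilot errors of the other
components. The first two are those of a smoother that knows the other components; they produce the
bias `b h²` and the Gaussian limit. Everything else must be `o(n^{-2/5})`, since `√(nh)` is of order
`n^{2/5}`.

Gaussian part. Given the predictors the noise is white, so weighted noise terms are exactly
uncorrelated, and mixing is needed only to decouple distant blocks. The characteristic functions of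
big blocks separated by gaps are multiplied (`norm_charFun_sum_sub_le`,
`tendstoInDistribution_of_mixing`); the expansion on one block uses a moment of order `5/2`,
available because `δ > 1/2`. Kernel weights in different coordinates are asymptotically uncorrelated
(`tendsto_kernel_cross`), so the variances of the components add up.

Pilot part, the heart of the proof. The bound available for the pilot error itself is worse than
`n^{-2/5}`, so this error has to be averaged out. Least squares over the splines `B_{J,α}` and the
constants has residuals orthogonal to all step functions (`IsLeastSquares.sum_residual_mul_cell`),
so the normal equations can be written with the indicators of the cells. Subtracting the
interpolation of the components at the knots leaves a coefficient vector `δ` driven by the noise and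
by a bias of order `1/(N+1) + |Ȳ - c|`, which is `o(n^{-2/5})` thanks to the factor `log n` in `N`.
Comparison with the uniform law on the cube, under which the coordinates are independent, shows that
the additive basis is stable (`sum_integral_sq_le`, `sum_sq_le_gram`), and this gives a crude bound
on `∑ δ²` (`isBigO_sum_sq_coeff`).

Up to sampling and interpolation errors, the kernel average of the pilot error is a linear
functional of `δ`, bounded in `L²` uniformly in `N` and in small `h` because `α ≠ β`
(`abs_sum_kernelCoeff_mul_le`). It is represented through the Gram form augmented by the products of
component means; the augmentation is needed because constants can be shifted between components. The
representer is a deterministic spline of bounded norm (`exists_representer`). Testing the normal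
equations against it turns the functional into a small bias plus one noise average of order nearly
`n^{-1/2}` (`abs_functional_le`, `isLittleO_kernel_pilot`).

Sampling errors are controlled in mean square, by a covariance inequality at lag `n^{1/100}`
(`isBigO_sum_sq_avg_sub`). Statements in probability are `O` and `o` along the filter `whp`, with
explicit exponents whose slack absorbs logarithms and constants. -/

namespace SPBK

/-! ### Covariance inequalities under strong mixing. -/

section Mixing

variable {Ω : Type*} {m0 : MeasurableSpace Ω} {P : Measure Ω} [IsProbabilityMeasure P]

/-- A covariance with a bounded `m`-measurable variable is controlled by the covariance with the
indicator of a set of `m`. -/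
lemma exists_measurableSet_abs_cov_le {m : MeasurableSpace Ω} (hm : m ≤ m0) {U V : Ω → ℝ} {B : ℝ}
    (hU : StronglyMeasurable[m] U) (hB : ∀ ω, |U ω| ≤ B) (hV : Integrable V P) :
    ∃ A, MeasurableSet[m] A ∧ |∫ ω, U ω * V ω ∂P - (∫ ω, U ω ∂P) * ∫ ω, V ω ∂P| ≤
      2 * B * |∫ ω in A, V ω ∂P - P.real A * ∫ ω, V ω ∂P| := by
  set v : ℝ := ∫ ω, V ω ∂P with hv
  set W : Ω → ℝ := fun ω => V ω - v with hW
  have hWi : Integrable W P := hV.sub (integrable_const _)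
  set G : Ω → ℝ := P[W|m] with hG
  have hGm : StronglyMeasurable[m] G := stronglyMeasurable_condExp
  have hGi : Integrable G P := integrable_condExp
  obtain ⟨ω₀⟩ : Nonempty Ω := nonempty_of_isProbabilityMeasure P
  have hB0 : 0 ≤ B := (abs_nonneg _).trans (hB ω₀)
  have hUb : ∀ᵐ ω ∂P, ‖U ω‖ ≤ B := ae_of_all _ fun ω => by simpa using hB ω
  have hUW : Integrable (fun ω => U ω * W ω) P :=
    hWi.bdd_mul (hU.mono hm).aestronglyMeasurable hUb
  have hUG : Integrable (fun ω => U ω * G ω) P :=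
    hGi.bdd_mul (hU.mono hm).aestronglyMeasurable hUb
  have hUi : Integrable U P :=
    Integrable.of_bound (hU.mono hm).aestronglyMeasurable B hUb
  have hUV : Integrable (fun ω => U ω * V ω) P :=
    hV.bdd_mul (hU.mono hm).aestronglyMeasurable hUb
  have h1 : ∫ ω, U ω * V ω ∂P - (∫ ω, U ω ∂P) * v = ∫ ω, U ω * G ω ∂P := by
    have e1 : ∫ ω, U ω * W ω ∂P = ∫ ω, U ω * V ω ∂P - (∫ ω, U ω ∂P) * v := by
      rw [← integral_mul_const, ← integral_sub hUV (hUi.mul_const _)]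
      congr 1; ext ω; simp only [hW]; ring
    have e2 : P[fun ω => U ω * W ω|m] =ᵐ[P] fun ω => U ω * G ω :=
      condExp_mul_of_stronglyMeasurable_left hU hUW hWi
    rw [← e1, ← integral_condExp hm, integral_congr_ae e2]
  -- `G` has mean zero, so `E|G|` is twice its integral over the set where it is nonnegative, and
  -- that integral is the covariance of `V` with the indicator of the set.
  set A : Set Ω := {ω | 0 ≤ G ω} with hA
  have hAm : MeasurableSet[m] A := measurableSet_le measurable_const hGm.measurable
  refine ⟨A, hAm, ?_⟩
  have hAm0 := hm _ hAm
  have hG0 : ∫ ω, G ω ∂P = 0 := by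
    rw [hG, integral_condExp hm, hW, integral_sub hV (integrable_const _)]
    simp [hv]
  have hsplit := integral_add_compl hAm0 hGi
  have habs : ∫ ω, |G ω| ∂P = 2 * ∫ ω in A, G ω ∂P := by
    rw [← integral_add_compl hAm0 hGi.abs]
    have e1 : ∫ ω in A, |G ω| ∂P = ∫ ω in A, G ω ∂P :=
      setIntegral_congr_fun hAm0 fun ω hω => abs_of_nonneg hω
    have e2 : ∫ ω in Aᶜ, |G ω| ∂P = - ∫ ω in Aᶜ, G ω ∂P := by
      rw [← integral_neg]
      exact setIntegral_congr_fun hAm0.compl fun ω hω => abs_of_neg (not_le.1 hω)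
    rw [e1, e2]; linarith
  have hAW : ∫ ω in A, G ω ∂P = ∫ ω in A, V ω ∂P - P.real A * v := by
    rw [hG, setIntegral_condExp hm hWi hAm, hW, integral_sub hV.integrableOn
      (integrable_const _).integrableOn]
    simp
  rw [h1, ← hAW]
  calc |∫ ω, U ω * G ω ∂P| ≤ ∫ ω, |U ω * G ω| ∂P := abs_integral_le_integral_abs
    _ ≤ ∫ ω, B * |G ω| ∂P := by
        refine integral_mono hUG.abs (hGi.abs.const_mul _) fun ω => ?_
        simp only [abs_mul]
        exact mul_le_mul_of_nonneg_right (hB ω) (abs_nonneg _)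
    _ = 2 * B * ∫ ω in A, G ω ∂P := by rw [integral_const_mul, habs]; ring
    _ ≤ _ := mul_le_mul_of_nonneg_left (le_abs_self _) (by positivity)

/-- The covariance inequality for bounded variables under `α`-mixing. -/
lemma abs_cov_le_of_mixing {m₁ m₂ : MeasurableSpace Ω} (h₁ : m₁ ≤ m0) (h₂ : m₂ ≤ m0) {a : ℝ}
    (hmix : ∀ B C, MeasurableSet[m₁] B → MeasurableSet[m₂] C →
      |P.real (B ∩ C) - P.real B * P.real C| ≤ a)
    {U V : Ω → ℝ} {b₁ b₂ : ℝ}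
    (hU : StronglyMeasurable[m₁] U) (hV : StronglyMeasurable[m₂] V)
    (hb₁ : ∀ ω, |U ω| ≤ b₁) (hb₂ : ∀ ω, |V ω| ≤ b₂) :
    |∫ ω, U ω * V ω ∂P - (∫ ω, U ω ∂P) * ∫ ω, V ω ∂P| ≤ 4 * b₁ * b₂ * a := by
  obtain ⟨ω₀⟩ : Nonempty Ω := nonempty_of_isProbabilityMeasure P
  have hb₁0 : 0 ≤ b₁ := (abs_nonneg _).trans (hb₁ ω₀)
  have hb₂0 : 0 ≤ b₂ := (abs_nonneg _).trans (hb₂ ω₀)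
  have hVi : Integrable V P := Integrable.of_bound (hV.mono h₂).aestronglyMeasurable b₂
    (ae_of_all _ fun ω => by simpa using hb₂ ω)
  obtain ⟨A, hA, hA'⟩ := exists_measurableSet_abs_cov_le h₁ hU hb₁ hVi
  have hAm0 := h₁ _ hA
  have hAi : Integrable (A.indicator fun _ => (1 : ℝ)) P := (integrable_const _).indicator hAm0
  -- The same reduction with the roles exchanged: `V` is now the bounded measurable factor and the
  -- indicator of `A` the other variable.
  obtain ⟨C, hC, hC'⟩ := exists_measurableSet_abs_cov_le h₂ hV hb₂ hAi
  have hCm0 := h₂ _ hC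
  have e1 : ∫ ω, V ω * A.indicator (fun _ => (1 : ℝ)) ω ∂P = ∫ ω in A, V ω ∂P := by
    rw [← integral_indicator hAm0]
    congr 1; ext ω; by_cases h : ω ∈ A <;> simp [h]
  have e2 : ∫ ω, A.indicator (fun _ => (1 : ℝ)) ω ∂P = P.real A := by
    rw [integral_indicator hAm0]; simp
  have e3 : ∫ ω in C, A.indicator (fun _ => (1 : ℝ)) ω ∂P = P.real (A ∩ C) := by
    rw [integral_indicator hAm0, Measure.restrict_restrict hAm0]
    simp
  rw [e1, e2, e3] at hC'
  calc _ ≤ 2 * b₁ * |∫ ω in A, V ω ∂P - P.real A * ∫ ω, V ω ∂P| := hA'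
    _ ≤ 2 * b₁ * (2 * b₂ * |P.real (A ∩ C) - P.real C * P.real A|) := by
        refine mul_le_mul_of_nonneg_left ?_ (by positivity)
        rwa [mul_comm (P.real A)]
    _ ≤ 2 * b₁ * (2 * b₂ * a) := by
        gcongr
        rw [mul_comm (P.real C)]
        exact hmix A C hA hC
    _ = _ := by ring

omit [IsProbabilityMeasure P] in
lemma re_integral_eq {f : Ω → ℂ} (hf : Integrable f P) : (∫ ω, f ω ∂P).re = ∫ ω, (f ω).re ∂P :=
  (integral_re hf).symm

omit [IsProbabilityMeasure P] in
lemma im_integral_eq {f : Ω → ℂ} (hf : Integrable f P) : (∫ ω, f ω ∂P).im = ∫ ω, (f ω).im ∂P :=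
  (integral_im hf).symm

/-- The covariance inequality for complex variables bounded by one. -/
lemma norm_cov_le_of_mixing {m₁ m₂ : MeasurableSpace Ω} (h₁ : m₁ ≤ m0) (h₂ : m₂ ≤ m0) {a : ℝ}
    (hmix : ∀ B C, MeasurableSet[m₁] B → MeasurableSet[m₂] C →
      |P.real (B ∩ C) - P.real B * P.real C| ≤ a)
    {U V : Ω → ℂ} (hU : StronglyMeasurable[m₁] U) (hV : StronglyMeasurable[m₂] V)
    (hb₁ : ∀ ω, ‖U ω‖ ≤ 1) (hb₂ : ∀ ω, ‖V ω‖ ≤ 1) :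
    ‖∫ ω, U ω * V ω ∂P - (∫ ω, U ω ∂P) * ∫ ω, V ω ∂P‖ ≤ 16 * a := by
  have hUr : StronglyMeasurable[m₁] fun ω => (U ω).re :=
    Complex.continuous_re.comp_stronglyMeasurable hU
  have hUi : StronglyMeasurable[m₁] fun ω => (U ω).im :=
    Complex.continuous_im.comp_stronglyMeasurable hU
  have hVr : StronglyMeasurable[m₂] fun ω => (V ω).re :=
    Complex.continuous_re.comp_stronglyMeasurable hV
  have hVi : StronglyMeasurable[m₂] fun ω => (V ω).im :=
    Complex.continuous_im.comp_stronglyMeasurable hV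
  have bUr : ∀ ω, |(U ω).re| ≤ 1 := fun ω => (Complex.abs_re_le_norm _).trans (hb₁ ω)
  have bUi : ∀ ω, |(U ω).im| ≤ 1 := fun ω => (Complex.abs_im_le_norm _).trans (hb₁ ω)
  have bVr : ∀ ω, |(V ω).re| ≤ 1 := fun ω => (Complex.abs_re_le_norm _).trans (hb₂ ω)
  have bVi : ∀ ω, |(V ω).im| ≤ 1 := fun ω => (Complex.abs_im_le_norm _).trans (hb₂ ω)
  have iU : Integrable U P := Integrable.of_bound (hU.mono h₁).aestronglyMeasurable 1
    (ae_of_all _ hb₁)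
  have iV : Integrable V P := Integrable.of_bound (hV.mono h₂).aestronglyMeasurable 1
    (ae_of_all _ hb₂)
  have iUV : Integrable (fun ω => U ω * V ω) P :=
    iV.bdd_mul (hU.mono h₁).aestronglyMeasurable (ae_of_all _ hb₁)
  have hm₁ : ∀ {u : Ω → ℝ}, StronglyMeasurable[m₁] u → (∀ ω, |u ω| ≤ 1) → Integrable u P :=
    fun hu hb => Integrable.of_bound (hu.mono h₁).aestronglyMeasurable 1
      (ae_of_all _ fun ω => by simpa using hb ω)
  have hm₂ : ∀ {u : Ω → ℝ}, StronglyMeasurable[m₂] u → (∀ ω, |u ω| ≤ 1) → Integrable u P :=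
    fun hu hb => Integrable.of_bound (hu.mono h₂).aestronglyMeasurable 1
      (ae_of_all _ fun ω => by simpa using hb ω)
  have hmm : ∀ {u v : Ω → ℝ}, StronglyMeasurable[m₁] u → (∀ ω, |u ω| ≤ 1) →
      StronglyMeasurable[m₂] v → (∀ ω, |v ω| ≤ 1) → Integrable (fun ω => u ω * v ω) P :=
    fun hu hb hv hb' => (hm₂ hv hb').bdd_mul (hu.mono h₁).aestronglyMeasurable
      (ae_of_all _ fun ω => by simpa using hb ω)
  have c1 := abs_cov_le_of_mixing h₁ h₂ hmix hUr hVr bUr bVr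
  have c2 := abs_cov_le_of_mixing h₁ h₂ hmix hUi hVi bUi bVi
  have c3 := abs_cov_le_of_mixing h₁ h₂ hmix hUr hVi bUr bVi
  have c4 := abs_cov_le_of_mixing h₁ h₂ hmix hUi hVr bUi bVr
  -- The real and the imaginary part are each a combination of two real covariances, each at most `4
  -- * a`; this gives `8 * a + 8 * a`.
  refine (Complex.norm_le_abs_re_add_abs_im _).trans ?_
  rw [Complex.sub_re, Complex.sub_im, Complex.mul_re, Complex.mul_im, re_integral_eq iUV, im_integral_eq iUV,
    re_integral_eq iU, im_integral_eq iU, re_integral_eq iV, im_integral_eq iV]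
  simp only [Complex.mul_re, Complex.mul_im]
  rw [integral_sub (hmm hUr bUr hVr bVr) (hmm hUi bUi hVi bVi),
    integral_add (hmm hUr bUr hVi bVi) (hmm hUi bUi hVr bVr)]
  rw [abs_le] at c1 c2 c3 c4
  have := c1.1; have := c1.2; have := c2.1; have := c2.2
  have := c3.1; have := c3.2; have := c4.1; have := c4.2
  have d1 : ∀ p q : ℝ, |p| ≤ 8 * a → |q| ≤ 8 * a → |p| + |q| ≤ 16 * a := fun p q h h' => by
    linarith
  apply d1 <;> rw [abs_le] <;> constructor <;> linarith

end Mixing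

/-! ### The mixing coefficient of a process. -/

section Coefficient

variable {Ω E : Type*} [mΩ : MeasurableSpace Ω] [MeasurableSpace E] {P : Measure Ω}
  [IsProbabilityMeasure P] {Z : ℕ → Ω → E}

lemma generatedBy_le (hZ : ∀ i, Measurable (Z i)) (S : Set ℕ) : generatedBy Z S ≤ mΩ :=
  iSup₂_le fun i _ => (hZ i).comap_le

omit mΩ in
lemma comap_le_generatedBy {S : Set ℕ} {i : ℕ} (hi : i ∈ S) :
    MeasurableSpace.comap (Z i) inferInstance ≤ generatedBy Z S :=
  le_iSup₂ (f := fun s (_ : s ∈ S) => MeasurableSpace.comap (Z s) inferInstance) i hi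

lemma measurable_generatedBy {S : Set ℕ} {i : ℕ} (hi : i ∈ S) :
    Measurable[generatedBy Z S] (Z i) :=
  measurable_iff_comap_le.2 (comap_le_generatedBy hi)

lemma abs_measureReal_inter_sub_le {k t : ℕ} {B C : Set Ω}
    (hB : MeasurableSet[generatedBy Z (Set.Iic t)] B)
    (hC : MeasurableSet[generatedBy Z (Set.Ici (t + k))] C) :
    |P.real (B ∩ C) - P.real B * P.real C| ≤ alphaMixingCoeff P Z k := by
  refine le_csSup ⟨1, ?_⟩ ⟨t, B, C, hB, hC, rfl⟩
  rintro r ⟨t, B, C, -, -, rfl⟩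
  have h1 := measureReal_le_one (μ := P) (s := B)
  have h2 := measureReal_le_one (μ := P) (s := C)
  have h3 := measureReal_le_one (μ := P) (s := B ∩ C)
  have h4 := measureReal_nonneg (μ := P) (s := B)
  have h5 := measureReal_nonneg (μ := P) (s := C)
  have h6 := measureReal_nonneg (μ := P) (s := B ∩ C)
  rw [abs_le]; constructor <;> nlinarith

lemma alphaMixingCoeff_nonneg (k : ℕ) : 0 ≤ alphaMixingCoeff P Z k :=
  (abs_nonneg _).trans (abs_measureReal_inter_sub_le (P := P) (Z := Z) (t := 0) (B := ∅) (C := ∅)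
    (@MeasurableSet.empty _ (generatedBy Z _)) (@MeasurableSet.empty _ (generatedBy Z _)))

/-- The covariance of two bounded functions of the process at times at least `k` apart. -/
lemma abs_cov_comp_le (hZ : ∀ i, Measurable (Z i)) {φ : E → ℝ} (hφ : Measurable φ) {B : ℝ}
    (hB : ∀ z, |φ z| ≤ B) {i j k : ℕ} (hij : i + k ≤ j) :
    |∫ ω, φ (Z i ω) * φ (Z j ω) ∂P - (∫ ω, φ (Z i ω) ∂P) * ∫ ω, φ (Z j ω) ∂P| ≤
      4 * B ^ 2 * alphaMixingCoeff P Z k := by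
  have := abs_cov_le_of_mixing (P := P) (generatedBy_le hZ (Set.Iic i))
    (generatedBy_le hZ (Set.Ici (i + k))) (fun B C hB hC => abs_measureReal_inter_sub_le hB hC)
    (U := fun ω => φ (Z i ω)) (V := fun ω => φ (Z j ω)) (b₁ := B) (b₂ := B)
    (hφ.comp (measurable_generatedBy (by simp))).stronglyMeasurable
    (hφ.comp (measurable_generatedBy (by simpa using hij))).stronglyMeasurable
    (fun ω => hB _) (fun ω => hB _)
  linarith

end Coefficient

/-! ### Variance of sample averages under mixing. -/

section Averages

variable {Ω E : Type*} [MeasurableSpace Ω] [MeasurableSpace E] {P : Measure Ω}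
  [IsProbabilityMeasure P]

/-- Counts the indices too close to `i` for mixing to be of use; their covariances are bounded by
the second moment instead. -/
lemma card_filter_near_le (n L i : ℕ) :
    ((Finset.range n).filter fun j => ¬ (i + L ≤ j ∨ j + L ≤ i)).card ≤ 2 * L + 1 := by
  have : ((Finset.range n).filter fun j => ¬ (i + L ≤ j ∨ j + L ≤ i)) ⊆
      Finset.Icc (i - L) (i + L) := by
    intro j hj
    simp at hj ⊢
    omega
  refine (Finset.card_le_card this).trans ?_
  simp; omega

/-- The variance of the average of a bounded function of a mixing process. -/
lemma integral_sq_average_sub_le {Z : ℕ → Ω → E} (hZ : ∀ i, Measurable (Z i)) {φ : E → ℝ}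
    (hφ : Measurable φ) {B μ q a : ℝ} (hB : ∀ z, |φ z| ≤ B) (hμ : ∀ i, ∫ ω, φ (Z i ω) ∂P = μ)
    (hq : ∀ i, ∫ ω, φ (Z i ω) ^ 2 ∂P = q) {L : ℕ} (ha : alphaMixingCoeff P Z L ≤ a)
    {n : ℕ} (hn : 0 < n) :
    ∫ ω, ((n : ℝ)⁻¹ * ∑ i ∈ Finset.range n, φ (Z i ω) - μ) ^ 2 ∂P ≤
      (2 * L + 1) / n * q + 4 * B ^ 2 * a := by
  have hn' : (0 : ℝ) < n := by exact_mod_cast hn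
  have hm : ∀ i, Measurable fun ω => φ (Z i ω) := fun i => hφ.comp (hZ i)
  have hb : ∀ i, ∀ᵐ ω ∂P, ‖φ (Z i ω)‖ ≤ B := fun i => ae_of_all _ fun ω => by simpa using hB _
  have hi : ∀ i, Integrable (fun ω => φ (Z i ω)) P := fun i =>
    Integrable.of_bound (hm i).aestronglyMeasurable B (hb i)
  have hii : ∀ i j, Integrable (fun ω => φ (Z i ω) * φ (Z j ω)) P := fun i j =>
    (hi j).bdd_mul (hm i).aestronglyMeasurable (hb i)
  have hq0 : 0 ≤ q := by rw [← hq 0]; exact integral_nonneg fun ω => sq_nonneg _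
  have ha0 : 0 ≤ a := (alphaMixingCoeff_nonneg L).trans ha
  have hiic : ∀ i j, Integrable (fun ω => (φ (Z i ω) - μ) * (φ (Z j ω) - μ)) P := fun i j => by
    have : (fun ω => (φ (Z i ω) - μ) * (φ (Z j ω) - μ)) =
        fun ω => φ (Z i ω) * φ (Z j ω) - μ * φ (Z i ω) - μ * φ (Z j ω) + μ ^ 2 := by
      ext ω; ring
    rw [this]
    exact (((hii i j).sub ((hi i).const_mul _)).sub ((hi j).const_mul _)).add
      (integrable_const _)
  have hc : ∀ i j, ∫ ω, (φ (Z i ω) - μ) * (φ (Z j ω) - μ) ∂P =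
      ∫ ω, φ (Z i ω) * φ (Z j ω) ∂P - μ * μ := fun i j => by
    have : (fun ω => (φ (Z i ω) - μ) * (φ (Z j ω) - μ)) =
        fun ω => φ (Z i ω) * φ (Z j ω) - μ * φ (Z i ω) - μ * φ (Z j ω) + μ ^ 2 := by
      ext ω; ring
    have i1 := (hi i).const_mul μ
    have i2 := (hi j).const_mul μ
    have e1 := integral_sub (hii i j) i1
    have e2 := integral_sub ((hii i j).sub i1) i2
    have e3 := integral_add (((hii i j).sub i1).sub i2) (integrable_const (μ ^ 2))
    simp only [Pi.sub_apply] at e2 e3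
    rw [this, e3, e2, e1, integral_const_mul, integral_const_mul, hμ, hμ]
    simp; ring
  -- Pairs at distance at least `L` are handled by mixing, the others by `2ab ≤ a² + b²`. Only the
  -- second bound carries `q`, which may be far smaller than `B ^ 2`.
  have hcov : ∀ i j, ∫ ω, (φ (Z i ω) - μ) * (φ (Z j ω) - μ) ∂P ≤
      if ¬ (i + L ≤ j ∨ j + L ≤ i) then q else 4 * B ^ 2 * a := by
    intro i j
    rw [hc]
    have key : ∀ i j, i + L ≤ j → ∫ ω, φ (Z i ω) * φ (Z j ω) ∂P - μ * μ ≤ 4 * B ^ 2 * a := by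
      intro i j hij
      have h := (abs_le.1 (abs_cov_comp_le (P := P) hZ hφ hB hij)).2
      rw [hμ, hμ] at h
      exact h.trans (mul_le_mul_of_nonneg_left ha (by positivity))
    by_cases h : i + L ≤ j ∨ j + L ≤ i
    · rw [if_neg (not_not.2 h)]
      rcases h with h | h
      · exact key i j h
      · have := key j i h
        simpa [mul_comm] using this
    · rw [if_pos h]
      have h1 : ∫ ω, φ (Z i ω) * φ (Z j ω) ∂P ≤
          ∫ ω, (φ (Z i ω) ^ 2 / 2 + φ (Z j ω) ^ 2 / 2) ∂P := by
        refine integral_mono (hii i j) ?_ fun ω => ?_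
        · have h2 : ∀ i, Integrable (fun ω => φ (Z i ω) ^ 2 / 2) P := fun i => by
            simpa [sq] using (hii i i).div_const 2
          exact (h2 i).add (h2 j)
        · nlinarith [sq_nonneg (φ (Z i ω) - φ (Z j ω))]
      have h2 : ∀ i, Integrable (fun ω => φ (Z i ω) ^ 2 / 2) P := fun i => by
        simpa [sq] using (hii i i).div_const 2
      rw [integral_add (h2 i) (h2 j), integral_div, integral_div, hq, hq] at h1
      nlinarith [sq_nonneg μ]
  have e1 : ∀ ω, ((n : ℝ)⁻¹ * ∑ i ∈ Finset.range n, φ (Z i ω) - μ) ^ 2 =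
      (n : ℝ)⁻¹ ^ 2 * ∑ i ∈ Finset.range n, ∑ j ∈ Finset.range n,
        (φ (Z i ω) - μ) * (φ (Z j ω) - μ) := by
    intro ω
    rw [← Finset.sum_mul_sum, Finset.sum_sub_distrib]
    simp
    field_simp
  simp_rw [e1]
  rw [integral_const_mul, integral_finsetSum _ fun i _ => integrable_finsetSum _ fun j _ => hiic i j]
  have e2 : ∑ i ∈ Finset.range n, ∫ ω, ∑ j ∈ Finset.range n,
      (φ (Z i ω) - μ) * (φ (Z j ω) - μ) ∂P ≤
      ∑ i ∈ Finset.range n, ((2 * L + 1) * q + n * (4 * B ^ 2 * a)) := by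
    refine Finset.sum_le_sum fun i _ => ?_
    rw [integral_finsetSum _ fun j _ => hiic i j]
    refine (Finset.sum_le_sum fun j _ => hcov i j).trans ?_
    rw [Finset.sum_ite, Finset.sum_const, Finset.sum_const, nsmul_eq_mul, nsmul_eq_mul]
    refine add_le_add (mul_le_mul_of_nonneg_right ?_ hq0)
      (mul_le_mul_of_nonneg_right ?_ (by positivity))
    · exact_mod_cast card_filter_near_le n L i
    · exact_mod_cast (Finset.card_filter_le _ _).trans (by simp)
  refine (mul_le_mul_of_nonneg_left e2 (by positivity)).trans (le_of_eq ?_)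
  rw [Finset.sum_const, nsmul_eq_mul, Finset.card_range]
  field_simp

end Averages

/-! ### Moments of weighted noise. -/

section Noise

variable {Ω : Type*} [m0 : MeasurableSpace Ω] {P : Measure Ω} [IsProbabilityMeasure P]

/-- Taking out what is known, when the conditional expectation is constant. -/
lemma integral_mul_of_condExp_eq_const {m : MeasurableSpace Ω} (hm : m ≤ m0) {g u : Ω → ℝ}
    {c B : ℝ} (hg : StronglyMeasurable[m] g) (hB : ∀ ω, |g ω| ≤ B) (hu : Integrable u P)
    (hc : P[u|m] =ᵐ[P] fun _ => c) : ∫ ω, g ω * u ω ∂P = (∫ ω, g ω ∂P) * c := by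
  have hgu : Integrable (fun ω => g ω * u ω) P :=
    hu.bdd_mul (hg.mono hm).aestronglyMeasurable (ae_of_all _ fun ω => by simpa using hB ω)
  have e2 : P[fun ω => g ω * u ω|m] =ᵐ[P] fun ω => g ω * (P[u|m]) ω :=
    condExp_mul_of_stronglyMeasurable_left hg hgu hu
  rw [← integral_condExp hm, integral_congr_ae e2, ← integral_mul_const]
  refine integral_congr_ae ?_
  filter_upwards [hc] with ω hω
  rw [hω]

lemma integral_mul_le_of_condExp_le {m : MeasurableSpace Ω} (hm : m ≤ m0) {g u : Ω → ℝ}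
    {c B : ℝ} (hg : StronglyMeasurable[m] g) (hg0 : ∀ ω, 0 ≤ g ω) (hB : ∀ ω, |g ω| ≤ B)
    (hu : Integrable u P) (hc : ∀ᵐ ω ∂P, (P[u|m]) ω ≤ c) :
    ∫ ω, g ω * u ω ∂P ≤ (∫ ω, g ω ∂P) * c := by
  have hb : ∀ᵐ ω ∂P, ‖g ω‖ ≤ B := ae_of_all _ fun ω => by simpa using hB ω
  have hgu : Integrable (fun ω => g ω * u ω) P :=
    hu.bdd_mul (hg.mono hm).aestronglyMeasurable hb
  have e2 : P[fun ω => g ω * u ω|m] =ᵐ[P] fun ω => g ω * (P[u|m]) ω :=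
    condExp_mul_of_stronglyMeasurable_left hg hgu hu
  rw [← integral_condExp hm, integral_congr_ae e2, ← integral_mul_const]
  refine integral_mono_ae (integrable_condExp.bdd_mul (hg.mono hm).aestronglyMeasurable hb)
    ((Integrable.of_bound (hg.mono hm).aestronglyMeasurable B hb).mul_const _) ?_
  filter_upwards [hc] with ω hω
  exact mul_le_mul_of_nonneg_left hω (hg0 ω)

variable {d : ℕ} {X : ℕ → Ω → Fin d → ℝ} {ε : ℕ → Ω → ℝ} {s : (Fin d → ℝ) → ℝ}

/-- Serves to descend from the assumed order `2 + δ` to the order `5/2`, which lies below it because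
`δ > 1/2`, and to the orders one and two. -/
lemma rpow_le_one_add_rpow {x p q : ℝ} (hx : 0 ≤ x) (hp : 0 < p) (hpq : p ≤ q) :
    x ^ p ≤ 1 + x ^ q := by
  rcases le_total x 1 with h | h
  · have := Real.rpow_le_one hx h hp.le
    have := Real.rpow_nonneg hx q
    linarith
  · have := Real.rpow_le_rpow_of_exponent_le h hpq
    linarith

namespace NoiseAssumption

lemma integrable_rpow (hε : ∀ i, Measurable (ε i)) (hnoise : NoiseAssumption P X ε s) (i : ℕ)
    {p : ℝ} (hp0 : 0 < p) (hp : p ≤ 5 / 2) : Integrable (fun ω => |ε i ω| ^ p) P := by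
  obtain ⟨δ, hδ, M, hM⟩ := hnoise.highMoment
  have := (hM i).1
  refine ((integrable_const (1 : ℝ)).add this).mono'
    (((hε i).abs.pow_const p).aestronglyMeasurable) (ae_of_all _ fun ω => ?_)
  rw [Real.norm_of_nonneg (Real.rpow_nonneg (abs_nonneg _) _)]
  exact rpow_le_one_add_rpow (abs_nonneg _) hp0 (by linarith)

lemma exists_condExp_le (hX : ∀ i, Measurable (X i)) (hε : ∀ i, Measurable (ε i))
    (hnoise : NoiseAssumption P X ε s) : ∃ M : ℝ, 0 ≤ M ∧ ∀ i, ∀ᵐ ω ∂P,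
      (P[fun ω => |ε i ω| ^ (5 / 2 : ℝ) | MeasurableSpace.comap (X i) inferInstance]) ω ≤ M := by
  obtain ⟨δ, hδ, M, hM⟩ := hnoise.highMoment
  refine ⟨|1 + M|, abs_nonneg _, fun i => ?_⟩
  have h1 : P[fun ω => |ε i ω| ^ (5 / 2 : ℝ) | MeasurableSpace.comap (X i) inferInstance] ≤ᵐ[P]
      P[(fun _ => (1 : ℝ)) + fun ω => |ε i ω| ^ (2 + δ) |
        MeasurableSpace.comap (X i) inferInstance] := by
    refine condExp_mono (hnoise.integrable_rpow hε i (by norm_num) le_rfl)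
      ((integrable_const _).add (hM i).1) (ae_of_all _ fun ω => ?_)
    exact rpow_le_one_add_rpow (abs_nonneg _) (by norm_num) (by linarith)
  have h2 := condExp_add (m := MeasurableSpace.comap (X i) inferInstance)
    (integrable_const (1 : ℝ)) (hM i).1
  filter_upwards [h1, h2, (hM i).2] with ω a b c
  rw [b] at a
  rw [Pi.add_apply, condExp_const (hX i).comap_le] at a
  exact (a.trans (by linarith)).trans (le_abs_self _)

lemma integrable_sq (hε : ∀ i, Measurable (ε i)) (hnoise : NoiseAssumption P X ε s) (i : ℕ) :
    Integrable (fun ω => ε i ω ^ 2) P := by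
  have := hnoise.integrable_rpow hε i (p := 2) (by norm_num) (by norm_num)
  simpa using this

lemma integrable (hε : ∀ i, Measurable (ε i)) (hnoise : NoiseAssumption P X ε s) (i : ℕ) :
    Integrable (ε i) P := by
  have := hnoise.integrable_rpow hε i (p := 1) (by norm_num) (by norm_num)
  simp only [Real.rpow_one] at this
  exact (integrable_norm_iff (hε i).aestronglyMeasurable).1 this

lemma integrable_mul (hε : ∀ i, Measurable (ε i)) (hnoise : NoiseAssumption P X ε s) (i j : ℕ) :
    Integrable (fun ω => ε i ω * ε j ω) P :=
  (((memLp_two_iff_integrable_sq (hε i).aestronglyMeasurable).2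
    (hnoise.integrable_sq hε i)).integrable_mul
    ((memLp_two_iff_integrable_sq (hε j).aestronglyMeasurable).2 (hnoise.integrable_sq hε j)))

variable {φ : (Fin d → ℝ) → ℝ} {B : ℝ}

lemma integral_mul_eq_zero (hX : ∀ i, Measurable (X i)) (hε : ∀ i, Measurable (ε i))
    (hnoise : NoiseAssumption P X ε s) (hφ : Measurable φ) (hB : ∀ x, |φ x| ≤ B) (i : ℕ) :
    ∫ ω, φ (X i ω) * ε i ω ∂P = 0 := by
  rw [integral_mul_of_condExp_eq_const (g := fun ω => φ (X i ω)) (hX i).comap_le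
    (hφ.comp (comap_measurable (X i))).stronglyMeasurable (fun ω => hB _)
    (hnoise.integrable hε i) (hnoise.mean i), mul_zero]

lemma integral_sq_mul (hX : ∀ i, Measurable (X i)) (hε : ∀ i, Measurable (ε i))
    (hnoise : NoiseAssumption P X ε s) (hφ : Measurable φ) (hB : ∀ x, |φ x| ≤ B) (i : ℕ) :
    ∫ ω, (φ (X i ω) * ε i ω) ^ 2 ∂P = ∫ ω, φ (X i ω) ^ 2 ∂P := by
  have := integral_mul_of_condExp_eq_const (P := P) (hX i).comap_le (B := B ^ 2)
    ((hφ.pow_const 2).comp (comap_measurable (X i))).stronglyMeasurable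
    (fun ω => ?_) (hnoise.integrable_sq hε i) (hnoise.secondMoment i)
  · rw [mul_one] at this
    simpa [mul_pow] using this
  · simp only [Function.comp, abs_pow]
    exact pow_le_pow_left₀ (abs_nonneg _) (hB _) 2

lemma integrable_sq_mul (hX : ∀ i, Measurable (X i)) (hε : ∀ i, Measurable (ε i))
    (hnoise : NoiseAssumption P X ε s) (hφ : Measurable φ) (hB : ∀ x, |φ x| ≤ B) (i j : ℕ) :
    Integrable (fun ω => (φ (X i ω) * ε i ω) * (φ (X j ω) * ε j ω)) P := by
  have hm : ∀ i, Measurable fun ω => φ (X i ω) := fun i => hφ.comp (hX i)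
  have hb : ∀ i, ∀ᵐ ω ∂P, ‖φ (X i ω)‖ ≤ B := fun i => ae_of_all _ fun ω => by simpa using hB _
  have := ((hnoise.integrable_mul hε i j).bdd_mul (hm i).aestronglyMeasurable (hb i)).bdd_mul
    (hm j).aestronglyMeasurable (hb j)
  refine this.congr (ae_of_all _ fun ω => ?_)
  simp only; ring

/-- Given the pair of predictors both weights are known, and the white noise assumption removes the
rest. No mixing enters, so second moments of noise sums are exact. -/
lemma integral_cross_eq_zero (hX : ∀ i, Measurable (X i)) (hε : ∀ i, Measurable (ε i))
    (hnoise : NoiseAssumption P X ε s) (hφ : Measurable φ) (hB : ∀ x, |φ x| ≤ B) {i j : ℕ}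
    (hij : i ≠ j) : ∫ ω, (φ (X i ω) * ε i ω) * (φ (X j ω) * ε j ω) ∂P = 0 := by
  have hm : Measurable fun ω => (X i ω, X j ω) := (hX i).prodMk (hX j)
  have := integral_mul_of_condExp_eq_const (P := P) hm.comap_le (B := B * B)
    (g := fun ω => φ (X i ω) * φ (X j ω))
    (((hφ.comp measurable_fst).mul (hφ.comp measurable_snd)).comp
      (comap_measurable fun ω => (X i ω, X j ω))).stronglyMeasurable
    (fun ω => ?_) (hnoise.integrable_mul hε i j) (hnoise.uncorrelated i j hij)
  · rw [mul_zero] at this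
    rw [← this]
    congr 1; ext ω; ring
  · rw [abs_mul]
    exact mul_le_mul (hB _) (hB _) (abs_nonneg _) ((abs_nonneg _).trans (hB (X i ω)))

/-- The second moment of a sum of noise terms: the terms are exactly uncorrelated. -/
lemma integral_sq_sum (hX : ∀ i, Measurable (X i)) (hε : ∀ i, Measurable (ε i))
    (hnoise : NoiseAssumption P X ε s) (hφ : Measurable φ) (hB : ∀ x, |φ x| ≤ B)
    (T : Finset ℕ) :
    ∫ ω, (∑ i ∈ T, φ (X i ω) * ε i ω) ^ 2 ∂P = ∑ i ∈ T, ∫ ω, φ (X i ω) ^ 2 ∂P := by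
  have hi := hnoise.integrable_sq_mul hX hε hφ hB
  simp_rw [sq (∑ i ∈ T, _), Finset.sum_mul_sum]
  rw [integral_finsetSum _ fun i _ => integrable_finsetSum _ fun j _ => hi i j]
  refine Finset.sum_congr rfl fun i hiT => ?_
  rw [integral_finsetSum _ fun j _ => hi i j,
    Finset.sum_eq_single_of_mem i hiT fun j _ hji =>
      hnoise.integral_cross_eq_zero hX hε hφ hB hji.symm, ← hnoise.integral_sq_mul hX hε hφ hB]
  congr 1; ext ω; ring

lemma integrable_sq_sum (hX : ∀ i, Measurable (X i)) (hε : ∀ i, Measurable (ε i))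
    (hnoise : NoiseAssumption P X ε s) (hφ : Measurable φ) (hB : ∀ x, |φ x| ≤ B)
    (T : Finset ℕ) : Integrable (fun ω => (∑ i ∈ T, φ (X i ω) * ε i ω) ^ 2) P := by
  simp_rw [sq (∑ i ∈ T, _), Finset.sum_mul_sum]
  exact integrable_finsetSum _ fun i _ => integrable_finsetSum _ fun j _ =>
    hnoise.integrable_sq_mul hX hε hφ hB i j

lemma integral_sq_average (hX : ∀ i, Measurable (X i)) (hε : ∀ i, Measurable (ε i))
    (hnoise : NoiseAssumption P X ε s) (hφ : Measurable φ) (hB : ∀ x, |φ x| ≤ B) {q : ℝ}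
    (hq : ∀ i, ∫ ω, φ (X i ω) ^ 2 ∂P = q) (n : ℕ) :
    ∫ ω, ((n : ℝ)⁻¹ * ∑ i ∈ Finset.range n, φ (X i ω) * ε i ω) ^ 2 ∂P = (n : ℝ)⁻¹ * q := by
  simp_rw [mul_pow]
  rw [integral_const_mul, hnoise.integral_sq_sum hX hε hφ hB]
  simp only [hq, Finset.sum_const, nsmul_eq_mul, Finset.card_range]
  rcases eq_or_ne (n : ℝ) 0 with h | h
  · simp [h]
  · field_simp

/-- Conditioning on `X i` pulls out the weight, so the conditional moment bound `M` multiplies the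
moment of the weight alone. -/
lemma integral_rpow_mul_le (hX : ∀ i, Measurable (X i)) (hε : ∀ i, Measurable (ε i))
    (hnoise : NoiseAssumption P X ε s) (hφ : Measurable φ) (hB : ∀ x, |φ x| ≤ B) {M : ℝ} {i : ℕ}
    (hM : ∀ᵐ ω ∂P,
      (P[fun ω => |ε i ω| ^ (5 / 2 : ℝ) | MeasurableSpace.comap (X i) inferInstance]) ω ≤ M) :
    Integrable (fun ω => |φ (X i ω) * ε i ω| ^ (5 / 2 : ℝ)) P ∧
    ∫ ω, |φ (X i ω) * ε i ω| ^ (5 / 2 : ℝ) ∂P ≤ (∫ ω, |φ (X i ω)| ^ (5 / 2 : ℝ) ∂P) * M := by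
  have hb : ∀ x, |(|φ x| ^ (5 / 2 : ℝ))| ≤ |B| ^ (5 / 2 : ℝ) := fun x => by
    rw [abs_of_nonneg (Real.rpow_nonneg (abs_nonneg _) _)]
    exact Real.rpow_le_rpow (abs_nonneg _) ((hB x).trans (le_abs_self _)) (by norm_num)
  have hm : Measurable fun x => |φ x| ^ (5 / 2 : ℝ) := hφ.abs.pow_const _
  have hi := hnoise.integrable_rpow hε i (p := 5 / 2) (by norm_num) le_rfl
  have e : (fun ω => |φ (X i ω) * ε i ω| ^ (5 / 2 : ℝ)) =
      fun ω => |φ (X i ω)| ^ (5 / 2 : ℝ) * |ε i ω| ^ (5 / 2 : ℝ) := by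
    ext ω; rw [abs_mul, Real.mul_rpow (abs_nonneg _) (abs_nonneg _)]
  rw [e]
  refine ⟨hi.bdd_mul (hm.comp (hX i)).aestronglyMeasurable
    (ae_of_all _ fun ω => by simpa using hb (X i ω)), ?_⟩
  exact integral_mul_le_of_condExp_le (hX i).comap_le
    (hm.comp (comap_measurable (X i))).stronglyMeasurable
    (fun ω => Real.rpow_nonneg (abs_nonneg _) _) (fun ω => hb _) hi hM

end NoiseAssumption

end Noise

/-! ### Characteristic functions of block sums. -/

section BlockCLT

/-- The Taylor remainder is cubic for small `u` and at most quadratic for large `u`; the exponent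
`5/2` lies in between and matches the moment of the noise that is used. -/
lemma norm_exp_mul_I_sub_le (u : ℝ) :
    ‖Complex.exp (u * Complex.I) - (1 + u * Complex.I - u ^ 2 / 2)‖ ≤ 5 * |u| ^ (5 / 2 : ℝ) := by
  rcases le_total |u| 1 with h | h
  · have hn : ‖(u : ℂ) * Complex.I‖ = |u| := by simp
    have := Complex.exp_bound (x := u * Complex.I) (by rw [hn]; exact h) (n := 3) (by norm_num)
    rw [hn] at this
    have e : ∑ m ∈ Finset.range 3, ((u : ℂ) * Complex.I) ^ m / (m.factorial : ℂ) =
        1 + u * Complex.I - u ^ 2 / 2 := by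
      simp [Finset.sum_range_succ, mul_pow, Nat.factorial]; ring
    rw [e] at this
    refine this.trans ?_
    have h3 : |u| ^ 3 ≤ |u| ^ (5 / 2 : ℝ) := by
      rw [← Real.rpow_natCast]
      exact Real.rpow_le_rpow_of_exponent_ge' (abs_nonneg _) h (by norm_num) (by norm_num)
    have h0 : 0 ≤ |u| ^ 3 := by positivity
    norm_num [Nat.factorial]
    linarith
  · have h1 : |u| ≤ |u| ^ (5 / 2 : ℝ) := by
      simpa using Real.rpow_le_rpow_of_exponent_le h (show (1 : ℝ) ≤ 5 / 2 by norm_num)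
    have h2 : |u| ^ 2 ≤ |u| ^ (5 / 2 : ℝ) := by
      have := Real.rpow_le_rpow_of_exponent_le h (show (2 : ℝ) ≤ 5 / 2 by norm_num)
      simpa using this
    have a1 : ‖Complex.exp (u * Complex.I)‖ = 1 := Complex.norm_exp_ofReal_mul_I u
    have a2 : ‖(1 + u * Complex.I - u ^ 2 / 2 : ℂ)‖ ≤ 1 + |u| + |u| ^ 2 / 2 := by
      refine (norm_sub_le _ _).trans (add_le_add ((norm_add_le _ _).trans ?_) ?_)
      · simp
      · simp
    refine (norm_sub_le _ _).trans ?_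
    linarith

variable {Ω E : Type*} [MeasurableSpace Ω] [MeasurableSpace E] {P : Measure Ω}
  [IsProbabilityMeasure P] {Z : ℕ → Ω → E}

/-- The characteristic function of a block sum, to second order. -/
lemma norm_charFun_block_sub_le {ξ : ℕ → Ω → ℝ} (hξ : ∀ i, Measurable (ξ i)) {v M : ℝ}
    (h0 : ∀ i, ∫ ω, ξ i ω ∂P = 0) (hint : ∀ i, Integrable (ξ i) P)
    (T : Finset ℕ) (hsi : Integrable (fun ω => (∑ i ∈ T, ξ i ω) ^ 2) P)
    (hsq : ∫ ω, (∑ i ∈ T, ξ i ω) ^ 2 ∂P = T.card * v)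
    (hM : ∀ i, Integrable (fun ω => |ξ i ω| ^ (5 / 2 : ℝ)) P ∧
      ∫ ω, |ξ i ω| ^ (5 / 2 : ℝ) ∂P ≤ M) (t : ℝ) :
    ‖∫ ω, Complex.exp (((t * ∑ i ∈ T, ξ i ω : ℝ) : ℂ) * Complex.I) ∂P -
      ((1 - t ^ 2 / 2 * (T.card * v) : ℝ) : ℂ)‖ ≤
      5 * |t| ^ (5 / 2 : ℝ) * ((T.card : ℝ) ^ (5 / 2 : ℝ) * M) := by
  set U : Ω → ℝ := fun ω => ∑ i ∈ T, ξ i ω with hU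
  have hUm : Measurable U := Finset.measurable_fun_sum _ fun i _ => hξ i
  have hUi : Integrable U P := integrable_finsetSum _ fun i _ => hint i
  have hU0 : ∫ ω, U ω ∂P = 0 := by
    rw [integral_finsetSum _ fun i _ => hint i]; simp [h0]
  have hei : Integrable (fun ω => Complex.exp (((t * U ω : ℝ) : ℂ) * Complex.I)) P := by
    refine Integrable.of_bound (C := 1) ?_ (ae_of_all _ fun ω => ?_)
    · exact (by fun_prop : Measurable fun ω =>
        Complex.exp (((t * U ω : ℝ) : ℂ) * Complex.I)).aestronglyMeasurable
    · rw [Complex.norm_exp_ofReal_mul_I]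
  have hqi : Integrable (fun ω => (1 + ((t * U ω : ℝ) : ℂ) * Complex.I
      - ((t * U ω : ℝ) : ℂ) ^ 2 / 2)) P := by
    refine ((integrable_const _).add ((hUi.const_mul t).ofReal.mul_const _)).sub ?_
    have : Integrable (fun ω => (((t ^ 2 / 2 * U ω ^ 2 : ℝ)) : ℂ)) P :=
      (hsi.const_mul (t ^ 2 / 2)).ofReal
    refine this.congr (ae_of_all _ fun ω => ?_)
    push_cast; ring
  have hq : ∫ ω, (1 + ((t * U ω : ℝ) : ℂ) * Complex.I - ((t * U ω : ℝ) : ℂ) ^ 2 / 2) ∂P =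
      ((1 - t ^ 2 / 2 * (T.card * v) : ℝ) : ℂ) := by
    have i1 : Integrable (fun ω => ((t * U ω : ℝ) : ℂ) * Complex.I) P :=
      (hUi.const_mul t).ofReal.mul_const _
    have i2 : Integrable (fun ω => (((t ^ 2 / 2 * U ω ^ 2 : ℝ)) : ℂ)) P :=
      (hsi.const_mul (t ^ 2 / 2)).ofReal
    have e : ∀ ω, (1 + ((t * U ω : ℝ) : ℂ) * Complex.I - ((t * U ω : ℝ) : ℂ) ^ 2 / 2) =
        (1 + ((t * U ω : ℝ) : ℂ) * Complex.I) - ((t ^ 2 / 2 * U ω ^ 2 : ℝ) : ℂ) := by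
      intro ω; push_cast; ring
    simp_rw [e]
    have e1 := integral_sub ((integrable_const (1 : ℂ)).add i1) i2
    have e2 := integral_add (integrable_const (1 : ℂ)) i1
    simp only [Pi.add_apply] at e1
    rw [e1, e2, integral_mul_const, integral_complex_ofReal, integral_complex_ofReal,
      integral_const_mul,
      integral_const_mul, hU0, hsq]
    simp
  rw [← hq, ← integral_sub hei hqi]
  refine (norm_integral_le_integral_norm _).trans ?_
  -- The power mean inequality ignores all cancellation inside the block. This is affordable because
  -- the blocks will be short, of length about `n^{1/20}`.
  have hsum : ∀ ω, |U ω| ^ (5 / 2 : ℝ) ≤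
      (T.card : ℝ) ^ (3 / 2 : ℝ) * ∑ i ∈ T, |ξ i ω| ^ (5 / 2 : ℝ) := by
    intro ω
    have := Real.rpow_sum_le_const_mul_sum_rpow T (fun i => ξ i ω) (p := 5 / 2) (by norm_num)
    rw [show (5 / 2 - 1 : ℝ) = 3 / 2 by norm_num] at this
    exact (Real.rpow_le_rpow (abs_nonneg _) (Finset.abs_sum_le_sum_abs _ _)
      (by norm_num)).trans this
  have hri : Integrable (fun ω => 5 * |t| ^ (5 / 2 : ℝ) *
      ((T.card : ℝ) ^ (3 / 2 : ℝ) * ∑ i ∈ T, |ξ i ω| ^ (5 / 2 : ℝ))) P :=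
    ((integrable_finsetSum _ fun i _ => (hM i).1).const_mul _).const_mul _
  calc _ ≤ ∫ ω, 5 * |t| ^ (5 / 2 : ℝ) *
      ((T.card : ℝ) ^ (3 / 2 : ℝ) * ∑ i ∈ T, |ξ i ω| ^ (5 / 2 : ℝ)) ∂P := by
        refine integral_mono (hei.sub hqi).norm hri fun ω => ?_
        refine (norm_exp_mul_I_sub_le (t * U ω)).trans ?_
        rw [abs_mul, Real.mul_rpow (abs_nonneg _) (abs_nonneg _), mul_assoc]
        exact mul_le_mul_of_nonneg_left (mul_le_mul_of_nonneg_left (hsum ω)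
          (Real.rpow_nonneg (abs_nonneg _) _)) (by norm_num)
    _ = 5 * |t| ^ (5 / 2 : ℝ) * ((T.card : ℝ) ^ (3 / 2 : ℝ) *
          ∑ i ∈ T, ∫ ω, |ξ i ω| ^ (5 / 2 : ℝ) ∂P) := by
        rw [integral_const_mul, integral_const_mul, integral_finsetSum _ fun i _ => (hM i).1]
    _ ≤ 5 * |t| ^ (5 / 2 : ℝ) * ((T.card : ℝ) ^ (3 / 2 : ℝ) * ∑ i ∈ T, M) := by
        have := Real.rpow_nonneg (abs_nonneg t) (5 / 2)
        have := Real.rpow_nonneg (Nat.cast_nonneg (α := ℝ) T.card) (3 / 2)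
        gcongr with i _
        exact (hM i).2
    _ = _ := by
        rw [Finset.sum_const, nsmul_eq_mul, ← mul_assoc ((T.card : ℝ) ^ (3 / 2 : ℝ))]
        congr 2
        rcases Nat.eq_zero_or_pos T.card with h | h
        · rw [h]; norm_num
        · rw [← Real.rpow_add_one (by positivity)]; norm_num

/-- A bound for the characteristic function of a sum of a mixing sequence, by the method of big
blocks of length `p` and gaps of length `q`. -/
lemma norm_charFun_sum_sub_le (hZ : ∀ i, Measurable (Z i)) {ψ : E → ℝ} (hψ : Measurable ψ)
    {v M a : ℝ} (h0 : ∀ i, ∫ ω, ψ (Z i ω) ∂P = 0) (hint : ∀ i, Integrable (fun ω => ψ (Z i ω)) P)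
    (hsi : ∀ T : Finset ℕ, Integrable (fun ω => (∑ i ∈ T, ψ (Z i ω)) ^ 2) P)
    (hsq : ∀ T : Finset ℕ, ∫ ω, (∑ i ∈ T, ψ (Z i ω)) ^ 2 ∂P = T.card * v)
    (hM : ∀ i, Integrable (fun ω => |ψ (Z i ω)| ^ (5 / 2 : ℝ)) P ∧
      ∫ ω, |ψ (Z i ω)| ^ (5 / 2 : ℝ) ∂P ≤ M)
    {n p q k : ℕ} (ha : alphaMixingCoeff P Z q ≤ a) (hk : k * (p + q) ≤ n) (t : ℝ)
    (hx : t ^ 2 / 2 * (p * v) ≤ 1) :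
    ‖∫ ω, Complex.exp (((t * ∑ i ∈ Finset.range n, ψ (Z i ω) : ℝ) : ℂ) * Complex.I) ∂P -
      ((Real.exp (-(t ^ 2 / 2 * (k * p * v))) : ℝ) : ℂ)‖ ≤
      |t| * Real.sqrt ((n - k * p) * v) + k * (16 * a +
        5 * |t| ^ (5 / 2 : ℝ) * ((p : ℝ) ^ (5 / 2 : ℝ) * M) + (t ^ 2 / 2 * (p * v)) ^ 2) := by
  have hv0 : 0 ≤ v := by
    have := hsq {0}
    simp only [Finset.card_singleton, Nat.cast_one, one_mul] at this
    rw [← this]; exact integral_nonneg fun ω => sq_nonneg _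
  set T : ℕ → Finset ℕ := fun j => Finset.Ico (j * (p + q)) (j * (p + q) + p) with hT
  have hTc : ∀ j, (T j).card = p := fun j => by simp [hT]
  set U : ℕ → Ω → ℝ := fun j ω => ∑ i ∈ T j, ψ (Z i ω) with hU
  set e : ℕ → Ω → ℂ := fun j ω => Complex.exp (((t * U j ω : ℝ) : ℂ) * Complex.I) with he
  have hm : ∀ i, Measurable fun ω => ψ (Z i ω) := fun i => hψ.comp (hZ i)
  have hUm : ∀ j, Measurable (U j) := fun j => Finset.measurable_fun_sum _ fun i _ => hm i
  have hem : ∀ j, Measurable (e j) := fun j => by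
    have := hUm j
    simp only [he]; fun_prop
  have hen : ∀ j ω, ‖e j ω‖ = 1 := fun j ω => Complex.norm_exp_ofReal_mul_I _
  set A : ℕ → ℂ := fun J => ∫ ω, ∏ j ∈ Finset.range J, e j ω ∂P with hA
  set D : ℝ := Real.exp (-(t ^ 2 / 2 * (p * v))) with hD
  -- The error per block: decoupling it from the past, expanding its characteristic function to
  -- second order, and replacing `1 - y` by `exp (-y)`.
  set η : ℝ := 16 * a + 5 * |t| ^ (5 / 2 : ℝ) * ((p : ℝ) ^ (5 / 2 : ℝ) * M) +
    (t ^ 2 / 2 * (p * v)) ^ 2 with hη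
  have ha0 : 0 ≤ a := (alphaMixingCoeff_nonneg q).trans ha
  have hx0 : 0 ≤ t ^ 2 / 2 * (p * v) := by positivity
  have hD0 : 0 ≤ D := (Real.exp_pos _).le
  have hD1 : D ≤ 1 := Real.exp_le_one_iff.2 (by linarith)
  have hAn : ∀ J, ‖A J‖ ≤ 1 := fun J => by
    refine (norm_integral_le_of_norm_le_const (C := 1) (ae_of_all _ fun ω => ?_)).trans (by simp)
    rw [norm_prod]; simp [hen]
  have hc : ∀ j, ‖∫ ω, e j ω ∂P - (D : ℂ)‖ ≤
      5 * |t| ^ (5 / 2 : ℝ) * ((p : ℝ) ^ (5 / 2 : ℝ) * M) + (t ^ 2 / 2 * (p * v)) ^ 2 := by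
    intro j
    have h1 := norm_charFun_block_sub_le (P := P) hm h0 hint (T j) (hsi _) (hsq _) hM t
    rw [hTc] at h1
    have h2 : ‖((1 - t ^ 2 / 2 * (p * v) : ℝ) : ℂ) - (D : ℂ)‖ ≤ (t ^ 2 / 2 * (p * v)) ^ 2 := by
      rw [← Complex.ofReal_sub, Complex.norm_real, Real.norm_eq_abs, abs_sub_comm]
      have := Real.abs_exp_sub_one_sub_id_le (x := -(t ^ 2 / 2 * (p * v)))
        (by rw [abs_neg, abs_of_nonneg hx0]; exact hx)
      rw [neg_sq] at this
      rw [hD]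
      convert! this using 2
      ring
    calc _ = ‖(∫ ω, e j ω ∂P - ((1 - t ^ 2 / 2 * (p * v) : ℝ) : ℂ)) +
          (((1 - t ^ 2 / 2 * (p * v) : ℝ) : ℂ) - (D : ℂ))‖ := by congr 1; ring
      _ ≤ _ := (norm_add_le _ _).trans (add_le_add h1 h2)
  have hmixJ : ∀ J, ‖A (J + 1) - A J * ∫ ω, e J ω ∂P‖ ≤ 16 * a := by
    intro J
    simp only [hA, Finset.prod_range_succ]
    -- For `J > 0` the first `J` blocks lie strictly before time `J * (p + q) - q`, and block `J`
    -- starts `q` later. The case `J = 0` is separate because the natural subtraction would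
    -- truncate.
    rcases Nat.eq_zero_or_pos J with rfl | hJ
    · simp; exact ha0
    · have hJb : p + q ≤ J * (p + q) := Nat.le_mul_of_pos_left _ hJ
      refine norm_cov_le_of_mixing (P := P) (generatedBy_le hZ (Set.Iic (J * (p + q) - q)))
        (generatedBy_le hZ (Set.Ici (J * (p + q) - q + q)))
        (fun B C hB hC => (abs_measureReal_inter_sub_le hB hC).trans ha)
        ?_ ?_ (fun ω => by rw [norm_prod]; simp [hen]) (fun ω => (hen J ω).le)
      · refine Measurable.stronglyMeasurable ?_
        refine Finset.measurable_fun_prod _ fun j hj => ?_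
        have hjJ : j + 1 ≤ J := by simpa using hj
        have : Measurable[generatedBy Z (Set.Iic (J * (p + q) - q))] (U j) := by
          refine Finset.measurable_fun_sum _ fun i hi => ?_
          refine hψ.comp (measurable_generatedBy ?_)
          have h1 := Nat.mul_le_mul_right (p + q) hjJ
          simp only [hT, Finset.mem_Ico, Set.mem_Iic, add_mul, one_mul] at hi h1 ⊢
          omega
        exact Complex.measurable_exp.comp
          ((Complex.measurable_ofReal.comp (this.const_mul t)).mul_const _)
      · refine Measurable.stronglyMeasurable ?_
        have : Measurable[generatedBy Z (Set.Ici (J * (p + q) - q + q))] (U J) := by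
          refine Finset.measurable_fun_sum _ fun i hi => ?_
          refine hψ.comp (measurable_generatedBy ?_)
          simp only [hT, Finset.mem_Ico, Set.mem_Ici] at hi ⊢
          omega
        exact Complex.measurable_exp.comp
          ((Complex.measurable_ofReal.comp (this.const_mul t)).mul_const _)
  have hind : ∀ J : ℕ, ‖A J - (D : ℂ) ^ J‖ ≤ J * η := by
    intro J
    induction J with
    | zero => simp [hA]
    | succ J ih =>
      -- Telescoping: decouple block `J`, replace its characteristic function by `D`, and use the
      -- induction hypothesis. All factors have norm at most one, so the errors simply add up.
      have e1 : A (J + 1) - (D : ℂ) ^ (J + 1) = (A (J + 1) - A J * ∫ ω, e J ω ∂P) +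
          A J * (∫ ω, e J ω ∂P - D) + D * (A J - (D : ℂ) ^ J) := by ring
      rw [e1]
      have hDn : ‖(D : ℂ)‖ ≤ 1 := by
        rw [Complex.norm_real, Real.norm_of_nonneg hD0]; exact hD1
      have n1 : ‖A J * (∫ ω, e J ω ∂P - D)‖ ≤ 5 * |t| ^ (5 / 2 : ℝ) *
          ((p : ℝ) ^ (5 / 2 : ℝ) * M) + (t ^ 2 / 2 * (p * v)) ^ 2 := by
        rw [norm_mul]
        exact (mul_le_of_le_one_left (norm_nonneg _) (hAn J)).trans (hc J)
      have n2 : ‖(D : ℂ) * (A J - (D : ℂ) ^ J)‖ ≤ J * η := by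
        rw [norm_mul]
        exact (mul_le_of_le_one_left (norm_nonneg _) hDn).trans ih
      refine (norm_add₃_le).trans ?_
      have := hmixJ J
      push_cast
      rw [hη] at n2 ⊢
      linarith
  -- the remainder: the gaps and the end
  set B : Finset ℕ := (Finset.range k).biUnion T with hB
  have hdisj : ∀ i ∈ (Finset.range k : Set ℕ), ∀ j ∈ (Finset.range k : Set ℕ), i ≠ j →
      Disjoint (T i) (T j) := by
    have key : ∀ i j, i < j → Disjoint (T i) (T j) := by
      intro i j hij
      rw [Finset.disjoint_left]
      intro l hl hl'
      have h1 := Nat.mul_le_mul_right (p + q) (Nat.succ_le_of_lt hij)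
      simp only [hT, Finset.mem_Ico, Nat.succ_eq_add_one, add_mul, one_mul] at hl hl' h1
      omega
    intro i _ j _ hij
    rcases lt_or_gt_of_ne hij with h | h
    · exact key i j h
    · exact (key j i h).symm
  have hBn : B ⊆ Finset.range n := by
    intro l hl
    simp only [hB, Finset.mem_biUnion, Finset.mem_range, hT, Finset.mem_Ico] at hl ⊢
    obtain ⟨j, hj, h1, h2⟩ := hl
    have h3 := Nat.mul_le_mul_right (p + q) (Nat.succ_le_of_lt hj)
    simp only [Nat.succ_eq_add_one, add_mul, one_mul] at h3 hk
    omega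
  have hBc : B.card = k * p := by
    rw [hB, Finset.card_biUnion hdisj]; simp [hTc]
  set R : Ω → ℝ := fun ω => ∑ i ∈ Finset.range n \ B, ψ (Z i ω) with hR
  have hRm : Measurable R := Finset.measurable_fun_sum _ fun i _ => hm i
  have hRc : ((Finset.range n \ B).card : ℝ) = n - k * p := by
    rw [Finset.cast_card_sdiff hBn, hBc]; simp
  have hRi : Integrable R P := integrable_finsetSum _ fun i _ => hint i
  -- The discarded terms are uncorrelated too, so their second moment is exactly their number times
  -- `v`.
  have hRabs : ∫ ω, |R ω| ∂P ≤ Real.sqrt ((n - k * p) * v) := by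
    have hL2 : MemLp R 2 P := (memLp_two_iff_integrable_sq hRm.aestronglyMeasurable).2 (hsi _)
    have h1 : (∫ ω, |R ω| ∂P) ^ 2 ≤ ∫ ω, |R ω| ^ 2 ∂P := by
      have h := variance_nonneg |R| P
      rw [variance_eq_sub (hL2.abs)] at h
      simpa using h
    refine Real.le_sqrt_of_sq_le (h1.trans (le_of_eq ?_))
    simp only [sq_abs]
    rw [hsq, hRc]
  have hsplit : ∀ ω, ∑ i ∈ Finset.range n, ψ (Z i ω) = R ω + ∑ j ∈ Finset.range k, U j ω := by
    intro ω
    rw [hR, hU, ← Finset.sum_sdiff hBn, hB, Finset.sum_biUnion hdisj]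
  have hprod : ∀ ω, Complex.exp (((t * ∑ i ∈ Finset.range n, ψ (Z i ω) : ℝ) : ℂ) * Complex.I) =
      Complex.exp (((t * R ω : ℝ) : ℂ) * Complex.I) * ∏ j ∈ Finset.range k, e j ω := by
    intro ω
    rw [hsplit, he, ← Complex.exp_sum, ← Complex.exp_add]
    congr 1
    push_cast
    rw [mul_add, add_mul, Finset.mul_sum, Finset.sum_mul]
  have hprm : Measurable fun ω => ∏ j ∈ Finset.range k, e j ω :=
    Finset.measurable_fun_prod _ fun j _ => hem j
  have hpri : Integrable (fun ω => ∏ j ∈ Finset.range k, e j ω) P :=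
    Integrable.of_bound (C := 1) hprm.aestronglyMeasurable
      (ae_of_all _ fun ω => by rw [norm_prod]; simp [hen])
  have hfi : Integrable (fun ω => Complex.exp (((t * R ω : ℝ) : ℂ) * Complex.I) *
      ∏ j ∈ Finset.range k, e j ω) P := by
    refine Integrable.of_bound (C := 1) (Measurable.aestronglyMeasurable ?_)
      (ae_of_all _ fun ω => ?_)
    · refine Measurable.mul ?_ hprm
      fun_prop
    · rw [norm_mul, norm_prod, Complex.norm_exp_ofReal_mul_I]; simp [hen]
  have hfirst : ‖∫ ω, Complex.exp (((t * ∑ i ∈ Finset.range n, ψ (Z i ω) : ℝ) : ℂ) *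
      Complex.I) ∂P - A k‖ ≤ |t| * Real.sqrt ((n - k * p) * v) := by
    simp_rw [hprod]
    rw [hA, ← integral_sub hfi hpri]
    refine (norm_integral_le_integral_norm _).trans ?_
    calc _ ≤ ∫ ω, |t| * |R ω| ∂P := by
          refine integral_mono (hfi.sub hpri).norm (hRi.abs.const_mul _) fun ω => ?_
          have e1 : Complex.exp (((t * R ω : ℝ) : ℂ) * Complex.I) * ∏ j ∈ Finset.range k, e j ω -
              ∏ j ∈ Finset.range k, e j ω =
              (Complex.exp (((t * R ω : ℝ) : ℂ) * Complex.I) - 1) *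
                ∏ j ∈ Finset.range k, e j ω := by ring
          simp only
          rw [e1, norm_mul, norm_prod]
          simp only [hen, Finset.prod_const_one, mul_one]
          rw [mul_comm _ Complex.I]
          refine (Real.norm_exp_I_mul_ofReal_sub_one_le).trans ?_
          rw [Real.norm_eq_abs, abs_mul]
      _ ≤ _ := by
          rw [integral_const_mul]
          exact mul_le_mul_of_nonneg_left hRabs (abs_nonneg _)
  have hDk : ((Real.exp (-(t ^ 2 / 2 * (k * p * v))) : ℝ) : ℂ) = (D : ℂ) ^ k := by
    rw [← Complex.ofReal_pow, hD, ← Real.exp_nat_mul]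
    congr 2; ring
  rw [hDk]
  calc _ = ‖(∫ ω, Complex.exp (((t * ∑ i ∈ Finset.range n, ψ (Z i ω) : ℝ) : ℂ) *
      Complex.I) ∂P - A k) + (A k - (D : ℂ) ^ k)‖ := by congr 1; ring
    _ ≤ _ := (norm_add_le _ _).trans (add_le_add hfirst (hind k))

end BlockCLT

/-! ### Powers of the sample size. -/

section Rates

open Topology

lemma tendsto_natCast_rpow_neg {e : ℝ} (he : 0 < e) :
    Tendsto (fun n : ℕ => (n : ℝ) ^ (-e)) atTop (𝓝 0) :=
  (tendsto_rpow_neg_atTop he).comp tendsto_natCast_atTop_atTop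

lemma tendsto_natCast_rpow_of_neg {e : ℝ} (he : e < 0) :
    Tendsto (fun n : ℕ => (n : ℝ) ^ e) atTop (𝓝 0) := by
  simpa using tendsto_natCast_rpow_neg (e := -e) (by linarith)

/-- Under geometric mixing a lag that is any positive power of `n` already beats every polynomial
loss; hence the lags can have tiny exponents. -/
lemma tendsto_rpow_mul_exp_neg_rpow (D : ℝ) {l e : ℝ} (hl : 0 < l) (he : 0 < e) :
    Tendsto (fun n : ℕ => (n : ℝ) ^ D * Real.exp (-l * (n : ℝ) ^ e)) atTop (𝓝 0) := by
  have h1 : Tendsto (fun n : ℕ => (n : ℝ) ^ e) atTop atTop :=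
    (tendsto_rpow_atTop he).comp tendsto_natCast_atTop_atTop
  refine ((tendsto_rpow_mul_exp_neg_mul_atTop_nhds_zero (D / e) l hl).comp h1).congr fun n => ?_
  simp only [Function.comp]
  rw [← Real.rpow_mul (Nat.cast_nonneg n), mul_div_cancel₀ _ he.ne']

lemma natCeil_rpow_le {e : ℝ} (he : 0 ≤ e) {n : ℕ} (hn : 1 ≤ n) :
    ((⌈(n : ℝ) ^ e⌉₊ : ℕ) : ℝ) ≤ 2 * (n : ℝ) ^ e := by
  have h1 : (1 : ℝ) ≤ (n : ℝ) ^ e := Real.one_le_rpow (by exact_mod_cast hn) he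
  have := Nat.ceil_lt_add_one (a := (n : ℝ) ^ e) (by linarith)
  linarith

end Rates

/-! ### Central limit theorem for mixing arrays. -/

section MixingCLT

open Topology

variable {Ω E : Type*} [MeasurableSpace Ω] [MeasurableSpace E] {P : Measure Ω}
  [IsProbabilityMeasure P] {Z : ℕ → Ω → E}

/-- The gaps take up a fraction of order `n^{-1/40}` of the sample and the incomplete last period
one of order `n^{-19/20}`, so the big blocks exhaust the sample. -/
lemma tendsto_block_ratio :
    Tendsto (fun n : ℕ => (((n / (⌈(n : ℝ) ^ (1 / 20 : ℝ)⌉₊ + ⌈(n : ℝ) ^ (1 / 40 : ℝ)⌉₊) : ℕ) : ℝ) *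
      (⌈(n : ℝ) ^ (1 / 20 : ℝ)⌉₊ : ℝ)) / n) atTop (𝓝 1) := by
  have hlow : Tendsto (fun n : ℕ => 1 - (4 * (n : ℝ) ^ (-(19 / 20) : ℝ) +
      2 * (n : ℝ) ^ (-(1 / 40) : ℝ))) atTop (𝓝 1) := by
    have h1 := (tendsto_natCast_rpow_neg (e := 19 / 20) (by norm_num)).const_mul 4
    have h2 := (tendsto_natCast_rpow_neg (e := 1 / 40) (by norm_num)).const_mul 2
    simpa using tendsto_const_nhds.sub (h1.add h2)
  refine tendsto_of_tendsto_of_tendsto_of_le_of_le' hlow tendsto_const_nhds ?_ ?_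
  · filter_upwards [eventually_ge_atTop 1] with n hn
    have hn0 : (0 : ℝ) < n := by exact_mod_cast hn
    set p := ⌈(n : ℝ) ^ (1 / 20 : ℝ)⌉₊ with hp
    set q := ⌈(n : ℝ) ^ (1 / 40 : ℝ)⌉₊ with hq
    have hp1 : (n : ℝ) ^ (1 / 20 : ℝ) ≤ p := Nat.le_ceil _
    have hp0 : 0 < (n : ℝ) ^ (1 / 20 : ℝ) := by positivity
    have hp2 : (p : ℝ) ≤ 2 * (n : ℝ) ^ (1 / 20 : ℝ) := natCeil_rpow_le (by norm_num) hn
    have hq2 : (q : ℝ) ≤ 2 * (n : ℝ) ^ (1 / 40 : ℝ) := natCeil_rpow_le (by norm_num) hn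
    have hq3 : (n : ℝ) ^ (1 / 40 : ℝ) ≤ (n : ℝ) ^ (1 / 20 : ℝ) :=
      Real.rpow_le_rpow_of_exponent_le (by exact_mod_cast hn) (by norm_num)
    have hpn : 0 < p := by
      have : (0 : ℝ) < p := by linarith
      exact_mod_cast this
    have hk1 := Nat.lt_div_mul_add (a := n) (b := p + q) (by omega)
    have hk2 := Nat.div_mul_le_self n (p + q)
    set k := n / (p + q) with hk
    have hk1' : (n : ℝ) ≤ k * (p + q) + (p + q) := by exact_mod_cast hk1.le
    have hk2' : (k : ℝ) * (p + q) ≤ n := by exact_mod_cast hk2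
    have hkp : (k : ℝ) * (n : ℝ) ^ (1 / 20 : ℝ) ≤ n := by
      have : (k : ℝ) * (n : ℝ) ^ (1 / 20 : ℝ) ≤ k * (p + q) := by gcongr; linarith [Nat.cast_nonneg (α := ℝ) q]
      linarith
    have e1 : (n : ℝ) ^ (-(19 / 20) : ℝ) * n = (n : ℝ) ^ (1 / 20 : ℝ) := by
      rw [← Real.rpow_add_one hn0.ne']; norm_num
    have e2 : (n : ℝ) ^ (-(1 / 40) : ℝ) * (n : ℝ) ^ (1 / 20 : ℝ) = (n : ℝ) ^ (1 / 40 : ℝ) := by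
      rw [← Real.rpow_add hn0]; norm_num
    have e3 : (k : ℝ) * q ≤ 2 * (n : ℝ) ^ (-(1 / 40) : ℝ) * n := by
      calc (k : ℝ) * q ≤ k * (2 * (n : ℝ) ^ (1 / 40 : ℝ)) := by gcongr
        _ = 2 * (n : ℝ) ^ (-(1 / 40) : ℝ) * (k * (n : ℝ) ^ (1 / 20 : ℝ)) := by rw [← e2]; ring
        _ ≤ _ := by gcongr
    rw [le_div_iff₀ hn0]
    nlinarith
  · filter_upwards [eventually_ge_atTop 1] with n hn
    have hn0 : (0 : ℝ) < n := by exact_mod_cast hn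
    rw [div_le_one hn0]
    have hk2 := Nat.div_mul_le_self n
      (⌈(n : ℝ) ^ (1 / 20 : ℝ)⌉₊ + ⌈(n : ℝ) ^ (1 / 40 : ℝ)⌉₊)
    rw [mul_add] at hk2
    exact_mod_cast (Nat.le_add_right _ _).trans hk2

/-- A central limit theorem for triangular arrays of functions of a geometrically mixing process,
with uncorrelated terms whose variance does not depend on the time. -/
theorem tendstoInDistribution_of_mixing (hZ : ∀ i, Measurable (Z i)) {K₀ l₀ : ℝ} (hl₀ : 0 < l₀)
    (hmix : ∀ k : ℕ, 1 ≤ k → alphaMixingCoeff P Z k ≤ K₀ * Real.exp (-l₀ * k))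
    {ψ : ℕ → E → ℝ} (hψ : ∀ n, Measurable (ψ n)) {v : ℕ → ℝ} {w : ℝ}
    (hv : Tendsto v atTop (𝓝 w)) {C : ℝ}
    (h0 : ∀ n i, ∫ ω, ψ n (Z i ω) ∂P = 0) (hint : ∀ n i, Integrable (fun ω => ψ n (Z i ω)) P)
    (hsi : ∀ n, ∀ T : Finset ℕ, Integrable (fun ω => (∑ i ∈ T, ψ n (Z i ω)) ^ 2) P)
    (hsq : ∀ n, ∀ T : Finset ℕ, ∫ ω, (∑ i ∈ T, ψ n (Z i ω)) ^ 2 ∂P = T.card * v n)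
    (hM : ∀ᶠ n in atTop, ∀ i, Integrable (fun ω => |ψ n (Z i ω)| ^ (5 / 2 : ℝ)) P ∧
      ∫ ω, |ψ n (Z i ω)| ^ (5 / 2 : ℝ) ∂P ≤ C * (n : ℝ) ^ (1 / 20 : ℝ)) :
    TendstoInDistribution
      (fun (n : ℕ) ω => (Real.sqrt n)⁻¹ * ∑ i ∈ Finset.range n, ψ n (Z i ω)) atTop (id : ℝ → ℝ)
      (fun _ => P) (gaussianReal 0 w.toNNReal) := by
  have hm : ∀ n : ℕ, Measurable fun ω => (Real.sqrt n)⁻¹ * ∑ i ∈ Finset.range n, ψ n (Z i ω) :=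
    fun n => (Finset.measurable_fun_sum _ fun i _ => (hψ n).comp (hZ i)).const_mul _
  have hv0 : ∀ n, 0 ≤ v n := fun n => by
    have := hsq n {0}
    simp only [Finset.card_singleton, Nat.cast_one, one_mul] at this
    rw [← this]; exact integral_nonneg fun ω => sq_nonneg _
  have hw0 : 0 ≤ w := ge_of_tendsto' hv hv0
  refine ⟨fun n => (hm n).aemeasurable, aemeasurable_id, ?_⟩
  refine ProbabilityMeasure.tendsto_iff_tendsto_charFun.2 fun t => ?_
  simp only [ProbabilityMeasure.coe_mk, Measure.map_id, charFun_gaussianReal]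
  -- The exponents need only be small, with gaps shorter than blocks. The expansion error then has
  -- order `n^{-5/4} * (k p) * p^{3/2} * n^{1/20}`, that is `n^{-5/4 + 1 + 3/40 + 1/20} = n^{-1/8}`.
  set p : ℕ → ℕ := fun n => ⌈(n : ℝ) ^ (1 / 20 : ℝ)⌉₊ with hp
  set q : ℕ → ℕ := fun n => ⌈(n : ℝ) ^ (1 / 40 : ℝ)⌉₊ with hq
  set k : ℕ → ℕ := fun n => n / (p n + q n) with hk
  have hratio : Tendsto (fun n : ℕ => ((k n : ℝ) * p n) / n) atTop (𝓝 1) := tendsto_block_ratio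
  have hpn : Tendsto (fun n : ℕ => (p n : ℝ) / n) atTop (𝓝 0) := by
    have h1 := (tendsto_natCast_rpow_neg (e := 19 / 20) (by norm_num)).const_mul 2
    rw [mul_zero] at h1
    refine squeeze_zero' (Eventually.of_forall fun n => by positivity) ?_ h1
    filter_upwards [eventually_ge_atTop 1] with n hn
    have hn0 : (0 : ℝ) < n := by exact_mod_cast hn
    rw [div_le_iff₀ hn0, mul_assoc, ← Real.rpow_add_one hn0.ne']
    rw [show (-(19 / 20) + 1 : ℝ) = 1 / 20 by norm_num]
    exact natCeil_rpow_le (by norm_num) hn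
  -- the error bound
  set err : ℕ → ℝ := fun n => |t| * Real.sqrt ((1 - (k n : ℝ) * p n / n) * v n) +
    (16 * K₀ * ((n : ℝ) ^ (1 : ℝ) * Real.exp (-l₀ * (n : ℝ) ^ (1 / 40 : ℝ))) +
      5 * |t| ^ (5 / 2 : ℝ) * (2 ^ (3 / 2 : ℝ) * |C| * (n : ℝ) ^ (-(1 / 8) : ℝ)) +
      ((k n : ℝ) * p n / n) * (p n / n) * (t ^ 2 / 2 * v n) ^ 2) with herr
  have herr0 : Tendsto err atTop (𝓝 0) := by
    have h1 : Tendsto (fun n => |t| * Real.sqrt ((1 - (k n : ℝ) * p n / n) * v n)) atTop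
        (𝓝 0) := by
      have := ((tendsto_const_nhds (x := (1 : ℝ))).sub hratio).mul hv
      simpa using (this.sqrt).const_mul |t|
    have h2 := (tendsto_rpow_mul_exp_neg_rpow 1 hl₀ (e := 1 / 40) (by norm_num)).const_mul (16 * K₀)
    have h3 := ((tendsto_natCast_rpow_neg (e := 1 / 8) (by norm_num)).const_mul
      (2 ^ (3 / 2 : ℝ) * |C|)).const_mul (5 * |t| ^ (5 / 2 : ℝ))
    have h4 := (hratio.mul hpn).mul ((hv.const_mul (t ^ 2 / 2)).pow 2)
    have h5 := h1.add ((h2.add h3).add h4)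
    norm_num only [mul_zero, zero_mul, add_zero] at h5
    convert! h5 using 2
  have hxlim : Tendsto (fun n : ℕ => t ^ 2 / 2 * ((p n : ℝ) / n * v n)) atTop (𝓝 0) := by
    simpa using (hpn.mul hv).const_mul (t ^ 2 / 2)
  have hmain : Tendsto (fun n : ℕ => ((Real.exp (-(t ^ 2 / 2 * ((k n : ℝ) * p n / n * v n))) : ℝ) :
      ℂ)) atTop (𝓝 ((Real.exp (-(t ^ 2 / 2 * w)) : ℝ) : ℂ)) := by
    have := ((hratio.mul hv).const_mul (t ^ 2 / 2)).neg
    rw [one_mul] at this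
    exact (Complex.continuous_ofReal.tendsto _).comp ((Real.continuous_exp.tendsto _).comp this)
  have hlim : Complex.exp (↑t * ↑(0 : ℝ) * Complex.I - ↑↑w.toNNReal * ↑t ^ 2 / 2) =
      ((Real.exp (-(t ^ 2 / 2 * w)) : ℝ) : ℂ) := by
    rw [Real.coe_toNNReal _ hw0]
    push_cast
    congr 1; ring
  rw [hlim]
  refine hmain.congr_dist (squeeze_zero_norm' ?_ herr0)
  filter_upwards [eventually_ge_atTop 1, hM, hxlim.eventually_le_const zero_lt_one]
    with n hn hMn hxn
  have hn0 : (0 : ℝ) < n := by exact_mod_cast hn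
  have hs0 : 0 < Real.sqrt n := Real.sqrt_pos.2 hn0
  have hp1 : (n : ℝ) ^ (1 / 20 : ℝ) ≤ p n := Nat.le_ceil _
  have hp2 : (p n : ℝ) ≤ 2 * (n : ℝ) ^ (1 / 20 : ℝ) := natCeil_rpow_le (by norm_num) hn
  have hp0 : 0 < (n : ℝ) ^ (1 / 20 : ℝ) := by positivity
  have hpp : (0 : ℝ) < p n := by linarith
  have hk2 : k n * (p n + q n) ≤ n := Nat.div_mul_le_self _ _
  have hkp : (k n : ℝ) * p n ≤ n := by
    rw [mul_add] at hk2
    exact_mod_cast (Nat.le_add_right _ _).trans hk2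
  have hkn : (k n : ℝ) ≤ n := by exact_mod_cast Nat.div_le_self _ _
  have hq1 : 1 ≤ q n := Nat.one_le_iff_ne_zero.2 (Nat.ceil_pos.2 (by positivity)).ne'
  have hqa : alphaMixingCoeff P Z (q n) ≤ K₀ * Real.exp (-l₀ * (q n : ℝ)) := hmix _ hq1
  have hK₀ : 0 ≤ K₀ := by
    have := (alphaMixingCoeff_nonneg (P := P) (Z := Z) (q n)).trans hqa
    exact nonneg_of_mul_nonneg_left this (Real.exp_pos _)
  have ht2 : (t / Real.sqrt n) ^ 2 = t ^ 2 / n := by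
    rw [div_pow, Real.sq_sqrt hn0.le]
  have key := norm_charFun_sum_sub_le (P := P) hZ (hψ n) (h0 n) (hint n) (hsi n) (hsq n) hMn hqa hk2
    (t / Real.sqrt n) (by rw [ht2]; refine le_trans (le_of_eq ?_) hxn; ring)
  rw [ht2] at key
  rw [Real.norm_of_nonneg dist_nonneg, dist_comm, dist_eq_norm, charFun_apply_real,
    integral_map (hm n).aemeasurable (by fun_prop)]
  have e1 : ∀ ω, Complex.exp (↑t * ↑((Real.sqrt n)⁻¹ * ∑ i ∈ Finset.range n, ψ n (Z i ω)) *
      Complex.I) = Complex.exp (((t / Real.sqrt n * ∑ i ∈ Finset.range n, ψ n (Z i ω) : ℝ) : ℂ) *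
      Complex.I) := by
    intro ω
    congr 2
    rw [← Complex.ofReal_mul]
    congr 1
    ring
  simp_rw [e1]
  rw [show t ^ 2 / 2 * ((k n : ℝ) * p n / n * v n) = t ^ 2 / n / 2 * (k n * p n * v n) by ring]
  refine key.trans ?_
  rw [herr]
  simp only
  have habs : |t / Real.sqrt n| = |t| / Real.sqrt n := by rw [abs_div, abs_of_pos hs0]
  rw [habs, mul_add, mul_add]
  refine add_le_add (le_of_eq ?_) (add_le_add (add_le_add ?_ ?_) (le_of_eq ?_))
  · rw [show (1 - (k n : ℝ) * p n / n) * v n = (n - k n * p n) * v n / n by field_simp,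
      Real.sqrt_div' _ hn0.le]
    ring
  · have hexp : Real.exp (-l₀ * (q n : ℝ)) ≤ Real.exp (-l₀ * (n : ℝ) ^ (1 / 40 : ℝ)) := by
      apply Real.exp_le_exp.2
      have : (n : ℝ) ^ (1 / 40 : ℝ) ≤ q n := Nat.le_ceil _
      nlinarith
    rw [Real.rpow_one]
    calc (k n : ℝ) * (16 * (K₀ * Real.exp (-l₀ * (q n : ℝ)))) ≤
        n * (16 * (K₀ * Real.exp (-l₀ * (n : ℝ) ^ (1 / 40 : ℝ)))) := by gcongr
      _ = _ := by ring
  · have e2 : (|t| / Real.sqrt n) ^ (5 / 2 : ℝ) = |t| ^ (5 / 2 : ℝ) * (n : ℝ) ^ (-(5 / 4) : ℝ) := by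
      rw [Real.div_rpow (abs_nonneg _) hs0.le, Real.sqrt_eq_rpow, ← Real.rpow_mul hn0.le,
        div_eq_mul_inv, ← Real.rpow_neg hn0.le]
      norm_num
    have e3 : (p n : ℝ) ^ (5 / 2 : ℝ) = p n * (p n : ℝ) ^ (3 / 2 : ℝ) := by
      rw [mul_comm, ← Real.rpow_add_one hpp.ne']; norm_num
    have e4 : (p n : ℝ) ^ (3 / 2 : ℝ) ≤ 2 ^ (3 / 2 : ℝ) * (n : ℝ) ^ (3 / 40 : ℝ) := by
      calc (p n : ℝ) ^ (3 / 2 : ℝ) ≤ (2 * (n : ℝ) ^ (1 / 20 : ℝ)) ^ (3 / 2 : ℝ) :=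
            Real.rpow_le_rpow hpp.le hp2 (by norm_num)
        _ = _ := by
            rw [Real.mul_rpow (by norm_num) hp0.le, ← Real.rpow_mul hn0.le]; norm_num
    have e5 : (n : ℝ) ^ (-(5 / 4) : ℝ) * n * (n : ℝ) ^ (3 / 40 : ℝ) * (n : ℝ) ^ (1 / 20 : ℝ) =
        (n : ℝ) ^ (-(1 / 8) : ℝ) := by
      rw [← Real.rpow_add_one hn0.ne', ← Real.rpow_add hn0, ← Real.rpow_add hn0]; norm_num
    rw [e2, e3]
    have t0 : 0 ≤ |t| ^ (5 / 2 : ℝ) := Real.rpow_nonneg (abs_nonneg _) _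
    calc (k n : ℝ) * (5 * (|t| ^ (5 / 2 : ℝ) * (n : ℝ) ^ (-(5 / 4) : ℝ)) *
          (p n * (p n : ℝ) ^ (3 / 2 : ℝ) * (C * (n : ℝ) ^ (1 / 20 : ℝ))))
        = 5 * |t| ^ (5 / 2 : ℝ) * ((n : ℝ) ^ (-(5 / 4) : ℝ) * (k n * p n) *
            ((p n : ℝ) ^ (3 / 2 : ℝ)) * (n : ℝ) ^ (1 / 20 : ℝ) * C) := by ring
      _ ≤ 5 * |t| ^ (5 / 2 : ℝ) * ((n : ℝ) ^ (-(5 / 4) : ℝ) * (k n * p n) *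
            ((p n : ℝ) ^ (3 / 2 : ℝ)) * (n : ℝ) ^ (1 / 20 : ℝ) * |C|) := by
          gcongr
          exact le_abs_self C
      _ ≤ 5 * |t| ^ (5 / 2 : ℝ) * ((n : ℝ) ^ (-(5 / 4) : ℝ) * n *
            (2 ^ (3 / 2 : ℝ) * (n : ℝ) ^ (3 / 40 : ℝ)) * (n : ℝ) ^ (1 / 20 : ℝ) * |C|) := by
          gcongr
      _ = 5 * |t| ^ (5 / 2 : ℝ) * (2 ^ (3 / 2 : ℝ) * |C| * ((n : ℝ) ^ (-(5 / 4) : ℝ) * n *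
            (n : ℝ) ^ (3 / 40 : ℝ) * (n : ℝ) ^ (1 / 20 : ℝ))) := by ring
      _ = _ := by rw [e5]
  · field_simp

end MixingCLT

/-! ### The uniform law on the cube. -/

section Cube

/-- The uniform law on `[0,1]`. -/
noncomputable def unitLaw : Measure ℝ := volume.restrict (Set.Icc 0 1)

/-- The uniform law on the cube. -/
noncomputable def cubeLaw (d : ℕ) : Measure (Fin d → ℝ) := volume.restrict (cube d)

instance : IsProbabilityMeasure unitLaw := ⟨by simp [unitLaw]⟩

variable {d : ℕ}

lemma cube_eq_pi : cube d = Set.univ.pi fun _ => Set.Icc (0 : ℝ) 1 := by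
  ext x; simp only [cube, Set.mem_ofPred_eq, Set.mem_univ_pi]

lemma cubeLaw_eq_pi : cubeLaw d = Measure.pi fun _ : Fin d => unitLaw := by
  rw [cubeLaw, cube_eq_pi, volume_pi, Measure.restrict_pi_pi]; rfl

instance : IsProbabilityMeasure (cubeLaw d) := by rw [cubeLaw_eq_pi]; infer_instance

lemma measurableSet_cube : MeasurableSet (cube d) := by
  rw [cube_eq_pi]; exact MeasurableSet.univ_pi fun _ => measurableSet_Icc

lemma isCompact_cube : IsCompact (cube d) := by
  rw [cube_eq_pi]; exact isCompact_univ_pi fun _ => isCompact_Icc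

lemma ae_mem_cube : ∀ᵐ y ∂cubeLaw d, y ∈ cube d := ae_restrict_mem measurableSet_cube

lemma ae_mem_unit : ∀ᵐ t ∂unitLaw, t ∈ Set.Icc (0 : ℝ) 1 := ae_restrict_mem measurableSet_Icc

lemma measurePreserving_eval_cubeLaw (α : Fin d) :
    MeasurePreserving (fun y : Fin d → ℝ => y α) (cubeLaw d) unitLaw := by
  rw [cubeLaw_eq_pi]; exact measurePreserving_eval _ α

lemma integral_eval_cubeLaw (α : Fin d) {φ : ℝ → ℝ} (hφ : Measurable φ) :
    ∫ y, φ (y α) ∂cubeLaw d = ∫ t, φ t ∂unitLaw := by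
  rw [← (measurePreserving_eval_cubeLaw α).map_eq,
    integral_map (measurable_pi_apply α).aemeasurable hφ.aestronglyMeasurable]

lemma iIndepFun_eval_cubeLaw {g : Fin d → ℝ → ℝ} (hg : ∀ α, Measurable (g α)) :
    iIndepFun (fun α (y : Fin d → ℝ) => g α (y α)) (cubeLaw d) := by
  rw [cubeLaw_eq_pi]
  exact iIndepFun_pi fun α => (hg α).aemeasurable

/-- Independence of the coordinates holds under the uniform law and not under the law of the
predictors; estimates for the latter are obtained from the former through the bounds on the density.
-/
lemma integral_mul_eval_cubeLaw {α β : Fin d} (hαβ : α ≠ β) {φ ψ : ℝ → ℝ} (hφ : Measurable φ)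
    (hψ : Measurable ψ) :
    ∫ y, φ (y α) * ψ (y β) ∂cubeLaw d = (∫ t, φ t ∂unitLaw) * ∫ t, ψ t ∂unitLaw := by
  have h := (iIndepFun_eval_cubeLaw (d := d) (g := fun _ t => t) fun _ => measurable_id).indepFun
    hαβ
  have h2 := h.comp hφ hψ
  have := h2.integral_fun_mul_eq_mul_integral
    (hφ.comp (measurable_pi_apply α)).aestronglyMeasurable
    (hψ.comp (measurable_pi_apply β)).aestronglyMeasurable
  simp only [Function.comp] at this
  rw [this, integral_eval_cubeLaw α hφ, integral_eval_cubeLaw β hψ]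

lemma measurable_update_prod (α : Fin d) :
    Measurable fun p : ℝ × (Fin d → ℝ) => Function.update p.2 α p.1 := by
  rw [measurable_pi_iff]
  intro β
  by_cases h : β = α
  · subst h; simpa using measurable_fst
  · simp only [Function.update_of_ne h]
    exact (measurable_pi_apply β).comp measurable_snd

/-- Redrawing one coordinate preserves the uniform law on the cube. -/
lemma measurePreserving_update (α : Fin d) :
    MeasurePreserving (fun p : ℝ × (Fin d → ℝ) => Function.update p.2 α p.1)
      (unitLaw.prod (cubeLaw d)) (cubeLaw d) := by
  refine ⟨measurable_update_prod α, ?_⟩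
  conv_rhs => rw [cubeLaw_eq_pi]
  refine (Measure.pi_eq fun s hs => ?_).symm
  rw [Measure.map_apply (measurable_update_prod α) (MeasurableSet.univ_pi hs)]
  have : (fun p : ℝ × (Fin d → ℝ) => Function.update p.2 α p.1) ⁻¹' Set.univ.pi s =
      s α ×ˢ Set.univ.pi (Function.update s α Set.univ) := by
    ext ⟨t, y⟩
    simp only [Set.mem_preimage, Set.mem_pi, Set.mem_univ, forall_const, Set.mem_prod]
    constructor
    · intro h
      refine ⟨by simpa using h α, fun β => ?_⟩
      by_cases hβ : β = α
      · subst hβ; simp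
      · simpa [Function.update_of_ne hβ] using h β
    · rintro ⟨h1, h2⟩ β
      by_cases hβ : β = α
      · subst hβ; simpa using h1
      · simpa [Function.update_of_ne hβ] using h2 β
  rw [this, Measure.prod_prod, cubeLaw_eq_pi, Measure.pi_pi,
    ← Finset.mul_prod_erase _ _ (Finset.mem_univ α), ← Finset.mul_prod_erase Finset.univ
      (fun i => unitLaw (s i)) (Finset.mem_univ α)]
  simp only [Function.update_self, measure_univ, one_mul]
  congr 1
  refine Finset.prod_congr rfl fun β hβ => ?_
  rw [Function.update_of_ne (Finset.ne_of_mem_erase hβ)]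

/-- Integrating out all the coordinates but one. -/
lemma integral_eval_mul_eq_sliceIntegral (α : Fin d) {φ : ℝ → ℝ}
    {g : (Fin d → ℝ) → ℝ} (hi : Integrable (fun y => φ (y α) * g y) (cubeLaw d)) :
    ∫ y, φ (y α) * g y ∂cubeLaw d = ∫ t, φ t * sliceIntegral g α t ∂unitLaw := by
  -- `sliceIntegral` still integrates over the idle coordinate `α`. Redrawing that coordinate from
  -- an independent uniform variable puts the integral in the form to which Fubini applies.
  have hmp := measurePreserving_update α
  have h1 : ∫ y, φ (y α) * g y ∂cubeLaw d = ∫ p, φ (Function.update p.2 α p.1 α) *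
      g (Function.update p.2 α p.1) ∂(unitLaw.prod (cubeLaw d)) := by
    conv_lhs => rw [← hmp.map_eq]
    rw [integral_map hmp.measurable.aemeasurable (by rw [hmp.map_eq]; exact hi.1)]
  have hi2 : Integrable (fun p : ℝ × (Fin d → ℝ) => φ (Function.update p.2 α p.1 α) *
      g (Function.update p.2 α p.1)) (unitLaw.prod (cubeLaw d)) :=
    hmp.integrable_comp_of_integrable hi
  rw [h1, integral_prod _ hi2]
  refine integral_congr_ae (ae_of_all _ fun t => ?_)
  simp only [Function.update_self]
  rw [integral_const_mul]
  rfl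

lemma update_mem_cube {y : Fin d → ℝ} (hy : y ∈ cube d) {α : Fin d} {t : ℝ}
    (ht : t ∈ Set.Icc (0 : ℝ) 1) : Function.update y α t ∈ cube d := by
  intro β
  by_cases h : β = α
  · subst h; simpa using ht
  · simpa [Function.update_of_ne h] using hy β

lemma continuousOn_slice {g : (Fin d → ℝ) → ℝ} (hg : ContinuousOn g (cube d)) {α : Fin d} {t : ℝ}
    (ht : t ∈ Set.Icc (0 : ℝ) 1) : ContinuousOn (fun y => g (Function.update y α t)) (cube d) :=
  hg.comp (continuous_id.update α continuous_const).continuousOn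
    fun _ hy => update_mem_cube hy ht

lemma exists_bound_of_continuousOn {g : (Fin d → ℝ) → ℝ} (hg : ContinuousOn g (cube d)) :
    ∃ C, ∀ y ∈ cube d, |g y| ≤ C := by
  obtain ⟨C, hC⟩ := isCompact_cube.exists_bound_of_continuousOn hg
  exact ⟨C, fun y hy => by simpa using hC y hy⟩

lemma integrable_cubeLaw {g : (Fin d → ℝ) → ℝ} (hg : ContinuousOn g (cube d)) :
    Integrable g (cubeLaw d) := by
  obtain ⟨C, hC⟩ := exists_bound_of_continuousOn hg
  refine Integrable.of_bound (hg.aestronglyMeasurable measurableSet_cube) C ?_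
  filter_upwards [ae_mem_cube] with y hy using by simpa using hC y hy

lemma continuousOn_sliceIntegral {g : (Fin d → ℝ) → ℝ} (hg : ContinuousOn g (cube d))
    (α : Fin d) : ContinuousOn (sliceIntegral g α) (Set.Icc 0 1) := by
  obtain ⟨C, hC⟩ := exists_bound_of_continuousOn hg
  refine continuousOn_of_dominated (μ := cubeLaw d) (F := fun t y => g (Function.update y α t))
    (bound := fun _ => C) (fun t ht => ?_) (fun t ht => ?_) (integrable_const _) ?_
  · exact (continuousOn_slice hg ht).aestronglyMeasurable measurableSet_cube
  · filter_upwards [ae_mem_cube] with y hy using by simpa using hC _ (update_mem_cube hy ht)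
  · filter_upwards [ae_mem_cube] with y hy
    have hc : Continuous fun t : ℝ => Function.update y α t := continuous_const.update α continuous_id
    exact hg.comp hc.continuousOn
      fun t ht => update_mem_cube hy ht

lemma sliceIntegral_mem {g : (Fin d → ℝ) → ℝ} (hg : ContinuousOn g (cube d)) {a b : ℝ}
    (hb : ∀ y ∈ cube d, a ≤ g y ∧ g y ≤ b) (α : Fin d) {t : ℝ} (ht : t ∈ Set.Icc (0 : ℝ) 1) :
    a ≤ sliceIntegral g α t ∧ sliceIntegral g α t ≤ b := by
  have hi : Integrable (fun y => g (Function.update y α t)) (cubeLaw d) :=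
    integrable_cubeLaw (continuousOn_slice hg ht)
  constructor
  · have : ∫ y : Fin d → ℝ, a ∂cubeLaw d ≤ ∫ y, g (Function.update y α t) ∂cubeLaw d := by
      refine integral_mono_ae (integrable_const _) hi ?_
      filter_upwards [ae_mem_cube] with y hy using (hb _ (update_mem_cube hy ht)).1
    rw [integral_const, probReal_univ, one_smul] at this
    exact this
  · have : ∫ y, g (Function.update y α t) ∂cubeLaw d ≤ ∫ y : Fin d → ℝ, b ∂cubeLaw d := by
      refine integral_mono_ae hi (integrable_const _) ?_
      filter_upwards [ae_mem_cube] with y hy using (hb _ (update_mem_cube hy ht)).2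
    rw [integral_const, probReal_univ, one_smul] at this
    exact this

end Cube

/-! ### The law of the predictors compared with the uniform law. -/

section Density

variable {d : ℕ} {f : (Fin d → ℝ) → ℝ} {c₁ c₂ : ℝ}

lemma integral_densityLaw (hf : ContinuousOn f (cube d)) (h0 : ∀ x ∈ cube d, 0 ≤ f x)
    (φ : (Fin d → ℝ) → ℝ) : ∫ x, φ x ∂densityLaw f = ∫ y, φ y * f y ∂cubeLaw d := by
  have hm : AEMeasurable f (cubeLaw d) :=
    (hf.aestronglyMeasurable measurableSet_cube).aemeasurable
  change ∫ x, φ x ∂((cubeLaw d).withDensity fun x => ENNReal.ofReal (f x)) = _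
  rw [integral_withDensity_eq_integral_toReal_smul₀ hm.ennreal_ofReal
    (ae_of_all _ fun _ => ENNReal.ofReal_lt_top)]
  refine integral_congr_ae ?_
  filter_upwards [ae_mem_cube] with y hy
  rw [ENNReal.toReal_ofReal (h0 y hy), smul_eq_mul, mul_comm]

lemma ae_densityLaw_of_ae {p : (Fin d → ℝ) → Prop} (h : ∀ᵐ y ∂cubeLaw d, p y) :
    ∀ᵐ y ∂densityLaw f, p y :=
  (withDensity_absolutelyContinuous _ _).ae_le h

lemma integrable_mul_density (hf : ContinuousOn f (cube d)) {φ : (Fin d → ℝ) → ℝ}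
    (hφ : Integrable φ (cubeLaw d)) : Integrable (fun y => φ y * f y) (cubeLaw d) := by
  obtain ⟨C, hC⟩ := exists_bound_of_continuousOn hf
  exact hφ.mul_bdd (c := C) (hf.aestronglyMeasurable measurableSet_cube)
    (by filter_upwards [ae_mem_cube] with y hy using by simpa using hC y hy)

/-- With `le_integral_densityLaw`, this lets integrals of nonnegative functions be computed under
independent coordinates, at the price of the constants `c₁` and `c₂`. -/
lemma integral_densityLaw_le (hf : ContinuousOn f (cube d)) (hc₁ : 0 ≤ c₁)
    (hb : ∀ x ∈ cube d, c₁ ≤ f x ∧ f x ≤ c₂) {φ : (Fin d → ℝ) → ℝ}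
    (hφ : Integrable φ (cubeLaw d)) (h0 : ∀ x, 0 ≤ φ x) :
    ∫ x, φ x ∂densityLaw f ≤ c₂ * ∫ y, φ y ∂cubeLaw d := by
  rw [integral_densityLaw hf (fun x hx => hc₁.trans (hb x hx).1), ← integral_const_mul]
  refine integral_mono_ae (integrable_mul_density hf hφ) (hφ.const_mul _) ?_
  filter_upwards [ae_mem_cube] with y hy
  rw [mul_comm]
  exact mul_le_mul_of_nonneg_right (hb y hy).2 (h0 y)

lemma le_integral_densityLaw (hf : ContinuousOn f (cube d)) (hc₁ : 0 ≤ c₁)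
    (hb : ∀ x ∈ cube d, c₁ ≤ f x ∧ f x ≤ c₂) {φ : (Fin d → ℝ) → ℝ}
    (hφ : Integrable φ (cubeLaw d)) (h0 : ∀ x, 0 ≤ φ x) :
    c₁ * ∫ y, φ y ∂cubeLaw d ≤ ∫ x, φ x ∂densityLaw f := by
  rw [integral_densityLaw hf (fun x hx => hc₁.trans (hb x hx).1), ← integral_const_mul]
  refine integral_mono_ae (hφ.const_mul _) (integrable_mul_density hf hφ) ?_
  filter_upwards [ae_mem_cube] with y hy
  rw [mul_comm c₁, mul_comm _ (f y), mul_comm (φ y)]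
  exact mul_le_mul_of_nonneg_right (hb y hy).1 (h0 y)

lemma integral_eval_densityLaw (hf : ContinuousOn f (cube d)) (h0 : ∀ x ∈ cube d, 0 ≤ f x)
    (α : Fin d) {φ : ℝ → ℝ} (hφ : Integrable (fun y : Fin d → ℝ => φ (y α)) (cubeLaw d)) :
    ∫ x, φ (x α) ∂densityLaw f = ∫ t, φ t * marginalDensity f α t ∂unitLaw := by
  rw [integral_densityLaw hf h0 fun x => φ (x α),
    integral_eval_mul_eq_sliceIntegral α (integrable_mul_density hf hφ)]
  rfl

lemma integrable_eval_of_bound {μ : Measure (Fin d → ℝ)} [IsFiniteMeasure μ] {g : ℝ → ℝ}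
    (hg : Measurable g) {B : ℝ} (hB : ∀ t, |g t| ≤ B) (α : Fin d) :
    Integrable (fun y : Fin d → ℝ => g (y α)) μ :=
  Integrable.of_bound (hg.comp (measurable_pi_apply α)).aestronglyMeasurable B
    (ae_of_all _ fun y => by simpa using hB _)

/-- The components of an additive function are controlled by the norm of the function, up to their
means. -/
lemma sum_integral_sq_le [IsProbabilityMeasure (densityLaw f)] (hf : ContinuousOn f (cube d))
    (hc₁ : 0 < c₁) (hb : ∀ x ∈ cube d, c₁ ≤ f x ∧ f x ≤ c₂) (hc₂ : 0 ≤ c₂) {g : Fin d → ℝ → ℝ}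
    (hg : ∀ α, Measurable (g α)) {B : ℝ} (hB : ∀ α t, |g α t| ≤ B) :
    ∑ α, ∫ t, g α t ^ 2 ∂unitLaw ≤ ((1 + 2 * c₂) / c₁ + 2) *
      (∫ x, (∑ α, g α (x α)) ^ 2 ∂densityLaw f + ∑ α, (∫ x, g α (x α) ∂densityLaw f) ^ 2) := by
  have hmem : ∀ α, MemLp (fun y : Fin d → ℝ => g α (y α)) 2 (cubeLaw d) := fun α =>
    MemLp.of_bound ((hg α).comp (measurable_pi_apply α)).aestronglyMeasurable B
      (ae_of_all _ fun y => by simpa using hB α _)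
  set V : Fin d → ℝ := fun α => Var[fun y : Fin d → ℝ => g α (y α); cubeLaw d] with hV
  have hV0 : ∀ α, 0 ≤ V α := fun α => variance_nonneg _ _
  -- Under the uniform law the components are independent, so their variances add up without any
  -- cancellation. This is the source of the stability.
  have hvar : ∑ α, V α ≤ ∫ y, (∑ α, g α (y α)) ^ 2 ∂cubeLaw d := by
    have h1 := IndepFun.variance_sum (μ := cubeLaw d) (s := Finset.univ)
      (X := fun α (y : Fin d → ℝ) => g α (y α)) (fun α _ => hmem α)
      fun α _ β _ hαβ => (iIndepFun_eval_cubeLaw hg).indepFun hαβ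
    rw [hV, ← h1]
    have h2 := variance_le_expectation_sq (μ := cubeLaw d)
      (X := ∑ α, fun y : Fin d → ℝ => g α (y α))
      (Finset.aestronglyMeasurable_sum _ fun α _ => (hmem α).1)
    simpa using h2
  have hsum : ∑ α, V α ≤ c₁⁻¹ * ∫ x, (∑ α, g α (x α)) ^ 2 ∂densityLaw f := by
    refine hvar.trans ?_
    rw [inv_mul_eq_div, le_div_iff₀ hc₁, mul_comm]
    refine le_integral_densityLaw hf hc₁.le hb ?_ fun x => sq_nonneg _
    have : MemLp (fun y : Fin d → ℝ => ∑ α, g α (y α)) 2 (cubeLaw d) :=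
      memLp_finsetSum _ fun α _ => hmem α
    exact this.integrable_sq
  have hcomp : ∀ α, ∫ t, g α t ^ 2 ∂unitLaw ≤
      (1 + 2 * c₂) * V α + 2 * (∫ x, g α (x α) ∂densityLaw f) ^ 2 := by
    intro α
    set w : ℝ := ∫ y, g α (y α) ∂cubeLaw d with hw
    have e1 : V α = ∫ t, g α t ^ 2 ∂unitLaw - w ^ 2 := by
      rw [hV]; simp only
      rw [variance_eq_sub (hmem α)]
      congr 1
      exact integral_eval_cubeLaw α ((hg α).pow_const 2)
    have hgi : Integrable (fun y : Fin d → ℝ => g α (y α)) (densityLaw f) :=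
      integrable_eval_of_bound (hg α) (hB α) α
    set u : ℝ := ∫ x, g α (x α) ∂densityLaw f with hu
    -- The two means differ by the mean of `g α - w` under the density law; Jensen's inequality and
    -- `f ≤ c₂` bound its square.
    have e2 : (u - w) ^ 2 ≤ c₂ * V α := by
      have hmu : MemLp (fun y : Fin d → ℝ => g α (y α) - w) 2 (densityLaw f) :=
        MemLp.of_bound (((hg α).comp (measurable_pi_apply α)).sub_const _).aestronglyMeasurable
          (B + |w|) (ae_of_all _ fun y => (norm_sub_le _ _).trans
            (add_le_add (by simpa using hB α _) (by simp)))
      have hmu' : MemLp (fun y : Fin d → ℝ => g α (y α) - w) 2 (cubeLaw d) :=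
        MemLp.of_bound (((hg α).comp (measurable_pi_apply α)).sub_const _).aestronglyMeasurable
          (B + |w|) (ae_of_all _ fun y => (norm_sub_le _ _).trans
            (add_le_add (by simpa using hB α _) (by simp)))
      have h1 := variance_nonneg (fun y : Fin d → ℝ => g α (y α) - w) (densityLaw f)
      rw [variance_eq_sub hmu, integral_sub hgi (integrable_const _)] at h1
      have h2 := integral_densityLaw_le hf hc₁.le hb hmu'.integrable_sq fun x => sq_nonneg _
      have h3 : V α = ∫ y, (g α (y α) - w) ^ 2 ∂cubeLaw d := by
        rw [hV]; simp only
        rw [variance_eq_integral (hmem α).1.aemeasurable]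
      simp only [Pi.pow_apply, integral_const, probReal_univ, smul_eq_mul,
        one_mul] at h1
      rw [h3]
      linarith
    -- The hint is `w² ≤ 2u² + 2(u - w)²`, whose defect is `(2u - w)²`.
    nlinarith [sq_nonneg (2 * u - w), hV0 α]
  have hV' : 0 ≤ ∑ α, V α := Finset.sum_nonneg fun α _ => hV0 α
  have hE : 0 ≤ ∑ α, (∫ x, g α (x α) ∂densityLaw f) ^ 2 :=
    Finset.sum_nonneg fun α _ => sq_nonneg _
  have hQ : 0 ≤ ∫ x, (∑ α, g α (x α)) ^ 2 ∂densityLaw f := integral_nonneg fun x => sq_nonneg _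
  calc ∑ α, ∫ t, g α t ^ 2 ∂unitLaw ≤
      ∑ α, ((1 + 2 * c₂) * V α + 2 * (∫ x, g α (x α) ∂densityLaw f) ^ 2) :=
        Finset.sum_le_sum fun α _ => hcomp α
    _ = (1 + 2 * c₂) * ∑ α, V α + 2 * ∑ α, (∫ x, g α (x α) ∂densityLaw f) ^ 2 := by
        rw [Finset.sum_add_distrib, Finset.mul_sum, Finset.mul_sum]
    _ ≤ (1 + 2 * c₂) * (c₁⁻¹ * ∫ x, (∑ α, g α (x α)) ^ 2 ∂densityLaw f) +
        2 * ∑ α, (∫ x, g α (x α) ∂densityLaw f) ^ 2 := by gcongr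
    _ ≤ _ := by
        have h3 : 0 ≤ (1 + 2 * c₂) / c₁ := by positivity
        have e : (1 + 2 * c₂) * (c₁⁻¹ * ∫ x, (∑ α, g α (x α)) ^ 2 ∂densityLaw f) =
          (1 + 2 * c₂) / c₁ * ∫ x, (∑ α, g α (x α)) ^ 2 ∂densityLaw f := by
            rw [div_eq_mul_inv]; ring
        rw [e]
        nlinarith [mul_nonneg h3 hE]

end Density

/-! ### Indicators of the cells and step functions. -/

section Cells

variable {N J : ℕ} {t : ℝ}

/-- Indexing the cell by an integer part makes both the disjointness of the cells and their covering
of `[0,1)` immediate. -/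
lemma cell_eq_ite (N J : ℕ) (ht : 0 ≤ t) :
    cell N J t = if ⌊t * ((N : ℝ) + 1)⌋₊ = J then 1 else 0 := by
  have hM : (0 : ℝ) < (N : ℝ) + 1 := by positivity
  have : (⌊t * ((N : ℝ) + 1)⌋₊ = J) ↔
      ((J : ℝ) * ((N : ℝ) + 1)⁻¹ ≤ t ∧ t < ((J : ℝ) + 1) * ((N : ℝ) + 1)⁻¹) := by
    rw [Nat.floor_eq_iff (by positivity), ← div_eq_mul_inv, ← div_eq_mul_inv, div_le_iff₀ hM,
      lt_div_iff₀ hM]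
  simp only [cell, this]

lemma cell_eq_zero_of_neg (ht : t < 0) : cell N J t = 0 := by
  rw [cell, if_neg]
  rintro ⟨h, -⟩
  have : (0 : ℝ) ≤ (J : ℝ) * ((N : ℝ) + 1)⁻¹ := by positivity
  linarith

lemma cell_nonneg (N J : ℕ) (t : ℝ) : 0 ≤ cell N J t := by
  unfold cell; split_ifs <;> norm_num

lemma cell_le_one (N J : ℕ) (t : ℝ) : cell N J t ≤ 1 := by
  unfold cell; split_ifs <;> norm_num

lemma abs_cell_le_one (N J : ℕ) (t : ℝ) : |cell N J t| ≤ 1 := by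
  rw [abs_of_nonneg (cell_nonneg _ _ _)]; exact cell_le_one _ _ _

lemma cell_sq (N J : ℕ) (t : ℝ) : cell N J t ^ 2 = cell N J t := by
  unfold cell; split_ifs <;> norm_num

lemma cell_mul_cell_of_ne {J' : ℕ} (h : J ≠ J') : cell N J t * cell N J' t = 0 := by
  rcases lt_or_ge t 0 with ht | ht
  · rw [cell_eq_zero_of_neg ht, zero_mul]
  · rw [cell_eq_ite _ _ ht, cell_eq_ite _ _ ht]
    split_ifs with h1 h2
    · exact absurd (h1.symm.trans h2) h
    all_goals simp

lemma measurable_cell (N J : ℕ) : Measurable (cell N J) := by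
  refine Measurable.ite ?_ measurable_const measurable_const
  exact measurableSet_Ico

lemma floor_lt_of_mem (ht : t ∈ Set.Ico (0 : ℝ) 1) : ⌊t * ((N : ℝ) + 1)⌋₊ < N + 1 := by
  have hM : (0 : ℝ) < (N : ℝ) + 1 := by positivity
  rw [Nat.floor_lt (mul_nonneg ht.1 hM.le)]
  push_cast
  nlinarith [ht.2]

/-- The value of a step function. -/
lemma sum_mul_cell (a : Fin (N + 1) → ℝ) (ht : t ∈ Set.Ico (0 : ℝ) 1) :
    ∑ J, a J * cell N J t = a ⟨_, floor_lt_of_mem ht⟩ := by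
  rw [Finset.sum_eq_single ⟨_, floor_lt_of_mem ht⟩]
  · rw [cell_eq_ite _ _ ht.1]; simp
  · intro J _ hJ
    rw [cell_eq_ite _ _ ht.1, if_neg, mul_zero]
    intro h; exact hJ (Fin.ext h.symm)
  · simp

lemma sum_cell_eq_one (ht : t ∈ Set.Ico (0 : ℝ) 1) : ∑ J : Fin (N + 1), cell N J t = 1 := by
  simpa using sum_mul_cell (fun _ => (1 : ℝ)) ht

lemma sum_cell_le_one (N : ℕ) (t : ℝ) : ∑ J : Fin (N + 1), cell N J t ≤ 1 := by
  -- Disjointness makes the sum idempotent, hence zero or one, for every real `t`, including points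
  -- outside `[0,1)`.
  have h1 : (∑ J : Fin (N + 1), cell N J t) ^ 2 = ∑ J : Fin (N + 1), cell N J t := by
    rw [sq, Finset.sum_mul_sum]
    refine Finset.sum_congr rfl fun i _ => ?_
    rw [Finset.sum_eq_single_of_mem i (Finset.mem_univ _) fun j _ hj =>
      cell_mul_cell_of_ne fun h => hj (Fin.ext h.symm), ← sq, cell_sq]
  nlinarith [sq_nonneg (∑ J : Fin (N + 1), cell N J t - 1)]

/-- The square of a step function. -/
lemma sq_sum_mul_cell (a : Fin (N + 1) → ℝ) (t : ℝ) :
    (∑ J, a J * cell N J t) ^ 2 = ∑ J, a J ^ 2 * cell N J t := by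
  rw [sq, Finset.sum_mul_sum]
  refine Finset.sum_congr rfl fun i _ => ?_
  rw [Finset.sum_eq_single_of_mem i (Finset.mem_univ _)]
  · linear_combination a i ^ 2 * cell_sq N i t
  · intro j _ hj
    rw [show a i * cell N i t * (a j * cell N j t) = a i * a j * (cell N i t * cell N j t) by ring,
      cell_mul_cell_of_ne (fun h => hj (Fin.ext h.symm)), mul_zero]

lemma integral_cell (hJ : J < N + 1) : ∫ t, cell N J t ∂unitLaw = ((N : ℝ) + 1)⁻¹ := by
  have hM : (0 : ℝ) < (N : ℝ) + 1 := by positivity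
  have hJ' : (J : ℝ) + 1 ≤ (N : ℝ) + 1 := by exact_mod_cast hJ
  have e : cell N J = (Set.Ico ((J : ℝ) * ((N : ℝ) + 1)⁻¹)
      (((J : ℝ) + 1) * ((N : ℝ) + 1)⁻¹)).indicator fun _ => (1 : ℝ) := by
    ext t
    by_cases h : (J : ℝ) * ((N : ℝ) + 1)⁻¹ ≤ t ∧ t < ((J : ℝ) + 1) * ((N : ℝ) + 1)⁻¹
    · rw [cell, if_pos h, Set.indicator_of_mem (Set.mem_Ico.2 h)]
    · rw [cell, if_neg h, Set.indicator_of_notMem (mt Set.mem_Ico.1 h)]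
  have hsub : Set.Ico ((J : ℝ) * ((N : ℝ) + 1)⁻¹) (((J : ℝ) + 1) * ((N : ℝ) + 1)⁻¹) ⊆
      Set.Icc 0 1 := by
    intro t ht
    have h0 : (0 : ℝ) ≤ (J : ℝ) * ((N : ℝ) + 1)⁻¹ := by positivity
    have h1 : ((J : ℝ) + 1) * ((N : ℝ) + 1)⁻¹ ≤ 1 := by
      rw [← div_eq_mul_inv, div_le_one hM]; exact hJ'
    exact ⟨h0.trans ht.1, ht.2.le.trans h1⟩
  rw [e, integral_indicator measurableSet_Ico, unitLaw,
    Measure.restrict_restrict_of_subset hsub, setIntegral_const, smul_eq_mul, mul_one,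
    Real.volume_real_Ico_of_le]
  · ring
  · gcongr; linarith

end Cells

/-! ### Normal equations of the spline fit. -/

section NormalEquations

variable {d : ℕ} {ν : Measure (Fin d → ℝ)} {N n : ℕ} {X : ℕ → Fin d → ℝ} {Y : ℕ → ℝ} {l₀ : ℝ}
  {l : Fin d → Fin N → ℝ}

lemma splineComponent_add_smul (k : Fin d → Fin N → ℝ) (r : ℝ) (α : Fin d) (t : ℝ) :
    splineComponent ν N (fun α J => l α J + r * k α J) α t =
      splineComponent ν N l α t + r * splineComponent ν N k α t := by
  simp only [splineComponent, Finset.mul_sum, ← Finset.sum_add_distrib]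
  exact Finset.sum_congr rfl fun _ _ => by ring

/-- The residuals of a least squares fit are orthogonal to the regressors. -/
lemma IsLeastSquares.orthogonal (h : IsLeastSquares ν N n X Y l₀ l) (k₀ : ℝ)
    (k : Fin d → Fin N → ℝ) :
    ∑ i ∈ Finset.range n, (Y i - l₀ - ∑ α, splineComponent ν N l α (X i α)) *
      (k₀ + ∑ α, splineComponent ν N k α (X i α)) = 0 := by
  set e : ℕ → ℝ := fun i => Y i - l₀ - ∑ α, splineComponent ν N l α (X i α) with he
  set g : ℕ → ℝ := fun i => k₀ + ∑ α, splineComponent ν N k α (X i α) with hg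
  set s : ℝ := ∑ i ∈ Finset.range n, e i * g i with hs
  set G : ℝ := ∑ i ∈ Finset.range n, g i ^ 2 with hG
  have hG0 : 0 ≤ G := Finset.sum_nonneg fun i _ => sq_nonneg _
  have key : ∀ r : ℝ, 0 ≤ -2 * r * s + r ^ 2 * G := by
    intro r
    have h1 := h (l₀ + r * k₀) fun α J => l α J + r * k α J
    have e1 : residualSS ν N n X Y (l₀ + r * k₀) (fun α J => l α J + r * k α J) =
        residualSS ν N n X Y l₀ l + (-2 * r * s + r ^ 2 * G) := by
      simp only [residualSS, splineComponent_add_smul, hs, hG, Finset.mul_sum,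
        ← Finset.sum_add_distrib]
      refine Finset.sum_congr rfl fun i _ => ?_
      simp only [he, hg, Finset.sum_add_distrib, ← Finset.mul_sum]
      ring
    linarith
  -- A perturbation of size `r` changes the criterion by `-2rs + r²G`. The minimizing `r` would be
  -- `s / G`; adding one to the denominator avoids the case `G = 0` and still forces `s = 0`.
  have h2 := key (s / (G + 1))
  have h3 : -2 * (s / (G + 1)) * s + (s / (G + 1)) ^ 2 * G = -(s ^ 2 * (G + 2) / (G + 1) ^ 2) := by
    field_simp; ring
  rw [h3] at h2
  have h4 : s ^ 2 * (G + 2) / (G + 1) ^ 2 ≤ 0 := by linarith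
  have h5 : s ^ 2 * (G + 2) ≤ 0 := by
    rw [div_le_iff₀ (by positivity)] at h4; linarith
  have h6 : s ^ 2 ≤ 0 := by nlinarith [sq_nonneg s]
  exact pow_eq_zero_iff two_ne_zero |>.1 (le_antisymm h6 (sq_nonneg s))

lemma IsLeastSquares.sum_residual (h : IsLeastSquares ν N n X Y l₀ l) :
    ∑ i ∈ Finset.range n, (Y i - l₀ - ∑ α, splineComponent ν N l α (X i α)) = 0 := by
  simpa [splineComponent] using h.orthogonal 1 fun _ _ => 0

lemma IsLeastSquares.sum_residual_mul_splineB (h : IsLeastSquares ν N n X Y l₀ l) (β : Fin d)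
    (J : Fin N) : ∑ i ∈ Finset.range n, (Y i - l₀ - ∑ α, splineComponent ν N l α (X i α)) *
      splineB ν N β J (X i β) = 0 := by
  have := h.orthogonal 0 fun α J' => if α = β ∧ J' = J then 1 else 0
  rw [← this]
  refine Finset.sum_congr rfl fun i _ => ?_
  congr 1
  rw [zero_add, Finset.sum_eq_single β]
  · simp [splineComponent]
  · intro α _ hα; simp [splineComponent, hα]
  · simp

/-- The residuals of a least squares fit are orthogonal to all the step functions. -/
lemma IsLeastSquares.sum_residual_mul_cell (h : IsLeastSquares ν N n X Y l₀ l)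
    (hX : ∀ i < n, ∀ α, X i α ∈ Set.Ico (0 : ℝ) 1)
    (hpos : ∀ α, ∀ J < N + 1, 0 < theoNorm ν α (cell N J))
    (hpos' : ∀ α J, theoNorm ν α (splineb ν N α J) ≠ 0) (β : Fin d) (J : Fin (N + 1)) :
    ∑ i ∈ Finset.range n, (Y i - l₀ - ∑ α, splineComponent ν N l α (X i α)) *
      cell N J (X i β) = 0 := by
  set e : ℕ → ℝ := fun i => Y i - l₀ - ∑ α, splineComponent ν N l α (X i α) with he
  set θ : ℕ → ℝ := fun J => theoNorm ν β (cell N J) with hθ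
  set y : ℕ → ℝ := fun J => ∑ i ∈ Finset.range n, e i * cell N J (X i β) with hy
  -- Orthogonality to the splines is a two-term recursion, so `y` is a multiple of the positive
  -- vector `θ`. Orthogonality to the constants makes its entries sum to zero, which kills the
  -- multiple.
  have hstep : ∀ J < N, y (J + 1) = θ (J + 1) / θ J * y J := by
    intro J hJ
    have h1 := h.sum_residual_mul_splineB β ⟨J, hJ⟩
    simp only [splineB, mul_div_assoc', ← Finset.sum_div, div_eq_zero_iff, hpos' β ⟨J, hJ⟩,
      or_false] at h1
    simp only [splineb, mul_sub, Finset.sum_sub_distrib] at h1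
    simp only [hy, hθ, Finset.mul_sum, he]
    rw [← sub_eq_zero, ← h1]
    congr 1
    exact Finset.sum_congr rfl fun _ _ => by ring
  have hrat : ∀ J < N + 1, y J = θ J / θ 0 * y 0 := by
    intro J hJ
    induction J with
    | zero => rw [div_self (hpos β 0 (by omega)).ne', one_mul]
    | succ J ih =>
      have := (hpos β J (by omega)).ne'
      rw [hstep J (by omega), ih (by omega)]
      simp only [hθ]
      field_simp
  have hsum : ∑ J : Fin (N + 1), y J = 0 := by
    simp only [hy]
    rw [Finset.sum_comm, ← h.sum_residual]
    refine Finset.sum_congr rfl fun i hi => ?_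
    rw [← Finset.mul_sum, sum_cell_eq_one (hX i (Finset.mem_range.1 hi) β), mul_one]
  have hy0 : y 0 = 0 := by
    have e1 : ∑ J : Fin (N + 1), y J = (∑ J : Fin (N + 1), θ J / θ 0) * y 0 := by
      rw [Finset.sum_mul]
      exact Finset.sum_congr rfl fun J _ => hrat J J.2
    rw [e1] at hsum
    rcases mul_eq_zero.1 hsum with h1 | h1
    · exfalso
      refine (Finset.sum_pos (fun J _ => ?_) ⟨0, Finset.mem_univ _⟩).ne' h1
      exact div_pos (hpos β J J.2) (hpos β 0 (by omega))
    · exact h1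
  have := hrat J J.2
  rw [hy0, mul_zero] at this
  exact this

/-- A spline component is a step function. -/
lemma exists_splineComponent_eq (l : Fin d → Fin N → ℝ) (α : Fin d) :
    ∃ a : Fin (N + 1) → ℝ, ∀ t, splineComponent ν N l α t = ∑ J, a J * cell N J t := by
  refine ⟨fun J => ∑ J' : Fin N, l α J' * ((if J = J'.succ then 1 else 0) -
    theoNorm ν α (cell N ((J' : ℕ) + 1)) / theoNorm ν α (cell N (J' : ℕ)) *
      (if J = J'.castSucc then 1 else 0)) / theoNorm ν α (splineb ν N α J'), fun t => ?_⟩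
  simp only [splineComponent, Finset.sum_mul]
  rw [Finset.sum_comm]
  refine Finset.sum_congr rfl fun J' _ => ?_
  have e1 : ∑ J : Fin (N + 1), (if J = J'.succ then (1 : ℝ) else 0) * cell N J t =
      cell N ((J' : ℕ) + 1) t := by simp
  have e2 : ∑ J : Fin (N + 1), (if J = J'.castSucc then (1 : ℝ) else 0) * cell N J t =
      cell N (J' : ℕ) t := by simp
  set r := theoNorm ν α (cell N ((J' : ℕ) + 1)) / theoNorm ν α (cell N (J' : ℕ)) with hr
  set w := theoNorm ν α (splineb ν N α J') with hw
  rw [splineB, splineb, ← hr, ← hw, ← e1, ← e2, Finset.mul_sum, ← Finset.sum_sub_distrib,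
    Finset.sum_div, Finset.mul_sum]
  exact Finset.sum_congr rfl fun J _ => by ring

/-- The normal equations for the coefficients `a` of the pilot estimators as step functions. -/
lemma IsLeastSquares.exists_pilot_eq (h : IsLeastSquares ν N n X Y l₀ l) (hn : 0 < n)
    (hX : ∀ i < n, ∀ α, X i α ∈ Set.Ico (0 : ℝ) 1)
    (hpos : ∀ α, ∀ J < N + 1, 0 < theoNorm ν α (cell N J))
    (hpos' : ∀ α J, theoNorm ν α (splineb ν N α J) ≠ 0) :
    ∃ a : Fin d × Fin (N + 1) → ℝ,
      (∀ i < n, ∀ γ, pilot ν N n X l γ (X i γ) = ∑ J, a (γ, J) * cell N J (X i γ)) ∧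
      (∀ γ, ∑ i ∈ Finset.range n, ∑ J, a (γ, J) * cell N J (X i γ) = 0) ∧
      ∀ k : Fin d × Fin (N + 1), ∑ i ∈ Finset.range n, (Y i - sampleMean n Y -
        ∑ γ, ∑ J, a (γ, J) * cell N J (X i γ)) * cell N k.2 (X i k.1) = 0 := by
  have hn' : (n : ℝ) ≠ 0 := by exact_mod_cast hn.ne'
  choose b hb using fun γ => exists_splineComponent_eq (ν := ν) l γ
  set E : Fin d → ℝ := fun γ => (n : ℝ)⁻¹ * ∑ i ∈ Finset.range n, splineComponent ν N l γ (X i γ)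
    with hE
  have hp : ∀ i < n, ∀ γ, pilot ν N n X l γ (X i γ) =
      ∑ J, (b γ J - E γ) * cell N J (X i γ) := by
    intro i hi γ
    simp only [sub_mul, Finset.sum_sub_distrib]
    rw [← Finset.mul_sum, sum_cell_eq_one (hX i hi γ), mul_one, ← hb]
    rfl
  -- Since the cells sum to one at the data, empirical centering subtracts the same constant from
  -- every coefficient of a component.
  refine ⟨fun k => b k.1 k.2 - E k.1, hp, fun γ => ?_, fun k => ?_⟩
  · rw [Finset.sum_congr rfl fun i hi => (hp i (Finset.mem_range.1 hi) γ).symm]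
    simp only [pilot, Finset.sum_sub_distrib, Finset.sum_const, Finset.card_range, nsmul_eq_mul]
    field_simp; ring
  · rw [← h.sum_residual_mul_cell hX hpos hpos' k.1 k.2]
    refine Finset.sum_congr rfl fun i hi => ?_
    congr 1
    rw [Finset.sum_congr rfl fun γ _ => (hp i (Finset.mem_range.1 hi) γ).symm]
    have h1 := h.sum_residual
    simp only [Finset.sum_sub_distrib, Finset.sum_const, Finset.card_range, nsmul_eq_mul] at h1
    rw [Finset.sum_comm] at h1
    -- The residuals sum to zero, so the fitted constant and the centering constants add up to the
    -- sample mean; centering thus leaves the residuals unchanged.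
    have h2 : sampleMean n Y = l₀ + ∑ γ, E γ := by
      simp only [sampleMean, hE, ← Finset.mul_sum]
      field_simp
      linarith
    simp only [pilot, Finset.sum_sub_distrib]
    rw [h2]
    simp only [hE]
    ring

end NormalEquations

/-! ### Nondegeneracy of the spline norms. -/

section SplineNorms

variable {d : ℕ} {f : (Fin d → ℝ) → ℝ} {c₁ c₂ : ℝ} {N : ℕ}

/-- It is enough that `g²` dominates one cell, which has mass `1/(N+1)` under the uniform law and at
least `c₁` times that under the density law. -/
lemma theoNorm_pos (hf : ContinuousOn f (cube d)) (hc₁ : 0 < c₁)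
    (hb : ∀ x ∈ cube d, c₁ ≤ f x ∧ f x ≤ c₂) {α : Fin d} {g : ℝ → ℝ} (hg : Measurable g) {B : ℝ}
    (hB : ∀ t, |g t| ≤ B) {J : ℕ} (hJ : J < N + 1) (hJg : ∀ t, cell N J t ≤ g t ^ 2) :
    0 < theoNorm (densityLaw f) α g := by
  refine Real.sqrt_pos.2 ?_
  have hi : Integrable (fun y : Fin d → ℝ => g (y α) ^ 2) (cubeLaw d) :=
    integrable_eval_of_bound (hg.pow_const 2) (B := B ^ 2)
      (fun t => by rw [abs_pow]; exact pow_le_pow_left₀ (abs_nonneg _) (hB t) 2) α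
  refine lt_of_lt_of_le ?_ (le_integral_densityLaw hf hc₁.le hb hi fun x => sq_nonneg _)
  refine mul_pos hc₁ ?_
  have h1 : ∫ y : Fin d → ℝ, cell N J (y α) ∂cubeLaw d ≤ ∫ y, g (y α) ^ 2 ∂cubeLaw d :=
    integral_mono (integrable_eval_of_bound (measurable_cell N J) (abs_cell_le_one N J) α) hi
      fun y => hJg _
  rw [integral_eval_cubeLaw α (measurable_cell N J), integral_cell hJ] at h1
  exact lt_of_lt_of_le (by positivity) h1

lemma theoNorm_cell_pos (hf : ContinuousOn f (cube d)) (hc₁ : 0 < c₁)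
    (hb : ∀ x ∈ cube d, c₁ ≤ f x ∧ f x ≤ c₂) (α : Fin d) {J : ℕ} (hJ : J < N + 1) :
    0 < theoNorm (densityLaw f) α (cell N J) :=
  theoNorm_pos hf hc₁ hb (measurable_cell N J) (abs_cell_le_one N J) hJ
    fun t => (cell_sq N J t).ge

lemma measurable_splineb (ν : Measure (Fin d → ℝ)) (α : Fin d) (J : Fin N) :
    Measurable (splineb ν N α J) :=
  (measurable_cell _ _).sub ((measurable_cell _ _).const_mul _)

lemma theoNorm_splineb_pos (hf : ContinuousOn f (cube d)) (hc₁ : 0 < c₁)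
    (hb : ∀ x ∈ cube d, c₁ ≤ f x ∧ f x ≤ c₂) (α : Fin d) (J : Fin N) :
    0 < theoNorm (densityLaw f) α (splineb (densityLaw f) N α J) := by
  set r : ℝ := theoNorm (densityLaw f) α (cell N ((J : ℕ) + 1)) /
    theoNorm (densityLaw f) α (cell N (J : ℕ)) with hr
  refine theoNorm_pos hf hc₁ hb (measurable_splineb _ α J) (B := 1 + |r|) (fun t => ?_)
    (N := N) (J := (J : ℕ) + 1) (by omega) fun t => ?_
  · refine (abs_sub _ _).trans (add_le_add (abs_cell_le_one _ _ _) ?_)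
    rw [abs_mul]
    exact mul_le_of_le_one_right (abs_nonneg _) (abs_cell_le_one _ _ _)
  · have h1 := cell_sq N ((J : ℕ) + 1) t
    have h2 : cell N ((J : ℕ) + 1) t * cell N (J : ℕ) t = 0 := cell_mul_cell_of_ne (by omega)
    have : splineb (densityLaw f) N α J t ^ 2 =
        cell N ((J : ℕ) + 1) t + (r * cell N (J : ℕ) t) ^ 2 := by
      rw [splineb, ← hr, sub_sq, h1]
      linear_combination (-2 * r) * h2
    rw [this]
    nlinarith [sq_nonneg (r * cell N (J : ℕ) t)]

end SplineNorms

/-! ### Algebra of sample averages. -/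

section SampleAverage

/-- The average of the first `n` terms. -/
noncomputable def avg (n : ℕ) (g : ℕ → ℝ) : ℝ := (n : ℝ)⁻¹ * ∑ i ∈ Finset.range n, g i

variable {n : ℕ} {g h : ℕ → ℝ}

lemma avg_add : avg n (fun i => g i + h i) = avg n g + avg n h := by
  simp only [avg, Finset.sum_add_distrib, mul_add]

lemma avg_sub : avg n (fun i => g i - h i) = avg n g - avg n h := by
  simp only [avg, Finset.sum_sub_distrib, mul_sub]

lemma avg_const_mul (c : ℝ) : avg n (fun i => c * g i) = c * avg n g := by
  simp only [avg, ← Finset.mul_sum]; ring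

lemma avg_sum {κ : Type*} (s : Finset κ) (g : κ → ℕ → ℝ) :
    avg n (fun i => ∑ k ∈ s, g k i) = ∑ k ∈ s, avg n (g k) := by
  simp only [avg]; rw [Finset.sum_comm, Finset.mul_sum]

lemma avg_const (hn : 0 < n) (c : ℝ) : avg n (fun _ => c) = c := by
  have : (n : ℝ) ≠ 0 := by exact_mod_cast hn.ne'
  simp only [avg, Finset.sum_const, Finset.card_range, nsmul_eq_mul]; field_simp

lemma avg_congr (hgh : ∀ i < n, g i = h i) : avg n g = avg n h := by
  rw [avg, avg, Finset.sum_congr rfl fun i hi => hgh i (Finset.mem_range.1 hi)]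

lemma avg_mono (hgh : ∀ i < n, g i ≤ h i) : avg n g ≤ avg n h :=
  mul_le_mul_of_nonneg_left (Finset.sum_le_sum fun i hi => hgh i (Finset.mem_range.1 hi))
    (by positivity)

lemma avg_nonneg (hg : ∀ i < n, 0 ≤ g i) : 0 ≤ avg n g :=
  mul_nonneg (by positivity) (Finset.sum_nonneg fun i hi => hg i (Finset.mem_range.1 hi))

lemma abs_avg_le : |avg n g| ≤ avg n fun i => |g i| := by
  rw [avg, abs_mul, abs_of_nonneg (by positivity)]
  exact mul_le_mul_of_nonneg_left (Finset.abs_sum_le_sum_abs _ _) (by positivity)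

lemma sq_avg_mul_le : avg n (fun i => g i * h i) ^ 2 ≤
    avg n (fun i => g i ^ 2) * avg n fun i => h i ^ 2 := by
  have h1 := Finset.sum_mul_sq_le_sq_mul_sq (Finset.range n) g h
  simp only [avg]
  calc _ = ((n : ℝ)⁻¹) ^ 2 * (∑ i ∈ Finset.range n, g i * h i) ^ 2 := by ring
    _ ≤ ((n : ℝ)⁻¹) ^ 2 * ((∑ i ∈ Finset.range n, g i ^ 2) * ∑ i ∈ Finset.range n, h i ^ 2) := by
        gcongr
    _ = _ := by ring

end SampleAverage

/-! ### Deterministic least squares estimates. -/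

section LeastSquaresCore

variable {ι Γ : Type*} [Fintype ι] [Fintype Γ]

lemma abs_sum_mul_le_sqrt (a b : ι → ℝ) :
    |∑ k, a k * b k| ≤ Real.sqrt (∑ k, a k ^ 2) * Real.sqrt (∑ k, b k ^ 2) := by
  rw [← Real.sqrt_mul (Finset.sum_nonneg fun _ _ => sq_nonneg _)]
  exact Real.abs_le_sqrt (Finset.sum_mul_sq_le_sq_mul_sq _ _ _)

/-- The Frobenius norm is used in place of the operator norm because its square is a sum of squared
entries, whose expectation can be taken term by term. -/
lemma abs_sum_sum_mul_le_sqrt (a b : ι → ℝ) (D : ι → ι → ℝ) :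
    |∑ k, ∑ l, a k * b l * D k l| ≤ Real.sqrt (∑ k, a k ^ 2) * Real.sqrt (∑ l, b l ^ 2) *
      Real.sqrt (∑ k, ∑ l, D k l ^ 2) := by
  have h1 := abs_sum_mul_le_sqrt (fun p : ι × ι => a p.1 * b p.2) fun p => D p.1 p.2
  simp only [Fintype.sum_prod_type, mul_pow] at h1
  rwa [← Finset.sum_mul_sum, Real.sqrt_mul (Finset.sum_nonneg fun _ _ => sq_nonneg _)] at h1

variable {n : ℕ} {ψ : ι → ℕ → ℝ} {G : ι → ι → ℝ} {μ μ' : Γ → ι → ℝ} {δ : ι → ℝ} {H C : ℝ}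

lemma avg_sq_sum (a b : ι → ℝ) : avg n (fun i => (∑ k, a k * ψ k i) * ∑ k, b k * ψ k i) =
    ∑ k, ∑ l, a k * b l * avg n (fun i => ψ k i * ψ l i) := by
  simp only [Finset.sum_mul_sum]
  rw [avg_sum]
  refine Finset.sum_congr rfl fun k _ => ?_
  rw [avg_sum]
  refine Finset.sum_congr rfl fun l _ => ?_
  rw [← avg_const_mul]
  congr 1; ext i; ring

/-- The difference between the sample and the population versions of the quadratic form. -/
lemma abs_avg_sq_sum_sub_le (a b : ι → ℝ) :
    |avg n (fun i => (∑ k, a k * ψ k i) * ∑ k, b k * ψ k i) - ∑ k, ∑ l, a k * b l * G k l| ≤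
      Real.sqrt (∑ k, a k ^ 2) * Real.sqrt (∑ l, b l ^ 2) *
        Real.sqrt (∑ k, ∑ l, (avg n (fun i => ψ k i * ψ l i) - G k l) ^ 2) := by
  rw [avg_sq_sum, ← Finset.sum_sub_distrib]
  refine le_trans (le_of_eq ?_) (abs_sum_sum_mul_le_sqrt a b fun k l =>
    avg n (fun i => ψ k i * ψ l i) - G k l)
  congr 1
  refine Finset.sum_congr rfl fun k _ => ?_
  rw [← Finset.sum_sub_distrib]
  exact Finset.sum_congr rfl fun l _ => by ring

/-- The size of the coefficients of a least squares fit to responses `ρ + e` with `|ρ| ≤ b`. Here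
`μ'` is the sample version of the mean functionals `μ`. -/
lemma sum_sq_le_of_normal_equations (hn : 0 < n) (hH : 0 < H) (hC : 0 ≤ C)
    (hstab : H * ∑ k, δ k ^ 2 ≤
      C * (∑ k, ∑ l, δ k * δ l * G k l + ∑ γ, (∑ k, δ k * μ γ k) ^ 2))
    {ρ e : ℕ → ℝ} {b : ℝ} (hb : ∀ i < n, |ρ i| ≤ b)
    (hnormal : ∀ k, avg n (fun i => (ρ i + e i - ∑ l, δ l * ψ l i) * ψ k i) = 0)
    (hsmall : C * (Real.sqrt (∑ k, ∑ l, (avg n (fun i => ψ k i * ψ l i) - G k l) ^ 2) +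
      2 * ∑ γ, ∑ k, (μ' γ k - μ γ k) ^ 2) ≤ H / 2) :
    ∑ k, δ k ^ 2 ≤ 4 * C * (b ^ 2 + 2 * ∑ γ, (∑ k, δ k * μ' γ k) ^ 2) / H +
      16 * C ^ 2 * (∑ k, avg n (fun i => e i * ψ k i) ^ 2) / H ^ 2 := by
  set S : ℝ := ∑ k, δ k ^ 2 with hS
  have hS0 : 0 ≤ S := Finset.sum_nonneg fun _ _ => sq_nonneg _
  set D : ℝ := Real.sqrt (∑ k, ∑ l, (avg n (fun i => ψ k i * ψ l i) - G k l) ^ 2) with hD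
  set D₂ : ℝ := ∑ γ, ∑ k, (μ' γ k - μ γ k) ^ 2 with hD₂
  set κ : ℝ := ∑ γ, (∑ k, δ k * μ' γ k) ^ 2 with hκ
  set A : ℝ := ∑ k, avg n (fun i => e i * ψ k i) ^ 2 with hA
  have hA0 : 0 ≤ A := Finset.sum_nonneg fun _ _ => sq_nonneg _
  set Q : ℝ := avg n (fun i => (∑ k, δ k * ψ k i) ^ 2) with hQ
  have h1 : ∑ k, ∑ l, δ k * δ l * G k l ≤ Q + S * D := by
    have := (abs_le.1 (abs_avg_sq_sum_sub_le (n := n) (ψ := ψ) (G := G) δ δ)).1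
    rw [← Real.sqrt_mul hS0, Real.sqrt_mul_self hS0] at this
    simp only [← sq] at this
    linarith
  -- The sample means of the components are known from the empirical centering; the population means
  -- in the stability bound are traded for them.
  have h2 : ∑ γ, (∑ k, δ k * μ γ k) ^ 2 ≤ 2 * κ + 2 * (S * D₂) := by
    rw [hκ, hD₂, Finset.mul_sum, Finset.mul_sum, Finset.mul_sum, ← Finset.sum_add_distrib]
    refine Finset.sum_le_sum fun γ _ => ?_
    have h3 := Finset.sum_mul_sq_le_sq_mul_sq Finset.univ δ fun k => μ' γ k - μ γ k
    have h4 : ∑ k, δ k * (μ' γ k - μ γ k) = ∑ k, δ k * μ' γ k - ∑ k, δ k * μ γ k := by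
      simp only [mul_sub, Finset.sum_sub_distrib]
    rw [h4] at h3
    nlinarith [sq_nonneg (2 * (∑ k, δ k * μ' γ k) - ∑ k, δ k * μ γ k)]
  -- The normal equations are tested with `δ` itself.
  have h3 : Q ≤ b ^ 2 + 2 * (Real.sqrt S * Real.sqrt A) := by
    have e1 : Q = avg n (fun i => ρ i * ∑ k, δ k * ψ k i) +
        ∑ k, δ k * avg n (fun i => e i * ψ k i) := by
      have e2 : ∑ k, δ k * avg n (fun i => (ρ i + e i - ∑ l, δ l * ψ l i) * ψ k i) = 0 :=
        Finset.sum_eq_zero fun k _ => by rw [hnormal k, mul_zero]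
      simp only [← avg_const_mul] at e2 ⊢
      rw [← avg_sum] at e2 ⊢
      rw [← avg_add, ← sub_eq_zero, hQ, ← avg_sub, ← neg_eq_zero, ← e2]
      rw [← neg_one_mul, ← avg_const_mul]
      congr 1; ext i
      have e3 : ∑ k, δ k * ((ρ i + e i - ∑ l, δ l * ψ l i) * ψ k i) =
          (ρ i + e i - ∑ l, δ l * ψ l i) * ∑ k, δ k * ψ k i := by
        rw [Finset.mul_sum]; exact Finset.sum_congr rfl fun _ _ => by ring
      have e4 : ∑ k, δ k * (e i * ψ k i) = e i * ∑ k, δ k * ψ k i := by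
        rw [Finset.mul_sum]; exact Finset.sum_congr rfl fun _ _ => by ring
      rw [e3, e4]; ring
    have e2 : avg n (fun i => ρ i * ∑ k, δ k * ψ k i) ≤ b ^ 2 / 2 + Q / 2 := by
      have : avg n (fun i => ρ i * ∑ k, δ k * ψ k i) ≤
          avg n (fun i => b ^ 2 / 2 + 1 / 2 * (∑ k, δ k * ψ k i) ^ 2) := by
        refine avg_mono fun i hi => ?_
        have hbi : ρ i ^ 2 ≤ b ^ 2 := sq_le_sq' (abs_le.1 (hb i hi)).1 (abs_le.1 (hb i hi)).2
        nlinarith [sq_nonneg (ρ i - ∑ k, δ k * ψ k i)]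
      rw [avg_add, avg_const hn, avg_const_mul] at this
      linarith
    have e3 := (abs_le.1 (abs_sum_mul_le_sqrt δ fun k => avg n (fun i => e i * ψ k i))).2
    linarith
  -- The sampling errors multiply `S` by at most `H / 2`, so they are absorbed into the left side.
  have h4 : H * S ≤ 2 * C * (b ^ 2 + 2 * (Real.sqrt S * Real.sqrt A) + 2 * κ) := by
    have e1 : H * S ≤ C * ((b ^ 2 + 2 * (Real.sqrt S * Real.sqrt A) + S * D) +
        (2 * κ + 2 * (S * D₂))) :=
      hstab.trans (mul_le_mul_of_nonneg_left (by linarith) hC)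
    have e2 : S * (C * (D + 2 * D₂)) ≤ S * (H / 2) := mul_le_mul_of_nonneg_left hsmall hS0
    nlinarith
  have hsS := Real.sq_sqrt hS0
  have hsA := Real.sq_sqrt hA0
  have h5 : 4 * C * (Real.sqrt S * Real.sqrt A) ≤ H * S / 2 + 8 * C ^ 2 * A / H := by
    have := sq_nonneg (H * Real.sqrt S - 4 * C * Real.sqrt A)
    have e : H * S / 2 + 8 * C ^ 2 * A / H - 4 * C * (Real.sqrt S * Real.sqrt A) =
        (H * Real.sqrt S - 4 * C * Real.sqrt A) ^ 2 / (2 * H) := by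
      rw [← hsS, ← hsA]
      rw [Real.sqrt_sq (Real.sqrt_nonneg _), Real.sqrt_sq (Real.sqrt_nonneg _)]
      field_simp; ring
    have : 0 ≤ (H * Real.sqrt S - 4 * C * Real.sqrt A) ^ 2 / (2 * H) := by positivity
    linarith
  have h6 : H * S ≤ 4 * C * (b ^ 2 + 2 * κ) + 16 * C ^ 2 * A / H := by
    have e : 16 * C ^ 2 * A / H = 2 * (8 * C ^ 2 * A / H) := by ring
    rw [e]; nlinarith
  calc S = H * S / H := by field_simp
    _ ≤ (4 * C * (b ^ 2 + 2 * κ) + 16 * C ^ 2 * A / H) / H := by gcongr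
    _ = _ := by field_simp

/-- A coercive form represents every linear functional. -/
lemma exists_representer (hH : 0 < H) (hC : 0 ≤ C)
    (hstab : ∀ δ : ι → ℝ, H * ∑ k, δ k ^ 2 ≤
      C * (∑ k, ∑ l, δ k * δ l * G k l + ∑ γ, (∑ k, δ k * μ γ k) ^ 2))
    (w : ι → ℝ) {B : ℝ} (hB : 0 ≤ B)
    (hw : ∀ δ : ι → ℝ, |∑ k, w k * δ k| ≤ B * Real.sqrt (H * ∑ k, δ k ^ 2)) :
    ∃ u : ι → ℝ, (∀ δ : ι → ℝ, ∑ k, ∑ l, u k * δ l * G k l +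
        ∑ γ, (∑ k, u k * μ γ k) * (∑ k, δ k * μ γ k) = ∑ k, w k * δ k) ∧
      H * ∑ k, u k ^ 2 ≤ (C * B) ^ 2 ∧
      ∑ k, ∑ l, u k * u l * G k l + ∑ γ, (∑ k, u k * μ γ k) ^ 2 ≤ C * B ^ 2 := by
  classical
  -- The matrix of the augmented form. Coercivity makes it injective, hence surjective in finite
  -- dimension.
  let T : (ι → ℝ) →ₗ[ℝ] (ι → ℝ) :=
    { toFun := fun u l => ∑ k, u k * G k l + ∑ γ, (∑ k, u k * μ γ k) * μ γ l
      map_add' := fun u v => by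
        ext l
        simp only [Pi.add_apply, add_mul, Finset.sum_add_distrib]
        ring
      map_smul' := fun c u => by
        ext l
        simp only [Pi.smul_apply, smul_eq_mul, RingHom.id_apply, mul_add, Finset.mul_sum,
          Finset.sum_mul]
        congr 1
        · exact Finset.sum_congr rfl fun _ _ => by ring
        · exact Finset.sum_congr rfl fun _ _ => Finset.sum_congr rfl fun _ _ => by ring }
  have hT : ∀ u δ : ι → ℝ, ∑ l, T u l * δ l = ∑ k, ∑ l, u k * δ l * G k l +
      ∑ γ, (∑ k, u k * μ γ k) * (∑ k, δ k * μ γ k) := by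
    intro u δ
    simp only [T, LinearMap.coe_mk, AddHom.coe_mk, add_mul, Finset.sum_add_distrib]
    congr 1
    · simp only [Finset.sum_mul]
      rw [Finset.sum_comm]
      exact Finset.sum_congr rfl fun _ _ => Finset.sum_congr rfl fun _ _ => by ring
    · rw [Finset.sum_congr rfl fun l _ => Finset.sum_mul _ _ (δ l), Finset.sum_comm]
      refine Finset.sum_congr rfl fun γ _ => ?_
      rw [Finset.mul_sum]
      exact Finset.sum_congr rfl fun _ _ => by ring
  have hinj : Function.Injective T := by
    rw [injective_iff_map_eq_zero]
    intro u hu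
    have h1 := hT u u
    rw [hu] at h1
    simp only [Pi.zero_apply, zero_mul, Finset.sum_const_zero, ← sq] at h1
    have h2 := hstab u
    rw [← h1, mul_zero] at h2
    have h3 : ∑ k, u k ^ 2 ≤ 0 := by
      by_contra h
      push Not at h
      linarith [mul_pos hH h]
    ext k
    have h4 := (Finset.sum_eq_zero_iff_of_nonneg fun k _ => sq_nonneg (u k)).1
      (le_antisymm h3 (Finset.sum_nonneg fun _ _ => sq_nonneg _)) k (Finset.mem_univ k)
    simpa using h4
  obtain ⟨u, hu⟩ := LinearMap.injective_iff_surjective.1 hinj w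
  have hQ : ∀ δ : ι → ℝ, ∑ k, ∑ l, u k * δ l * G k l +
        ∑ γ, (∑ k, u k * μ γ k) * (∑ k, δ k * μ γ k) = ∑ k, w k * δ k := fun δ => by
    rw [← hT, hu]
  have hS0 : 0 ≤ H * ∑ k, u k ^ 2 :=
    mul_nonneg hH.le (Finset.sum_nonneg fun _ _ => sq_nonneg _)
  have h1 := hQ u
  simp only [← sq] at h1
  have h2 := hstab u
  rw [h1] at h2
  have h3 := (abs_le.1 (hw u)).2
  set s := Real.sqrt (H * ∑ k, u k ^ 2) with hs
  have hs0 : 0 ≤ s := Real.sqrt_nonneg _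
  have hss : s ^ 2 = H * ∑ k, u k ^ 2 := Real.sq_sqrt hS0
  -- Coercivity and the bound on the functional give `s² ≤ C * (B * s)`.
  have h4 : s ≤ C * B := by
    by_contra h
    push Not at h
    have : C * (∑ k, w k * u k) ≤ C * (B * s) := mul_le_mul_of_nonneg_left h3 hC
    nlinarith [mul_nonneg hC hB]
  refine ⟨u, hQ, ?_, ?_⟩
  · rw [← hss]; exact pow_le_pow_left₀ hs0 h4 2
  · rw [h1]
    calc _ ≤ B * s := h3
      _ ≤ B * (C * B) := mul_le_mul_of_nonneg_left h4 hB
      _ = _ := by ring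

/-- A linear functional of the coefficients of a least squares fit, through its representer. -/
lemma abs_functional_le (hn : 0 < n) {w u : ι → ℝ} {B : ℝ} (hB : 0 ≤ B)
    (hu : ∑ k, ∑ l, u k * δ l * G k l +
        ∑ γ, (∑ k, u k * μ γ k) * (∑ k, δ k * μ γ k) = ∑ k, w k * δ k)
    (huB : ∑ k, ∑ l, u k * u l * G k l + ∑ γ, (∑ k, u k * μ γ k) ^ 2 ≤ B)
    (hG : 0 ≤ ∑ k, ∑ l, u k * u l * G k l)
    {ρ e : ℕ → ℝ} {b : ℝ} (hb0 : 0 ≤ b) (hb : ∀ i < n, |ρ i| ≤ b)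
    (hnormal : ∀ k, avg n (fun i => (ρ i + e i - ∑ l, δ l * ψ l i) * ψ k i) = 0)
    (hsmall : (∑ k, u k ^ 2) *
      Real.sqrt (∑ k, ∑ l, (avg n (fun i => ψ k i * ψ l i) - G k l) ^ 2) ≤ B) :
    |∑ k, w k * δ k| ≤ Real.sqrt (∑ k, δ k ^ 2) *
        Real.sqrt (∑ l, (avg n (fun i => (∑ k, u k * ψ k i) * ψ l i) - ∑ k, u k * G k l) ^ 2) +
      b * Real.sqrt (2 * B) + |avg n (fun i => (∑ k, u k * ψ k i) * e i)| +
      Real.sqrt B * (Real.sqrt (∑ γ, (∑ k, δ k * μ' γ k) ^ 2) +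
        Real.sqrt (∑ k, δ k ^ 2) * Real.sqrt (∑ γ, ∑ k, (μ' γ k - μ γ k) ^ 2)) := by
  set gu : ℕ → ℝ := fun i => ∑ k, u k * ψ k i with hgu
  -- the projection part
  have e1 : ∑ k, ∑ l, u k * δ l * G k l = avg n (fun i => gu i * ρ i) +
      avg n (fun i => gu i * e i) -
      ∑ l, δ l * (avg n (fun i => gu i * ψ l i) - ∑ k, u k * G k l) := by
    -- Testing the normal equations with the representer replaces the unknown inner product with `δ`
    -- by averages against `ρ` and `e`. The random `δ` survives only multiplied by sampling errors.
    have e2 : ∑ k, u k * avg n (fun i => (ρ i + e i - ∑ l, δ l * ψ l i) * ψ k i) = 0 :=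
      Finset.sum_eq_zero fun k _ => by rw [hnormal k, mul_zero]
    have e3 : ∑ k, u k * avg n (fun i => (ρ i + e i - ∑ l, δ l * ψ l i) * ψ k i) =
        avg n (fun i => gu i * ρ i) + avg n (fun i => gu i * e i) -
          ∑ l, δ l * avg n (fun i => gu i * ψ l i) := by
      simp only [← avg_const_mul]
      rw [← avg_sum, ← avg_sum, ← avg_add, ← avg_sub]
      congr 1; ext i
      have e4 : ∑ k, u k * ((ρ i + e i - ∑ l, δ l * ψ l i) * ψ k i) =
          (ρ i + e i - ∑ l, δ l * ψ l i) * gu i := by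
        rw [hgu, Finset.mul_sum]; exact Finset.sum_congr rfl fun _ _ => by ring
      have e5 : ∑ k, δ k * (gu i * ψ k i) = gu i * ∑ k, δ k * ψ k i := by
        rw [Finset.mul_sum]; exact Finset.sum_congr rfl fun _ _ => by ring
      rw [e4, e5]; ring
    have e6 : ∑ k, ∑ l, u k * δ l * G k l = ∑ l, δ l * ∑ k, u k * G k l := by
      rw [Finset.sum_comm]
      refine Finset.sum_congr rfl fun l _ => ?_
      rw [Finset.mul_sum]; exact Finset.sum_congr rfl fun _ _ => by ring
    simp only [mul_sub, Finset.sum_sub_distrib]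
    rw [e6]
    linarith
  have b1 := abs_sum_mul_le_sqrt δ fun l => avg n (fun i => gu i * ψ l i) - ∑ k, u k * G k l
  have hμ0 : 0 ≤ ∑ γ, (∑ k, u k * μ γ k) ^ 2 := Finset.sum_nonneg fun _ _ => sq_nonneg _
  have hS0 : 0 ≤ ∑ k, u k ^ 2 := Finset.sum_nonneg fun _ _ => sq_nonneg _
  have b2 : |avg n (fun i => gu i * ρ i)| ≤ b * Real.sqrt (2 * B) := by
    have h1 := (abs_le.1 (abs_avg_sq_sum_sub_le (n := n) (ψ := ψ) (G := G) u u)).2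
    rw [← Real.sqrt_mul hS0, Real.sqrt_mul_self hS0] at h1
    simp only [← sq] at h1
    have h2 : avg n (fun i => gu i ^ 2) ≤ 2 * B := by
      simp only [hgu]; linarith
    have h3 : avg n (fun i => ρ i ^ 2) ≤ b ^ 2 := by
      rw [← avg_const hn (b ^ 2)]
      exact avg_mono fun i hi => sq_le_sq' (abs_le.1 (hb i hi)).1 (abs_le.1 (hb i hi)).2
    refine abs_le_of_sq_le_sq ?_ (by positivity)
    rw [mul_pow, Real.sq_sqrt (by positivity)]
    calc _ ≤ _ := sq_avg_mul_le
      _ ≤ (2 * B) * b ^ 2 := mul_le_mul h2 h3 (avg_nonneg fun _ _ => sq_nonneg _) (by positivity)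
      _ = _ := by ring
  have b3 : |∑ γ, (∑ k, u k * μ γ k) * (∑ k, δ k * μ γ k)| ≤
      Real.sqrt B * (Real.sqrt (∑ γ, (∑ k, δ k * μ' γ k) ^ 2) +
        Real.sqrt (∑ k, δ k ^ 2) * Real.sqrt (∑ γ, ∑ k, (μ' γ k - μ γ k) ^ 2)) := by
    have hle : Real.sqrt (∑ γ, (∑ k, u k * μ γ k) ^ 2) ≤ Real.sqrt B :=
      Real.sqrt_le_sqrt (by linarith)
    have h1 : ∑ γ, (∑ k, u k * μ γ k) * (∑ k, δ k * μ γ k) =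
        ∑ γ, (∑ k, u k * μ γ k) * (∑ k, δ k * μ' γ k) -
        ∑ γ, (∑ k, u k * μ γ k) * (∑ k, δ k * (μ' γ k - μ γ k)) := by
      rw [← Finset.sum_sub_distrib]
      refine Finset.sum_congr rfl fun γ _ => ?_
      simp only [mul_sub, Finset.sum_sub_distrib]; ring
    have h2 := abs_sum_mul_le_sqrt (fun γ => ∑ k, u k * μ γ k) fun γ => ∑ k, δ k * μ' γ k
    have h3 := abs_sum_mul_le_sqrt (fun γ => ∑ k, u k * μ γ k)
      fun γ => ∑ k, δ k * (μ' γ k - μ γ k)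
    have h4 : Real.sqrt (∑ γ, (∑ k, δ k * (μ' γ k - μ γ k)) ^ 2) ≤
        Real.sqrt (∑ k, δ k ^ 2) * Real.sqrt (∑ γ, ∑ k, (μ' γ k - μ γ k) ^ 2) := by
      rw [← Real.sqrt_mul (Finset.sum_nonneg fun _ _ => sq_nonneg _)]
      refine Real.sqrt_le_sqrt ?_
      rw [Finset.mul_sum]
      exact Finset.sum_le_sum fun γ _ => Finset.sum_mul_sq_le_sq_mul_sq _ _ _
    rw [h1, mul_add]
    refine (abs_sub _ _).trans (add_le_add (h2.trans ?_) (h3.trans ?_))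
    · exact mul_le_mul_of_nonneg_right hle (Real.sqrt_nonneg _)
    · exact mul_le_mul hle h4 (Real.sqrt_nonneg _) (Real.sqrt_nonneg _)
  rw [← hu, e1]
  have t1 := abs_add_le (avg n (fun i => gu i * ρ i) + avg n (fun i => gu i * e i) -
      ∑ l, δ l * (avg n (fun i => gu i * ψ l i) - ∑ k, u k * G k l))
      (∑ γ, (∑ k, u k * μ γ k) * (∑ k, δ k * μ γ k))
  have t2 := abs_sub (avg n (fun i => gu i * ρ i) + avg n (fun i => gu i * e i))
      (∑ l, δ l * (avg n (fun i => gu i * ψ l i) - ∑ k, u k * G k l))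
  have t3 := abs_add_le (avg n (fun i => gu i * ρ i)) (avg n (fun i => gu i * e i))
  linarith

end LeastSquaresCore

/-! ### Kernel averages and their expansions. -/

section KernelIntegrals

open Topology Asymptotics

variable {K : ℝ → ℝ} {C x h : ℝ}

lemma integral_sub_sub {f₁ f₂ f₃ : ℝ → ℝ} (h₁ : Integrable f₁) (h₂ : Integrable f₂)
    (h₃ : Integrable f₃) :
    ∫ u, (f₁ u - f₂ u - f₃ u) = (∫ u, f₁ u) - (∫ u, f₂ u) - ∫ u, f₃ u := by
  have e := integral_sub (h₁.sub h₂) h₃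
  simp only [Pi.sub_apply] at e
  rw [e, integral_sub h₁ h₂]

lemma KernelAssumption.continuousOn (hK : KernelAssumption K) :
    ContinuousOn K (Set.Icc (-1) 1) := by
  obtain ⟨C, hC⟩ := hK.lipschitz
  exact hC.continuousOn

lemma KernelAssumption.exists_bound (hK : KernelAssumption K) : ∃ C, 0 < C ∧ ∀ u, |K u| ≤ C := by
  obtain ⟨C, hC⟩ := isCompact_Icc.exists_bound_of_continuousOn hK.continuousOn
  refine ⟨|C| + 1, by positivity, fun u => ?_⟩
  by_cases hu : u ∈ Set.Icc (-1 : ℝ) 1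
  · have := hC u hu
    rw [Real.norm_eq_abs] at this
    linarith [le_abs_self C]
  · rw [hK.support u hu, abs_zero]; positivity

lemma measurable_indicator_of_continuousOn {E : Type*} [TopologicalSpace E] [MeasurableSpace E]
    [BorelSpace E] {g : E → ℝ} {S : Set E} (hg : ContinuousOn g S) (hS : MeasurableSet S) :
    Measurable (S.indicator g) := by
  classical
  rw [← Set.piecewise_eq_indicator]
  exact hg.measurable_piecewise continuousOn_const hS

lemma KernelAssumption.measurable (hK : KernelAssumption K) : Measurable K := by
  have : K = (Set.Icc (-1 : ℝ) 1).indicator K := by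
    ext u
    by_cases hu : u ∈ Set.Icc (-1 : ℝ) 1
    · rw [Set.indicator_of_mem hu]
    · rw [Set.indicator_of_notMem hu, hK.support u hu]
  rw [this]
  exact measurable_indicator_of_continuousOn hK.continuousOn measurableSet_Icc

lemma measurable_scaledKernel (hK : Measurable K) (h x : ℝ) :
    Measurable fun t => scaledKernel K h (t - x) :=
  (hK.comp ((measurable_id.sub_const x).div_const h)).div_const h

lemma abs_scaledKernel_le (hC : ∀ u, |K u| ≤ C) (hh : 0 < h) (u : ℝ) :
    |scaledKernel K h u| ≤ C / h := by
  rw [scaledKernel, abs_div, abs_of_pos hh]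
  gcongr
  exact hC _

/-- The change of variables `t = x + h u`. -/
lemma integral_scaledKernel_mul (hs : ∀ u, u ∉ Set.Icc (-1 : ℝ) 1 → K u = 0) (hh : 0 < h)
    (h₁ : h ≤ x) (h₂ : x + h ≤ 1) (g : ℝ → ℝ) :
    ∫ t, scaledKernel K h (t - x) * g t ∂unitLaw = ∫ u, K u * g (x + h * u) := by
  have e1 : ∫ t, scaledKernel K h (t - x) * g t ∂unitLaw =
      ∫ t, scaledKernel K h (t - x) * g t := by
    rw [unitLaw, setIntegral_eq_integral_of_forall_compl_eq_zero]
    intro t ht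
    rw [scaledKernel, hs, zero_div, zero_mul]
    intro hu
    apply ht
    have h3 := hu.1
    have h4 := hu.2
    rw [le_div_iff₀ hh] at h3
    rw [div_le_iff₀ hh] at h4
    constructor <;> linarith
  have e2 := Measure.integral_comp_mul_left
    (fun y => scaledKernel K h y * g (x + y)) h
  have e3 : ∫ t, scaledKernel K h (t - x) * g t = ∫ y, scaledKernel K h y * g (x + y) := by
    rw [← integral_add_left_eq_self (μ := volume)
      (fun t => scaledKernel K h (t - x) * g t) x]
    congr 1; ext y; simp
  rw [e1, e3]
  rw [abs_of_pos (inv_pos.2 hh), smul_eq_mul, eq_inv_mul_iff_mul_eq₀ hh.ne', ← integral_const_mul]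
    at e2
  rw [← e2]
  congr 1; ext u
  rw [scaledKernel, mul_div_cancel_left₀ _ hh.ne']
  field_simp

lemma integrable_kernel_mul (hm : Measurable K) (hC : ∀ u, |K u| ≤ C)
    (hs : ∀ u, u ∉ Set.Icc (-1 : ℝ) 1 → K u = 0) {G : ℝ → ℝ}
    (hG : ContinuousOn G (Set.Icc (-1) 1)) : Integrable fun u => K u * G u := by
  have e : (fun u => K u * G u) = (Set.Icc (-1 : ℝ) 1).indicator fun u => K u * G u := by
    ext u
    by_cases hu : u ∈ Set.Icc (-1 : ℝ) 1
    · rw [Set.indicator_of_mem hu]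
    · rw [Set.indicator_of_notMem hu, hs u hu, zero_mul]
  rw [e, integrable_indicator_iff measurableSet_Icc]
  exact (hG.integrableOn_compact isCompact_Icc).bdd_mul hm.aestronglyMeasurable
    (ae_of_all _ fun u => by simpa using hC u)

lemma abs_integral_kernel_mul_le (hC0 : 0 ≤ C) (hC : ∀ u, |K u| ≤ C)
    (hs : ∀ u, u ∉ Set.Icc (-1 : ℝ) 1 → K u = 0) {G : ℝ → ℝ} {r : ℝ}
    (hG : ∀ u ∈ Set.Icc (-1 : ℝ) 1, |G u| ≤ r) : |∫ u, K u * G u| ≤ 2 * C * r := by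
  have h1 : Integrable ((Set.Icc (-1 : ℝ) 1).indicator fun _ => C * r) :=
    (integrable_indicator_iff measurableSet_Icc).2 (integrableOn_const (by simp))
  have h2 := norm_integral_le_of_norm_le (f := fun u => K u * G u) h1 (ae_of_all _ fun u => ?_)
  · rw [integral_indicator measurableSet_Icc, setIntegral_const, Real.volume_real_Icc] at h2
    norm_num at h2
    linarith
  · by_cases hu : u ∈ Set.Icc (-1 : ℝ) 1
    · rw [Set.indicator_of_mem hu, norm_mul]
      exact mul_le_mul (hC u) (hG u hu) (norm_nonneg _) hC0
    · rw [Set.indicator_of_notMem hu, hs u hu, zero_mul, norm_zero]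

/-- Local smallness of a function is inherited by its kernel averages. -/
lemma isLittleO_integral_kernel (hC0 : 0 ≤ C) (hC : ∀ u, |K u| ≤ C)
    (hs : ∀ u, u ∉ Set.Icc (-1 : ℝ) 1 → K u = 0) {F : ℝ → ℝ} {p : ℕ}
    (hF : F =o[𝓝 0] fun y => y ^ p) :
    (fun h => ∫ u, K u * F (h * u)) =o[𝓝[>] 0] fun h => h ^ p := by
  rw [isLittleO_iff]
  intro c hc
  -- `2 * C` bounds the mass of `|K|` on `[-1,1]`; adding one allows `C = 0`.
  have hc' : 0 < c / (2 * C + 1) := by positivity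
  obtain ⟨r, hr, hball⟩ := Metric.eventually_nhds_iff_ball.1 (hF.def hc')
  filter_upwards [Ioo_mem_nhdsGT hr] with h hh
  have h1 : |∫ u, K u * F (h * u)| ≤ 2 * C * (c / (2 * C + 1) * h ^ p) := by
    refine abs_integral_kernel_mul_le hC0 hC hs
      fun u hu => ?_
    have hu' : |u| ≤ 1 := abs_le.2 hu
    have h2 : |h * u| ≤ h := by
      rw [abs_mul, abs_of_pos hh.1]; exact mul_le_of_le_one_right hh.1.le hu'
    have h3 := hball (h * u) (by
      rw [Metric.mem_ball, Real.dist_eq, sub_zero]; exact h2.trans_lt hh.2)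
    rw [Real.norm_eq_abs, Real.norm_eq_abs, abs_pow] at h3
    refine h3.trans (mul_le_mul_of_nonneg_left ?_ hc'.le)
    exact pow_le_pow_left₀ (abs_nonneg _) h2 p
  rw [Real.norm_eq_abs, Real.norm_eq_abs, abs_of_nonneg (pow_nonneg hh.1.le p)]
  refine h1.trans ?_
  have h4 : 2 * C * (c / (2 * C + 1)) ≤ c := by
    rw [mul_div_assoc', div_le_iff₀ (by positivity)]; nlinarith
  calc _ = 2 * C * (c / (2 * C + 1)) * h ^ p := by ring
    _ ≤ _ := mul_le_mul_of_nonneg_right h4 (pow_nonneg hh.1.le p)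

/-- Around an interior point the whole kernel window eventually lies in `[0,1]`, so there are no
boundary effects. -/
lemma eventually_window (hx : x ∈ Set.Ioo (0 : ℝ) 1) :
    ∀ᶠ h in 𝓝[>] (0 : ℝ), 0 < h ∧ h ≤ x ∧ x + h ≤ 1 := by
  have h1 : 0 < min x (1 - x) := lt_min hx.1 (by linarith [hx.2])
  filter_upwards [Ioo_mem_nhdsGT h1] with h hh
  have h2 := hh.2.le.trans (min_le_left _ _)
  have h3 := hh.2.le.trans (min_le_right _ _)
  exact ⟨hh.1, h2, by linarith⟩

lemma continuousOn_comp_window {g : ℝ → ℝ} (hg : ContinuousOn g (Set.Icc 0 1)) (hh : 0 < h)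
    (h₁ : h ≤ x) (h₂ : x + h ≤ 1) :
    ContinuousOn (fun u => g (x + h * u)) (Set.Icc (-1) 1) := by
  refine hg.comp (by fun_prop) fun u hu => ?_
  constructor <;> nlinarith [hu.1, hu.2]

/-- Kernel averages of a continuous function converge. -/
lemma tendsto_integral_kernel (hm : Measurable K) (hC0 : 0 ≤ C) (hC : ∀ u, |K u| ≤ C)
    (hs : ∀ u, u ∉ Set.Icc (-1 : ℝ) 1 → K u = 0) {g : ℝ → ℝ}
    (hg : ContinuousOn g (Set.Icc 0 1)) (hx : x ∈ Set.Ioo (0 : ℝ) 1) :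
    Tendsto (fun h => ∫ t, scaledKernel K h (t - x) * g t ∂unitLaw) (𝓝[>] 0)
      (𝓝 ((∫ u, K u) * g x)) := by
  have hgx : ContinuousAt g x := hg.continuousAt (Icc_mem_nhds hx.1 hx.2)
  have hF : (fun y => g (x + y) - g x) =o[𝓝 0] fun y : ℝ => y ^ 0 := by
    simp only [pow_zero, isLittleO_one_iff]
    have h1 : Tendsto (fun y => g (x + y)) (𝓝 0) (𝓝 (g x)) := by
      have : Tendsto (fun y => x + y) (𝓝 0) (𝓝 x) := by
        have h := (continuous_const_add x).tendsto 0
        rwa [add_zero] at h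
      exact hgx.tendsto.comp this
    simpa using h1.sub_const (g x)
  have h2 := isLittleO_integral_kernel hC0 hC hs hF
  simp only [pow_zero, isLittleO_one_iff] at h2
  have h3 := h2.add_const ((∫ u, K u) * g x)
  rw [zero_add] at h3
  refine h3.congr' ?_
  filter_upwards [eventually_window hx] with h ⟨hh, h₁, h₂⟩
  rw [integral_scaledKernel_mul hs hh h₁ h₂]
  have i1 := integrable_kernel_mul hm hC hs (continuousOn_comp_window hg hh h₁ h₂)
  have i2 := integrable_kernel_mul hm hC hs (continuousOn_const (c := g x))
  simp only [mul_sub]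
  rw [integral_sub i1 i2, integral_mul_const]
  ring

lemma taylor_one_isLittleO {g : ℝ → ℝ} (hg : ContDiffOn ℝ 1 g (Set.Icc 0 1))
    (hx : x ∈ Set.Ioo (0 : ℝ) 1) :
    (fun y => g (x + y) - g x - derivWithin g (Set.Icc 0 1) x * y) =o[𝓝 0] fun y => y := by
  have h := taylor_isLittleO (n := 1) (convex_Icc (0 : ℝ) 1) (Set.Ioo_subset_Icc_self hx)
    (by exact_mod_cast hg)
  rw [nhdsWithin_eq_nhds.2 (Icc_mem_nhds hx.1 hx.2)] at h
  have ht : Tendsto (fun y => x + y) (𝓝 0) (𝓝 x) := by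
    have h := (continuous_const_add x).tendsto 0
    rwa [add_zero] at h
  refine (h.comp_tendsto ht).congr (fun y => ?_) fun y => ?_
  · simp [taylorWithinEval_succ, taylor_within_zero_eval, iteratedDerivWithin_one]; ring
  · simp

lemma taylor_two_isLittleO {g : ℝ → ℝ} (hg : ContDiffOn ℝ 2 g (Set.Icc 0 1))
    (hx : x ∈ Set.Ioo (0 : ℝ) 1) :
    (fun y => g (x + y) - g x - derivWithin g (Set.Icc 0 1) x * y -
      iteratedDerivWithin 2 g (Set.Icc 0 1) x / 2 * y ^ 2) =o[𝓝 0] fun y => y ^ 2 := by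
  have h := taylor_isLittleO (n := 2) (convex_Icc (0 : ℝ) 1) (Set.Ioo_subset_Icc_self hx)
    (by exact_mod_cast hg)
  rw [nhdsWithin_eq_nhds.2 (Icc_mem_nhds hx.1 hx.2)] at h
  have ht : Tendsto (fun y => x + y) (𝓝 0) (𝓝 x) := by
    have h := (continuous_const_add x).tendsto 0
    rwa [add_zero] at h
  refine (h.comp_tendsto ht).congr (fun y => ?_) fun y => ?_
  · simp [taylorWithinEval_succ, taylor_within_zero_eval, iteratedDerivWithin_one]; ring
  · simp

/-- The second order expansion of `(m(x + y) - m(x)) g(x + y)`. -/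
lemma increment_mul_isLittleO {m g : ℝ → ℝ} (hm : ContDiffOn ℝ 2 m (Set.Icc 0 1))
    (hg : ContDiffOn ℝ 1 g (Set.Icc 0 1)) (hx : x ∈ Set.Ioo (0 : ℝ) 1) :
    (fun y => (m (x + y) - m x) * g (x + y) - derivWithin m (Set.Icc 0 1) x * g x * y -
      (iteratedDerivWithin 2 m (Set.Icc 0 1) x * g x / 2 +
        derivWithin m (Set.Icc 0 1) x * derivWithin g (Set.Icc 0 1) x) * y ^ 2) =o[𝓝 0]
      fun y => y ^ 2 := by
  have ha := taylor_two_isLittleO hm hx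
  have hb := taylor_one_isLittleO hg hx
  set m₁ := derivWithin m (Set.Icc 0 1) x
  set m₂ := iteratedDerivWithin 2 m (Set.Icc 0 1) x
  set g₁ := derivWithin g (Set.Icc 0 1) x
  have ht : Tendsto (fun y => x + y) (𝓝 0) (𝓝 x) := by
    have h := (continuous_const_add x).tendsto 0
    rwa [add_zero] at h
  have hgt : Tendsto (fun y => g (x + y)) (𝓝 0) (𝓝 (g x)) :=
    (hg.continuousOn.continuousAt (Icc_mem_nhds hx.1 hx.2)).tendsto.comp ht
  -- The error has three sources: the second order remainder of `m` times `g`, the linear term of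
  -- `m` times the first order remainder of `g`, and the quadratic term of `m` times the increment
  -- of `g`.
  have t1 := ha.mul_isBigO (hgt.isBigO_one ℝ)
  have t2 := ((isBigO_refl (fun y : ℝ => y) (𝓝 0)).const_mul_left m₁).mul_isLittleO hb
  have hz : Tendsto (fun y => g (x + y) - g x) (𝓝 0) (𝓝 0) := by
    simpa using hgt.sub_const (g x)
  have t3 := ((isBigO_refl (fun y : ℝ => y ^ 2) (𝓝 0)).const_mul_left (m₂ / 2)).mul_isLittleO
    ((isLittleO_one_iff ℝ).2 hz)
  simp only [mul_one] at t1 t3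
  simp only [← sq] at t2
  refine ((t1.add t2).add t3).congr_left fun y => ?_
  ring

/-- This cancels the linear term of the expansion, so that the bias is of order `h²`. -/
lemma KernelAssumption.integral_mul_id (hK : KernelAssumption K) : ∫ u, K u * u = 0 := by
  have h := integral_neg_eq_self (fun u => K u * u) volume
  simp only [hK.symmetric, mul_neg] at h
  rw [integral_neg] at h
  linarith

/-- The bias of the kernel estimator. -/
lemma KernelAssumption.bias_isLittleO (hK : KernelAssumption K) {m g : ℝ → ℝ}
    (hm : ContDiffOn ℝ 2 m (Set.Icc 0 1)) (hg : ContDiffOn ℝ 1 g (Set.Icc 0 1))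
    (hx : x ∈ Set.Ioo (0 : ℝ) 1) :
    (fun h => ∫ t, scaledKernel K h (t - x) * ((m t - m x) * g t) ∂unitLaw -
      (∫ u, u ^ 2 * K u) * (iteratedDerivWithin 2 m (Set.Icc 0 1) x * g x / 2 +
        derivWithin m (Set.Icc 0 1) x * derivWithin g (Set.Icc 0 1) x) * h ^ 2) =o[𝓝[>] 0]
      fun h => h ^ 2 := by
  obtain ⟨C, hC0, hC⟩ := hK.exists_bound
  refine (isLittleO_integral_kernel hC0.le hC hK.support
    (increment_mul_isLittleO hm hg hx)).congr' ?_ (EventuallyEq.refl _ _)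
  filter_upwards [eventually_window hx] with h ⟨hh, h₁, h₂⟩
  rw [integral_scaledKernel_mul hK.support hh h₁ h₂]
  set a := derivWithin m (Set.Icc 0 1) x * g x
  set b := iteratedDerivWithin 2 m (Set.Icc 0 1) x * g x / 2 +
        derivWithin m (Set.Icc 0 1) x * derivWithin g (Set.Icc 0 1) x
  have hcm := (continuousOn_comp_window hm.continuousOn hh h₁ h₂).sub
    (continuousOn_const (c := m x))
  have i1 : Integrable fun u => K u * ((m (x + h * u) - m x) * g (x + h * u)) :=
    integrable_kernel_mul hK.measurable hC hK.support
      (hcm.mul (continuousOn_comp_window hg.continuousOn hh h₁ h₂))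
  have i2 : Integrable fun u => K u * u :=
    integrable_kernel_mul hK.measurable hC hK.support (G := fun u => u) (by fun_prop)
  have i3 : Integrable fun u => u ^ 2 * K u := by
    simpa [mul_comm] using
      integrable_kernel_mul hK.measurable hC hK.support (G := fun u => u ^ 2) (by fun_prop)
  have e : ∀ u, K u * ((m (x + h * u) - m x) * g (x + h * u) - a * (h * u) - b * (h * u) ^ 2) =
      K u * ((m (x + h * u) - m x) * g (x + h * u)) - a * h * (K u * u) -
        b * h ^ 2 * (u ^ 2 * K u) := fun u => by ring
  simp_rw [e]
  rw [integral_sub_sub i1 (i2.const_mul _) (i3.const_mul _), integral_const_mul, integral_const_mul, hK.integral_mul_id]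
  ring

/-- The kernel averages of a differentiable function converge at the rate `h`. -/
lemma KernelAssumption.density_isBigO (hK : KernelAssumption K) {g : ℝ → ℝ}
    (hg : ContDiffOn ℝ 1 g (Set.Icc 0 1)) (hx : x ∈ Set.Ioo (0 : ℝ) 1) :
    (fun h => ∫ t, scaledKernel K h (t - x) * g t ∂unitLaw - g x) =O[𝓝[>] 0] fun h => h := by
  obtain ⟨C, hC0, hC⟩ := hK.exists_bound
  have h1 := taylor_one_isLittleO hg hx
  have h1' : (fun y => g (x + y) - g x - derivWithin g (Set.Icc 0 1) x * y) =o[𝓝 0]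
      fun y => y ^ 1 := by simpa using h1
  have h2 := isLittleO_integral_kernel hC0.le hC hK.support h1'
  simp only [pow_one] at h2
  refine h2.isBigO.congr' ?_ (EventuallyEq.refl _ _)
  filter_upwards [eventually_window hx] with h ⟨hh, h₁, h₂⟩
  rw [integral_scaledKernel_mul hK.support hh h₁ h₂]
  set a := derivWithin g (Set.Icc 0 1) x
  have i1 : Integrable fun u => K u * g (x + h * u) :=
    integrable_kernel_mul hK.measurable hC hK.support
      (continuousOn_comp_window hg.continuousOn hh h₁ h₂)
  have i2 : Integrable fun u => K u * u :=
    integrable_kernel_mul hK.measurable hC hK.support (G := fun u => u) (by fun_prop)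
  have i3 : Integrable fun u => K u * g x :=
    integrable_kernel_mul hK.measurable hC hK.support (G := fun _ => g x) (by fun_prop)
  have e : ∀ u, K u * (g (x + h * u) - g x - a * (h * u)) =
      K u * g (x + h * u) - K u * g x - a * h * (K u * u) := fun u => by ring
  simp_rw [e]
  rw [integral_sub_sub i1 i3 (i2.const_mul _), integral_mul_const,
    integral_const_mul, hK.integral_mul_id, hK.integral_one]
  ring

lemma KernelAssumption.integral_scaledKernel (hK : KernelAssumption K) (hh : 0 < h) (h₁ : h ≤ x)
    (h₂ : x + h ≤ 1) : ∫ t, scaledKernel K h (t - x) ∂unitLaw = 1 := by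
  have := integral_scaledKernel_mul hK.support hh h₁ h₂ fun _ => 1
  simpa [hK.integral_one] using this

lemma KernelAssumption.scaledKernel_nonneg (hK : KernelAssumption K) (hh : 0 < h) (u : ℝ) :
    0 ≤ scaledKernel K h u := div_nonneg (hK.nonneg _) hh.le

end KernelIntegrals

/-! ### The Gaussian leading term. -/

section NoiseCLT

open Topology Asymptotics

variable {d : ℕ} {K : ℝ → ℝ} {s f : (Fin d → ℝ) → ℝ} {x : Fin d → ℝ} {c₁ c₂ : ℝ}

/-- The weight of the noise in the leading term of the estimation error. -/
noncomputable def noiseWeight (K : ℝ → ℝ) (s f : (Fin d → ℝ) → ℝ) (x : Fin d → ℝ) (h : ℝ)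
    (y : Fin d → ℝ) : ℝ :=
  Real.sqrt h * ∑ α, (marginalDensity f α (x α))⁻¹ *
    (scaledKernel K h (y α - x α) * (cube d).indicator s y)

lemma measurable_noiseWeight (hK : KernelAssumption K) (hs : ContinuousOn s (cube d)) (h : ℝ) :
    Measurable (noiseWeight K s f x h) := by
  refine (Finset.measurable_fun_sum _ fun α _ => ?_).const_mul _
  exact (((measurable_scaledKernel hK.measurable h (x α)).comp (measurable_pi_apply α)).mul
    (measurable_indicator_of_continuousOn hs measurableSet_cube)).const_mul _

/-- No sign of `h` is assumed, and division by zero returns zero on both sides. The weights are thus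
bounded for every `n`, also for the small `n` about which the bandwidth assumption says nothing. -/
lemma abs_scaledKernel_le_abs {C : ℝ} (hC : ∀ u, |K u| ≤ C) (h u : ℝ) :
    |scaledKernel K h u| ≤ C / |h| := by
  rw [scaledKernel, abs_div]
  exact div_le_div_of_nonneg_right (hC _) (abs_nonneg _)

lemma abs_indicator_le {S : ℝ} (hS0 : 0 ≤ S) (hS : ∀ y ∈ cube d, |s y| ≤ S) (y : Fin d → ℝ) :
    |(cube d).indicator s y| ≤ S := by
  by_cases hy : y ∈ cube d
  · rw [Set.indicator_of_mem hy]; exact hS y hy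
  · rw [Set.indicator_of_notMem hy, abs_zero]; exact hS0

lemma exists_abs_noiseWeight_le (hK : KernelAssumption K) (hs : ContinuousOn s (cube d)) :
    ∃ B, 0 ≤ B ∧ ∀ h y, |noiseWeight K s f x h y| ≤ Real.sqrt h * (B / |h|) := by
  obtain ⟨C, hC0, hC⟩ := hK.exists_bound
  obtain ⟨S, hS⟩ := exists_bound_of_continuousOn hs
  have hS' := abs_indicator_le (abs_nonneg S) fun y hy => (hS y hy).trans (le_abs_self S)
  refine ⟨∑ α, |(marginalDensity f α (x α))⁻¹| * (C * |S|),
    Finset.sum_nonneg fun α _ => by positivity, fun h y => ?_⟩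
  rw [noiseWeight, abs_mul, abs_of_nonneg (Real.sqrt_nonneg h), Finset.sum_div]
  refine mul_le_mul_of_nonneg_left ((Finset.abs_sum_le_sum_abs _ _).trans
    (Finset.sum_le_sum fun α _ => ?_)) (Real.sqrt_nonneg h)
  rw [abs_mul, abs_mul, mul_div_assoc, mul_div_right_comm]
  exact mul_le_mul_of_nonneg_left (mul_le_mul (abs_scaledKernel_le_abs hC h _) (hS' y)
    (abs_nonneg _) (div_nonneg hC0.le (abs_nonneg _))) (abs_nonneg _)

/-- On the diagonal `h K_h²` is the rescaled kernel `K²`, and its averages converge. Off the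
diagonal the two kernels live in different coordinates, the integral stays bounded, and the factor
`h` removes it. -/
lemma tendsto_kernel_cross (hK : KernelAssumption K) {g : (Fin d → ℝ) → ℝ}
    (hg : ContinuousOn g (cube d)) (hx : ∀ α, x α ∈ Set.Ioo (0 : ℝ) 1) (α β : Fin d) :
    Tendsto (fun h => h * ∫ y, scaledKernel K h (y α - x α) * scaledKernel K h (y β - x β) * g y
      ∂cubeLaw d) (𝓝[>] 0)
      (𝓝 (if α = β then (∫ u, K u ^ 2) * sliceIntegral g α (x α) else 0)) := by
  obtain ⟨C, hC0, hC⟩ := hK.exists_bound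
  obtain ⟨S, hS⟩ := exists_bound_of_continuousOn hg
  split_ifs with hαβ
  · subst hαβ
    have hm2 : Measurable fun u => K u ^ 2 := hK.measurable.pow_const 2
    have hC2 : ∀ u, |K u ^ 2| ≤ C ^ 2 := fun u => by
      rw [abs_pow]; exact pow_le_pow_left₀ (abs_nonneg _) (hC u) 2
    have hs2 : ∀ u, u ∉ Set.Icc (-1 : ℝ) 1 → K u ^ 2 = 0 := fun u hu => by
      rw [hK.support u hu]; norm_num
    refine (tendsto_integral_kernel hm2 (by positivity) hC2 hs2
      (continuousOn_sliceIntegral hg α) (hx α)).congr' ?_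
    filter_upwards [self_mem_nhdsWithin] with h hh
    have hh : 0 < h := hh
    have hmk : Measurable fun y : Fin d → ℝ => scaledKernel (fun u => K u ^ 2) h (y α - x α) :=
      (measurable_scaledKernel hm2 h (x α)).comp (measurable_pi_apply α)
    have hi : Integrable (fun y => scaledKernel (fun u => K u ^ 2) h (y α - x α) * g y)
        (cubeLaw d) := (integrable_cubeLaw hg).bdd_mul (c := C ^ 2 / h) hmk.aestronglyMeasurable
          (ae_of_all _ fun y => abs_scaledKernel_le hC2 hh _)
    rw [← integral_eval_mul_eq_sliceIntegral α
      (φ := fun t => scaledKernel (fun u => K u ^ 2) h (t - x α)) hi, ← integral_const_mul]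
    congr 1; ext y
    simp only [scaledKernel]
    field_simp
  · have hlim : Tendsto (fun h : ℝ => h * |S|) (𝓝[>] 0) (𝓝 0) := by
      have : Tendsto (fun h : ℝ => h * |S|) (𝓝 0) (𝓝 (0 * |S|)) :=
        (continuous_mul_const |S|).tendsto 0
      rw [zero_mul] at this
      exact this.mono_left nhdsWithin_le_nhds
    refine squeeze_zero_norm' ?_ hlim
    filter_upwards [eventually_window (hx α), eventually_window (hx β)]
      with h ⟨hh, h₁, h₂⟩ ⟨_, h₃, h₄⟩
    rw [norm_mul, Real.norm_of_nonneg hh.le]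
    refine mul_le_mul_of_nonneg_left ?_ hh.le
    have m1 := measurable_scaledKernel hK.measurable h (x α)
    have m2 := measurable_scaledKernel hK.measurable h (x β)
    have hi : Integrable (fun y : Fin d → ℝ => |S| *
        (scaledKernel K h (y α - x α) * scaledKernel K h (y β - x β))) (cubeLaw d) := by
      refine Integrable.const_mul ?_ _
      refine Integrable.bdd_mul (c := C / h) ?_
        (m1.comp (measurable_pi_apply α)).aestronglyMeasurable
        (ae_of_all _ fun y => abs_scaledKernel_le hC hh _)
      exact integrable_eval_of_bound m2 (B := C / h) (fun t => abs_scaledKernel_le hC hh _) β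
    refine (norm_integral_le_of_norm_le hi ?_).trans (le_of_eq ?_)
    · filter_upwards [ae_mem_cube] with y hy
      rw [Real.norm_eq_abs, abs_mul, mul_comm, abs_of_nonneg (mul_nonneg
        (hK.scaledKernel_nonneg hh _) (hK.scaledKernel_nonneg hh _))]
      exact mul_le_mul_of_nonneg_right ((hS y hy).trans (le_abs_self S)) (mul_nonneg
        (hK.scaledKernel_nonneg hh _) (hK.scaledKernel_nonneg hh _))
    · rw [integral_const_mul, integral_mul_eval_cubeLaw hαβ (φ := fun t => scaledKernel K h (t - x α))
        (ψ := fun t => scaledKernel K h (t - x β)) m1 m2, hK.integral_scaledKernel hh h₁ h₂,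
        hK.integral_scaledKernel hh h₃ h₄]
      ring

/-- The variance of the leading term. -/
lemma tendsto_integral_sq_noiseWeight (hK : KernelAssumption K) (hs : ContinuousOn s (cube d))
    (hf : ContinuousOn f (cube d)) (hf0 : ∀ y ∈ cube d, 0 ≤ f y)
    (hx : ∀ α, x α ∈ Set.Ioo (0 : ℝ) 1) :
    Tendsto (fun h => ∫ y, noiseWeight K s f x h y ^ 2 ∂densityLaw f) (𝓝[>] 0)
      (𝓝 (variance K s f x)) := by
  obtain ⟨C, hC0, hC⟩ := hK.exists_bound
  set g : (Fin d → ℝ) → ℝ := fun y => s y ^ 2 * f y with hg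
  have hgc : ContinuousOn g (cube d) := (hs.pow 2).mul hf
  set w : Fin d → ℝ := fun α => (marginalDensity f α (x α))⁻¹ with hw
  have hlim : Tendsto (fun h => ∑ α, ∑ β, w α * w β * (h * ∫ y, scaledKernel K h (y α - x α) *
      scaledKernel K h (y β - x β) * g y ∂cubeLaw d)) (𝓝[>] 0)
      (𝓝 (∑ α, ∑ β, w α * w β *
        (if α = β then (∫ u, K u ^ 2) * sliceIntegral g α (x α) else 0))) :=
    tendsto_finsetSum _ fun α _ => tendsto_finsetSum _ fun β _ =>
      (tendsto_kernel_cross hK hgc hx α β).const_mul _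
  have hval : ∑ α, ∑ β, w α * w β *
      (if α = β then (∫ u, K u ^ 2) * sliceIntegral g α (x α) else 0) = variance K s f x := by
    refine Finset.sum_congr rfl fun α _ => ?_
    simp only [mul_ite, mul_zero, Finset.sum_ite_eq, Finset.mem_univ, if_true]
    rw [varComponent, condSecondMoment, hw]
    simp only [div_eq_mul_inv]
    ring
  rw [hval] at hlim
  refine hlim.congr' ?_
  filter_upwards [self_mem_nhdsWithin] with h hh
  have hh : 0 < h := hh
  have hi : ∀ α β, Integrable (fun y : Fin d → ℝ => scaledKernel K h (y α - x α) *
      scaledKernel K h (y β - x β) * g y) (cubeLaw d) := by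
    intro α β
    have m : ∀ α : Fin d, Measurable fun y : Fin d → ℝ => scaledKernel K h (y α - x α) :=
      fun α => (measurable_scaledKernel hK.measurable h (x α)).comp (measurable_pi_apply α)
    simp only [mul_assoc]
    refine Integrable.bdd_mul (c := C / h) ?_ (m α).aestronglyMeasurable
      (ae_of_all _ fun y => abs_scaledKernel_le hC hh _)
    exact (integrable_cubeLaw hgc).bdd_mul (c := C / h) (m β).aestronglyMeasurable
      (ae_of_all _ fun y => abs_scaledKernel_le hC hh _)
  rw [integral_densityLaw hf hf0]
  have e1 : ∀ᵐ y ∂cubeLaw d, noiseWeight K s f x h y ^ 2 * f y =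
      ∑ α, ∑ β, w α * w β * h * (scaledKernel K h (y α - x α) *
        scaledKernel K h (y β - x β) * g y) := by
    filter_upwards [ae_mem_cube] with y hy
    simp only [noiseWeight, Set.indicator_of_mem hy]
    rw [mul_pow, Real.sq_sqrt hh.le, sq (∑ α, _), Finset.sum_mul_sum, Finset.mul_sum,
      Finset.sum_mul]
    refine Finset.sum_congr rfl fun α _ => ?_
    rw [Finset.mul_sum, Finset.sum_mul]
    refine Finset.sum_congr rfl fun β _ => ?_
    simp only [hg, hw]; ring
  rw [integral_congr_ae e1, integral_finsetSum _ fun α _ => integrable_finsetSum _ fun β _ =>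
    (hi α β).const_mul _]
  refine Finset.sum_congr rfl fun α _ => ?_
  rw [integral_finsetSum _ fun β _ => (hi α β).const_mul _]
  refine Finset.sum_congr rfl fun β _ => ?_
  rw [integral_const_mul]; ring

lemma BandwidthAssumption.tendsto {h : ℕ → ℝ} (hh : BandwidthAssumption h) :
    Tendsto h atTop (𝓝[>] 0) := by
  obtain ⟨c₁, hc₁, c₂, hc₂, hev⟩ := hh
  have h1 := (tendsto_natCast_rpow_neg (e := 1 / 5) (by norm_num)).const_mul c₂
  rw [mul_zero] at h1
  have hpos : ∀ᶠ n in atTop, 0 < h n := by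
    filter_upwards [hev, eventually_gt_atTop 0] with n hn hn0
    have : (0 : ℝ) < n := by exact_mod_cast hn0
    exact lt_of_lt_of_le (by positivity) hn.1
  refine tendsto_nhdsWithin_iff.2 ⟨?_, hpos⟩
  refine tendsto_of_tendsto_of_tendsto_of_le_of_le' tendsto_const_nhds h1 ?_ ?_
  · filter_upwards [hpos] with n hn using hn.le
  · filter_upwards [hev] with n hn using hn.2

lemma DensityAssumption.integral_comp {Ω : Type*} [MeasurableSpace Ω] {P : Measure Ω}
    {X : ℕ → Ω → Fin d → ℝ} (hd : DensityAssumption P X f) (hX : ∀ i, Measurable (X i))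
    {φ : (Fin d → ℝ) → ℝ} (hφ : Measurable φ) (i : ℕ) :
    ∫ ω, φ (X i ω) ∂P = ∫ y, φ y ∂densityLaw f := by
  rw [← hd.law i, integral_map (hX i).aemeasurable hφ.aestronglyMeasurable]

lemma DensityAssumption.isProbabilityMeasure {Ω : Type*} [MeasurableSpace Ω] {P : Measure Ω}
    [IsProbabilityMeasure P] {X : ℕ → Ω → Fin d → ℝ} (hd : DensityAssumption P X f)
    (hX : ∀ i, Measurable (X i)) : IsProbabilityMeasure (densityLaw f) := by
  rw [← hd.law 0]; exact Measure.isProbabilityMeasure_map (hX 0).aemeasurable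

/-- The central limit theorem for the leading term. -/
theorem tendstoInDistribution_noise {Ω : Type*} [MeasurableSpace Ω] {P : Measure Ω}
    [IsProbabilityMeasure P] {X : ℕ → Ω → Fin d → ℝ} {ε : ℕ → Ω → ℝ} {h : ℕ → ℝ}
    (hX : ∀ i, Measurable (X i)) (hε : ∀ i, Measurable (ε i)) (hmixing : GeometricMixing P X ε)
    (hnoise : NoiseAssumption P X ε s) (hdensity : DensityAssumption P X f)
    (hkernel : KernelAssumption K) (hbandwidth : BandwidthAssumption h)
    (hx : ∀ α, x α ∈ Set.Ioo (0 : ℝ) 1) :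
    TendstoInDistribution (fun (n : ℕ) ω => (Real.sqrt n)⁻¹ * ∑ i ∈ Finset.range n,
      noiseWeight K s f x (h n) (X i ω) * ε i ω) atTop (id : ℝ → ℝ) (fun _ => P)
      (gaussianReal 0 (variance K s f x).toNNReal) := by
  have := hdensity.isProbabilityMeasure hX
  obtain ⟨K₀, -, l₀, hl₀, hmix⟩ := hmixing
  obtain ⟨c₁, hc₁, c₂, hb⟩ := hdensity.bounds_f
  obtain ⟨B, hB0, hB⟩ := exists_abs_noiseWeight_le (f := f) (x := x) hkernel hnoise.continuous_s
  obtain ⟨M, hM0, hM⟩ := hnoise.exists_condExp_le hX hε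
  have hφ : ∀ n, Measurable (noiseWeight K s f x (h n)) := fun n =>
    measurable_noiseWeight hkernel hnoise.continuous_s _
  have hv := (tendsto_integral_sq_noiseWeight hkernel hnoise.continuous_s hdensity.continuous_f
    (fun y hy => hc₁.le.trans (hb y hy).1) hx).comp hbandwidth.tendsto
  obtain ⟨a₁, ha₁, a₂, ha₂, hev⟩ := hbandwidth
  set Z : ℕ → Ω → (Fin d → ℝ) × ℝ := fun i ω => (X i ω, ε i ω) with hZ
  refine tendstoInDistribution_of_mixing (Z := Z) (fun i => (hX i).prodMk (hε i)) hl₀ hmix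
    (ψ := fun n z => noiseWeight K s f x (h n) z.1 * z.2)
    (fun n => ((hφ n).comp measurable_fst).mul measurable_snd) hv
    (C := Real.sqrt B * (Real.sqrt (Real.sqrt a₁))⁻¹ * (variance K s f x + 1) * M)
    (fun n i => hnoise.integral_mul_eq_zero hX hε (hφ n) (hB (h n)) i)
    (fun n i => (hnoise.integrable hε i).bdd_mul ((hφ n).comp (hX i)).aestronglyMeasurable
      (ae_of_all _ fun ω => hB (h n) _))
    (fun n T => hnoise.integrable_sq_sum hX hε (hφ n) (hB (h n)) T) (fun n T => ?_) ?_
  · rw [hnoise.integral_sq_sum hX hε (hφ n) (hB (h n)) T]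
    simp only [Function.comp]
    rw [Finset.sum_congr rfl fun i _ => hdensity.integral_comp hX ((hφ n).pow_const 2) i]
    simp
  · filter_upwards [hev, eventually_gt_atTop 0, hv.eventually_le_const (lt_add_one _)]
      with n hn hn0 hvn i
    have hn' : (0 : ℝ) < n := by exact_mod_cast hn0
    have hp : 0 < (n : ℝ) ^ (-(1 / 5) : ℝ) := by positivity
    have hh : 0 < h n := lt_of_lt_of_le (by positivity) hn.1
    obtain ⟨h1, h2⟩ := hnoise.integral_rpow_mul_le hX hε (hφ n) (hB (h n)) (hM i)
    refine ⟨h1, h2.trans ?_⟩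
    have hsup : Real.sqrt (h n) * (B / |h n|) = B / Real.sqrt (h n) := by
      rw [abs_of_pos hh]
      have h3 := Real.sq_sqrt hh.le
      have h4 := Real.sqrt_pos.2 hh
      rw [mul_div_assoc', div_eq_div_iff hh.ne' h4.ne']
      nlinarith
    -- The excess exponent `1/2` is spent on the supremum of the weight, of order `h^{-1/2}`; its
    -- square root is `O(n^{1/20})`, while the remaining second moment converges.
    have hpt : ∀ y, |noiseWeight K s f x (h n) y| ^ (5 / 2 : ℝ) ≤
        Real.sqrt (B / Real.sqrt (h n)) * noiseWeight K s f x (h n) y ^ 2 := by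
      intro y
      have h3 := hB (h n) y
      rw [hsup] at h3
      have h0 := abs_nonneg (noiseWeight K s f x (h n) y)
      have e : |noiseWeight K s f x (h n) y| ^ (5 / 2 : ℝ) =
          Real.sqrt |noiseWeight K s f x (h n) y| * noiseWeight K s f x (h n) y ^ 2 := by
        rw [show (5 / 2 : ℝ) = 1 / 2 + (2 : ℕ) by norm_num,
          Real.rpow_add_of_nonneg h0 (by norm_num) (by norm_num), Real.sqrt_eq_rpow,
          Real.rpow_natCast, sq_abs]
      rw [e]
      exact mul_le_mul_of_nonneg_right (Real.sqrt_le_sqrt h3) (sq_nonneg _)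
    have hbd : Integrable (fun y => noiseWeight K s f x (h n) y ^ 2) (densityLaw f) :=
      (MemLp.of_bound (p := 2) (hφ n).aestronglyMeasurable _
        (ae_of_all _ fun y => hB (h n) y)).integrable_sq
    have hint : ∫ ω, |noiseWeight K s f x (h n) (X i ω)| ^ (5 / 2 : ℝ) ∂P ≤
        Real.sqrt (B / Real.sqrt (h n)) * (variance K s f x + 1) := by
      rw [hdensity.integral_comp hX (φ := fun y => |noiseWeight K s f x (h n) y| ^ (5 / 2 : ℝ))
        ((hφ n).abs.pow_const _) i]
      refine (integral_mono_of_nonneg (ae_of_all _ fun y => Real.rpow_nonneg (abs_nonneg _) _)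
        (hbd.const_mul _) (ae_of_all _ hpt)).trans ?_
      rw [integral_const_mul]
      exact mul_le_mul_of_nonneg_left hvn (Real.sqrt_nonneg _)
    have hv0 : 0 ≤ variance K s f x + 1 :=
      le_trans (integral_nonneg fun y => sq_nonneg _) hvn
    have hroot : Real.sqrt (B / Real.sqrt (h n)) ≤
        Real.sqrt B * (Real.sqrt (Real.sqrt a₁))⁻¹ * (n : ℝ) ^ (1 / 20 : ℝ) := by
      have e1 : Real.sqrt (Real.sqrt (a₁ * (n : ℝ) ^ (-(1 / 5) : ℝ))) =
          Real.sqrt (Real.sqrt a₁) * ((n : ℝ) ^ (1 / 20 : ℝ))⁻¹ := by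
        rw [Real.sqrt_mul ha₁.le, Real.sqrt_mul (Real.sqrt_nonneg _)]
        congr 1
        rw [Real.sqrt_eq_rpow, Real.sqrt_eq_rpow, ← Real.rpow_mul hn'.le, ← Real.rpow_mul hn'.le,
          ← Real.rpow_neg hn'.le]
        norm_num
      have e2 : Real.sqrt (Real.sqrt a₁) * ((n : ℝ) ^ (1 / 20 : ℝ))⁻¹ ≤
          Real.sqrt (Real.sqrt (h n)) := by
        rw [← e1]; exact Real.sqrt_le_sqrt (Real.sqrt_le_sqrt hn.1)
      have hs1 : 0 < Real.sqrt (Real.sqrt a₁) := Real.sqrt_pos.2 (Real.sqrt_pos.2 ha₁)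
      rw [Real.sqrt_div hB0, div_eq_mul_inv, mul_assoc]
      refine mul_le_mul_of_nonneg_left ?_ (Real.sqrt_nonneg _)
      calc (Real.sqrt (Real.sqrt (h n)))⁻¹ ≤
          (Real.sqrt (Real.sqrt a₁) * ((n : ℝ) ^ (1 / 20 : ℝ))⁻¹)⁻¹ :=
            inv_anti₀ (by positivity) e2
        _ = _ := by rw [mul_inv, inv_inv]
    calc _ ≤ Real.sqrt (B / Real.sqrt (h n)) * (variance K s f x + 1) * M :=
          mul_le_mul_of_nonneg_right hint hM0
      _ ≤ Real.sqrt B * (Real.sqrt (Real.sqrt a₁))⁻¹ * (n : ℝ) ^ (1 / 20 : ℝ) *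
          (variance K s f x + 1) * M := by gcongr
      _ = _ := by ring

end NoiseCLT

/-! ### Asymptotics in probability as a filter. -/

section HighProbability

open Topology Asymptotics

variable {Ω : Type*} [MeasurableSpace Ω] {P : Measure Ω}

/-- The filter of the sets of pairs `(n, ω)` whose sections have probability tending to one. -/
def whp (P : Measure Ω) : Filter (ℕ × Ω) where
  sets := {S | Tendsto (fun n => P {ω | (n, ω) ∉ S}) atTop (𝓝 0)}
  univ_sets := by simp
  sets_of_superset {S T} hS hST := by
    refine tendsto_of_tendsto_of_tendsto_of_le_of_le tendsto_const_nhds hS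
      (fun _ => zero_le) fun n => measure_mono fun ω hω h => hω (hST h)
  inter_sets {S T} hS hT := by
    have h : Tendsto (fun n => P {ω | (n, ω) ∉ S} + P {ω | (n, ω) ∉ T}) atTop (𝓝 0) := by
      simpa using Tendsto.add hS hT
    refine tendsto_of_tendsto_of_tendsto_of_le_of_le tendsto_const_nhds h
      (fun _ => zero_le) fun n => le_trans (measure_mono fun ω hω => ?_) (measure_union_le _ _)
    by_contra hc
    simp only [Set.mem_union, Set.mem_ofPred_eq, not_or, not_not] at hc
    exact hω hc

lemma eventually_whp {p : ℕ × Ω → Prop} :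
    (∀ᶠ q in whp P, p q) ↔ Tendsto (fun n => P {ω | ¬ p (n, ω)}) atTop (𝓝 0) := Iff.rfl

lemma tendsto_fst_whp : Tendsto Prod.fst (whp P) atTop := by
  intro S hS
  refine tendsto_const_nhds.congr' ?_
  filter_upwards [hS] with n hn
  simp [hn]

lemma eventually_whp_of_ae {p : ℕ → Ω → Prop} (h : ∀ n, ∀ᵐ ω ∂P, p n ω) :
    ∀ᶠ q in whp P, p q.1 q.2 := by
  rw [eventually_whp]
  have : (fun n => P {ω | ¬ p n ω}) = fun _ => 0 := funext fun n => ae_iff.1 (h n)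
  simp [this]

/-- The exit from the calculus of `O` and `o` along `whp`: a remainder that is small along this
filter is negligible for convergence in distribution. -/
lemma tendstoInMeasure_of_whp {R : ℕ → Ω → ℝ}
    (h : Tendsto (fun q : ℕ × Ω => R q.1 q.2) (whp P) (𝓝 0)) :
    TendstoInMeasure P R atTop 0 := by
  rw [tendstoInMeasure_iff_norm]
  intro r hr
  have h1 := (Metric.tendsto_nhds.1 h) r hr
  rw [eventually_whp] at h1
  simpa using h1

/-- A Markov bound: nonnegative variables are of the order of any larger rate than their means. -/
lemma isBigO_whp_of_integral [IsFiniteMeasure P] {A : ℕ → Ω → ℝ} (h0 : ∀ n ω, 0 ≤ A n ω)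
    (hi : ∀ n, Integrable (A n) P) {r : ℝ}
    (h : (fun n => ∫ ω, A n ω ∂P) =o[atTop] fun n : ℕ => (n : ℝ) ^ r) :
    (fun q : ℕ × Ω => A q.1 q.2) =O[whp P] fun q => (q.1 : ℝ) ^ r := by
  -- `O` along `whp` asks for one constant that works with probability tending to one, which is more
  -- than tightness. A mean of strictly smaller order gives this with constant one.
  refine IsBigO.of_bound 1 ?_
  rw [eventually_whp]
  have h1 : Tendsto (fun n => ENNReal.ofReal ((∫ ω, A n ω ∂P) / (n : ℝ) ^ r)) atTop (𝓝 0) := by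
    simpa using ENNReal.tendsto_ofReal h.tendsto_div_nhds_zero
  refine tendsto_of_tendsto_of_tendsto_of_le_of_le' tendsto_const_nhds h1
    (Eventually.of_forall fun _ => zero_le) ?_
  filter_upwards [eventually_gt_atTop 0] with n hn
  have hr : 0 < (n : ℝ) ^ r := Real.rpow_pos_of_pos (by exact_mod_cast hn) r
  have h2 := mul_meas_ge_le_integral_of_nonneg (Eventually.of_forall (h0 n)) (hi n) ((n : ℝ) ^ r)
  refine le_trans (measure_mono fun ω hω => ?_)
    ((ENNReal.ofReal_toReal (measure_ne_top P {ω | (n : ℝ) ^ r ≤ A n ω})).symm.le.trans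
      (ENNReal.ofReal_le_ofReal ?_))
  · simp only [Set.mem_ofPred_eq, Real.norm_eq_abs, one_mul, not_le, abs_of_nonneg (h0 n ω),
      abs_of_pos hr] at hω
    exact hω.le
  · rw [le_div_iff₀' hr]; exact h2

end HighProbability

/-! ### Calculus of exponents along a filter. -/

section Rates

open Topology Asymptotics

lemma isBigO_natCast_rpow {a b : ℝ} (hab : a ≤ b) :
    (fun n : ℕ => (n : ℝ) ^ a) =O[atTop] fun n : ℕ => (n : ℝ) ^ b := by
  refine IsBigO.of_bound 1 ?_
  filter_upwards [eventually_ge_atTop 1] with n hn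
  have hn' : (1 : ℝ) ≤ n := by exact_mod_cast hn
  rw [one_mul, Real.norm_of_nonneg (by positivity), Real.norm_of_nonneg (by positivity)]
  exact Real.rpow_le_rpow_of_exponent_le hn' hab

lemma isLittleO_natCast_rpow {a b : ℝ} (hab : a < b) :
    (fun n : ℕ => (n : ℝ) ^ a) =o[atTop] fun n : ℕ => (n : ℝ) ^ b := by
  refine (isLittleO_iff_tendsto' ?_).2 ?_
  · filter_upwards [eventually_gt_atTop 0] with n hn h
    exact absurd h (Real.rpow_pos_of_pos (by exact_mod_cast hn) b).ne'
  · refine (tendsto_natCast_rpow_of_neg (sub_neg.2 hab)).congr' ?_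
    filter_upwards [eventually_gt_atTop 0] with n hn
    rw [Real.rpow_sub (by exact_mod_cast hn)]

variable {T : Type*} {l : Filter T} {ν : T → ℕ}

lemma isBigO_mul_rpow (hν : Tendsto ν l atTop) {A B : T → ℝ} {a b c : ℝ}
    (hA : A =O[l] fun t => (ν t : ℝ) ^ a) (hB : B =O[l] fun t => (ν t : ℝ) ^ b)
    (h : a + b ≤ c) : (fun t => A t * B t) =O[l] fun t => (ν t : ℝ) ^ c := by
  refine (hA.mul hB).trans (IsBigO.trans ?_ ((isBigO_natCast_rpow h).comp_tendsto hν))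
  refine IsBigO.of_bound 1 ?_
  filter_upwards [hν.eventually (eventually_gt_atTop 0)] with t ht
  have : (0 : ℝ) < ν t := by exact_mod_cast ht
  simp only [Function.comp_apply]
  rw [Real.rpow_add this, one_mul]

lemma isBigO_sqrt_rpow {A : T → ℝ} {a c : ℝ} (hA : A =O[l] fun t => (ν t : ℝ) ^ a)
    (h : a / 2 = c) : (fun t => Real.sqrt (A t)) =O[l] fun t => (ν t : ℝ) ^ c := by
  obtain ⟨C, hC0, hC⟩ := hA.exists_nonneg
  refine IsBigO.of_bound (Real.sqrt C) ?_
  filter_upwards [hC.bound] with t ht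
  have h0 : (0 : ℝ) ≤ ν t := by positivity
  rw [Real.norm_of_nonneg (Real.rpow_nonneg h0 _), Real.norm_eq_abs] at ht
  rw [Real.norm_of_nonneg (Real.sqrt_nonneg _), Real.norm_of_nonneg (by positivity)]
  have h1 : (ν t : ℝ) ^ c = Real.sqrt ((ν t : ℝ) ^ a) := by
    rw [Real.sqrt_eq_rpow, ← Real.rpow_mul h0, ← h]; ring_nf
  rw [h1, ← Real.sqrt_mul hC0]
  exact Real.sqrt_le_sqrt ((le_abs_self _).trans ht)

end Rates

/-! ### Mean square rates for families of sample averages. -/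

section SquaredAverages

open Topology Asymptotics

variable {Ω : Type*} [MeasurableSpace Ω] {P : Measure Ω} [IsProbabilityMeasure P] {d : ℕ}
  {X : ℕ → Ω → Fin d → ℝ} {ε : ℕ → Ω → ℝ} {s f : (Fin d → ℝ) → ℝ}
  {J : ℕ → Type*} [∀ n, Fintype (J n)] {φ : ∀ n, J n → (Fin d → ℝ) → ℝ} {B : ℕ → ℝ} {q D r : ℝ}

/-- Sample averages of bounded functions of the predictors deviate from their means as under
independence, up to the factor `n ^ (1 / 100)`. -/
theorem isBigO_sum_sq_avg_sub (hX : ∀ i, Measurable (X i)) (hε : ∀ i, Measurable (ε i))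
    (hmixing : GeometricMixing P X ε) (hdensity : DensityAssumption P X f)
    (hφ : ∀ n j, Measurable (φ n j)) (hB : ∀ n j y, |φ n j y| ≤ B n)
    (hQ : (fun n => ∑ j, ∫ y, φ n j y ^ 2 ∂densityLaw f) =O[atTop] fun n : ℕ => (n : ℝ) ^ q)
    (hD : (fun n => Fintype.card (J n) * B n ^ 2) =O[atTop] fun n : ℕ => (n : ℝ) ^ D)
    (hr : q - 1 + 1 / 100 < r) :
    (fun p : ℕ × Ω => ∑ j, (avg p.1 (fun i => φ p.1 j (X i p.2)) -
      ∫ y, φ p.1 j y ∂densityLaw f) ^ 2) =O[whp P] fun p => (p.1 : ℝ) ^ r := by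
  have := hdensity.isProbabilityMeasure hX
  obtain ⟨K₀, hK₀, l₀, hl₀, hmix⟩ := hmixing
  have hm : ∀ n j, Measurable fun ω => avg n (fun i => φ n j (X i ω)) := fun n j =>
    (Finset.measurable_sum _ fun i _ => (hφ n j).comp (hX i)).const_mul _
  have habs : ∀ n j ω, |avg n (fun i => φ n j (X i ω))| ≤ B n := by
    intro n j ω
    have hB0 : 0 ≤ B n := (abs_nonneg _).trans (hB n j 0)
    rcases Nat.eq_zero_or_pos n with rfl | hn
    · simpa [avg] using hB0
    · rw [← avg_const hn (B n)]
      exact abs_avg_le.trans (avg_mono fun i _ => hB n j _)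
  have hint : ∀ n j, Integrable (fun ω => (avg n (fun i => φ n j (X i ω)) -
      ∫ y, φ n j y ∂densityLaw f) ^ 2) P := by
    intro n j
    refine Integrable.of_bound (((hm n j).sub_const _).pow_const 2).aestronglyMeasurable
      ((B n + |∫ y, φ n j y ∂densityLaw f|) ^ 2) (Eventually.of_forall fun ω => ?_)
    rw [Real.norm_eq_abs, abs_pow]
    exact pow_le_pow_left₀ (abs_nonneg _)
      ((abs_sub _ _).trans (add_le_add (habs n j ω) le_rfl)) 2
  refine isBigO_whp_of_integral (A := fun n ω => ∑ j, (avg n (fun i => φ n j (X i ω)) -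
      ∫ y, φ n j y ∂densityLaw f) ^ 2) (fun n ω => Finset.sum_nonneg fun j _ => sq_nonneg _)
    (fun n => integrable_finsetSum _ fun j _ => hint n j) ?_
  -- Pairs closer than this lag cost the factor `2 * L + 1 ≤ 5 * n^{1/100}`; beyond it the mixing
  -- coefficient outweighs the polynomial size of `card * B²`.
  set L : ℕ → ℕ := fun n => ⌈(n : ℝ) ^ (1 / 100 : ℝ)⌉₊ with hL
  have hle : ∀ᶠ n : ℕ in atTop, ‖∫ ω, ∑ j, (avg n (fun i => φ n j (X i ω)) -
      ∫ y, φ n j y ∂densityLaw f) ^ 2 ∂P‖ ≤ ‖5 * (n : ℝ) ^ (1 / 100 : ℝ) * (n : ℝ) ^ (-1 : ℝ) *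
        ∑ j, ∫ y, φ n j y ^ 2 ∂densityLaw f + 4 * K₀ * (Fintype.card (J n) * B n ^ 2 *
          Real.exp (-l₀ * (n : ℝ) ^ (1 / 100 : ℝ)))‖ := by
    filter_upwards [eventually_ge_atTop 1] with n hn
    have hn1 : (1 : ℝ) ≤ n := by exact_mod_cast hn
    have hroot : 1 ≤ (n : ℝ) ^ (1 / 100 : ℝ) := Real.one_le_rpow hn1 (by norm_num)
    have hLn : (n : ℝ) ^ (1 / 100 : ℝ) ≤ L n := Nat.le_ceil _
    have hL1 : 1 ≤ L n := by exact_mod_cast hroot.trans hLn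
    have hL2 : (L n : ℝ) ≤ 2 * (n : ℝ) ^ (1 / 100 : ℝ) := natCeil_rpow_le (by norm_num) hn
    have ha : alphaMixingCoeff P (fun i ω => (X i ω, ε i ω)) (L n) ≤
        K₀ * Real.exp (-l₀ * (n : ℝ) ^ (1 / 100 : ℝ)) := by
      refine (hmix _ hL1).trans (mul_le_mul_of_nonneg_left (Real.exp_le_exp.2 ?_) hK₀.le)
      nlinarith
    rw [Real.norm_of_nonneg (integral_nonneg fun ω => Finset.sum_nonneg fun j _ => sq_nonneg _)]
    refine le_trans ?_ (le_abs_self _)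
    rw [integral_finsetSum _ fun j _ => hint n j]
    have hterm : ∀ j, ∫ ω, (avg n (fun i => φ n j (X i ω)) -
        ∫ y, φ n j y ∂densityLaw f) ^ 2 ∂P ≤
        5 * (n : ℝ) ^ (1 / 100 : ℝ) * (n : ℝ) ^ (-1 : ℝ) * ∫ y, φ n j y ^ 2 ∂densityLaw f +
          4 * K₀ * (B n ^ 2 * Real.exp (-l₀ * (n : ℝ) ^ (1 / 100 : ℝ))) := by
      intro j
      have h1 := integral_sq_average_sub_le (P := P) (Z := fun i ω => (X i ω, ε i ω))
        (fun i => (hX i).prodMk (hε i)) (φ := fun z => φ n j z.1) ((hφ n j).comp measurable_fst)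
        (B := B n) (fun z => hB n j z.1) (fun i => hdensity.integral_comp hX (hφ n j) i)
        (fun i => hdensity.integral_comp hX ((hφ n j).pow_const 2) i) ha (by omega : 0 < n)
      refine h1.trans (le_of_le_of_eq (add_le_add_left (mul_le_mul_of_nonneg_right
        (?_ : _ ≤ 5 * (n : ℝ) ^ (1 / 100 : ℝ) * (n : ℝ) ^ (-1 : ℝ))
        (integral_nonneg fun y => sq_nonneg _)) _) (by ring))
      rw [Real.rpow_neg_one, div_eq_mul_inv]
      gcongr
      linarith
    refine (Finset.sum_le_sum fun j _ => hterm j).trans (le_of_eq ?_)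
    rw [Finset.sum_add_distrib, ← Finset.mul_sum, Finset.sum_const, Finset.card_univ,
      nsmul_eq_mul]
    ring
  refine (IsBigO.of_bound' hle).trans_isLittleO (IsLittleO.add ?_ ?_)
  · have h1 : (fun n : ℕ => 5 * (n : ℝ) ^ (1 / 100 : ℝ)) =O[atTop]
        fun n : ℕ => (n : ℝ) ^ (1 / 100 : ℝ) := (isBigO_refl _ _).const_mul_left 5
    have h2 := isBigO_mul_rpow (ν := fun n => n) tendsto_id h1 (isBigO_refl
      (fun n : ℕ => (n : ℝ) ^ (-1 : ℝ)) atTop) (c := 1 / 100 + -1) le_rfl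
    exact (isBigO_mul_rpow (ν := fun n => n) tendsto_id h2 hQ (c := q - 1 + 1 / 100)
      (by linarith)).trans_isLittleO (isLittleO_natCast_rpow hr)
  · refine IsLittleO.const_mul_left (IsBigO.trans_isLittleO (hD.mul (isBigO_refl _ _)) ?_) _
    refine (isLittleO_iff_tendsto' ?_).2 ?_
    · filter_upwards [eventually_gt_atTop 0] with n hn h
      exact absurd h (Real.rpow_pos_of_pos (by exact_mod_cast hn) r).ne'
    · refine (tendsto_rpow_mul_exp_neg_rpow (D - r) hl₀
        (by norm_num : (0 : ℝ) < 1 / 100)).congr' ?_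
      filter_upwards [eventually_gt_atTop 0] with n hn
      rw [Real.rpow_sub (by exact_mod_cast hn)]
      ring

/-- Sample averages of functions of the predictors times the noise. -/
theorem isBigO_sum_sq_avg_noise (hX : ∀ i, Measurable (X i)) (hε : ∀ i, Measurable (ε i))
    (hnoise : NoiseAssumption P X ε s) (hdensity : DensityAssumption P X f)
    (hφ : ∀ n j, Measurable (φ n j)) (hB : ∀ n j y, |φ n j y| ≤ B n)
    (hQ : (fun n => ∑ j, ∫ y, φ n j y ^ 2 ∂densityLaw f) =O[atTop] fun n : ℕ => (n : ℝ) ^ q)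
    (hr : q - 1 < r) :
    (fun p : ℕ × Ω => ∑ j, avg p.1 (fun i => φ p.1 j (X i p.2) * ε i p.2) ^ 2) =O[whp P]
      fun p => (p.1 : ℝ) ^ r := by
  have hint : ∀ n j, Integrable (fun ω => avg n (fun i => φ n j (X i ω) * ε i ω) ^ 2) P := by
    intro n j
    simp only [avg, mul_pow]
    exact (hnoise.integrable_sq_sum hX hε (hφ n j) (hB n j) _).const_mul _
  refine isBigO_whp_of_integral
    (A := fun n ω => ∑ j, avg n (fun i => φ n j (X i ω) * ε i ω) ^ 2) (fun n ω => Finset.sum_nonneg fun j _ => sq_nonneg _)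
    (fun n => integrable_finsetSum _ fun j _ => hint n j) ?_
  -- Noise averages have an exact variance, so neither the factor `n^{1/100}` nor mixing appears
  -- here.
  have heq : (fun n => ∫ ω, ∑ j, avg n (fun i => φ n j (X i ω) * ε i ω) ^ 2 ∂P) =
      fun n : ℕ => (n : ℝ) ^ (-1 : ℝ) * ∑ j, ∫ y, φ n j y ^ 2 ∂densityLaw f := by
    ext n
    rw [integral_finsetSum _ fun j _ => hint n j, Finset.mul_sum]
    refine Finset.sum_congr rfl fun j _ => ?_
    rw [Real.rpow_neg_one]
    exact hnoise.integral_sq_average hX hε (hφ n j) (hB n j)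
      (fun i => hdensity.integral_comp hX ((hφ n j).pow_const 2) i) n
  rw [heq]
  exact (isBigO_mul_rpow (ν := fun n => n) tendsto_id (isBigO_refl _ _) hQ (c := q - 1)
    (by linarith)).trans_isLittleO (isLittleO_natCast_rpow hr)

end SquaredAverages

/-! ### Population version of the additive step functions. -/

section Population

variable {d : ℕ} {f : (Fin d → ℝ) → ℝ} {c₁ c₂ : ℝ} {N : ℕ}

/-- The indicator function of the `k.2`-th cell in the coordinate `k.1`. -/
noncomputable def cellFn (N : ℕ) (k : Fin d × Fin (N + 1)) (y : Fin d → ℝ) : ℝ :=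
  cell N k.2 (y k.1)

/-- The Gram matrix of the indicator functions of the cells. -/
noncomputable def gram (f : (Fin d → ℝ) → ℝ) (N : ℕ) (k l : Fin d × Fin (N + 1)) : ℝ :=
  ∫ y, cellFn N k y * cellFn N l y ∂densityLaw f

/-- The functional that maps the coefficients of an additive spline to the mean of its
component `γ`. -/
noncomputable def cellMean (f : (Fin d → ℝ) → ℝ) (N : ℕ) (γ : Fin d) (k : Fin d × Fin (N + 1)) :
    ℝ := if k.1 = γ then ∫ y, cellFn N k y ∂densityLaw f else 0

/-- The functional that maps the coefficients of an additive spline to the mean of its component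
`β` weighted by the kernel in the coordinate `α`. -/
noncomputable def kernelCoeff (K : ℝ → ℝ) (f : (Fin d → ℝ) → ℝ) (x : Fin d → ℝ) (h : ℝ) (N : ℕ)
    (α β : Fin d) (k : Fin d × Fin (N + 1)) : ℝ :=
  if k.1 = β then ∫ y, scaledKernel K h (y α - x α) * cellFn N k y ∂densityLaw f else 0

lemma measurable_cellFn (k : Fin d × Fin (N + 1)) : Measurable (cellFn N k) :=
  (measurable_cell N k.2).comp (measurable_pi_apply k.1)

lemma cellFn_nonneg (k : Fin d × Fin (N + 1)) (y : Fin d → ℝ) : 0 ≤ cellFn N k y :=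
  cell_nonneg _ _ _

lemma abs_cellFn_le_one (k : Fin d × Fin (N + 1)) (y : Fin d → ℝ) : |cellFn N k y| ≤ 1 :=
  abs_cell_le_one _ _ _

lemma cellFn_sq (k : Fin d × Fin (N + 1)) (y : Fin d → ℝ) : cellFn N k y ^ 2 = cellFn N k y :=
  cell_sq _ _ _

lemma sum_mul_cellFn (δ : Fin d × Fin (N + 1) → ℝ) (y : Fin d → ℝ) :
    ∑ k, δ k * cellFn N k y = ∑ γ, ∑ J, δ (γ, J) * cell N J (y γ) := by
  rw [Fintype.sum_prod_type]; rfl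

lemma sum_ite_fst_eq {M : Type*} [AddCommMonoid M] {n : ℕ} (γ : Fin d) (g : Fin d × Fin n → M) :
    ∑ k, (if k.1 = γ then g k else 0) = ∑ J, g (γ, J) := by
  rw [Fintype.sum_prod_type, Finset.sum_eq_single γ]
  · simp
  · intro b _ hb; simp [hb]
  · simp

/-- At most one cell per coordinate is active at any point. Hence the second moments summed over all
cells stay bounded while the number of cells grows, which allows `q = 0` in several deviation
bounds. -/
lemma sum_cellFn_le (y : Fin d → ℝ) : ∑ k : Fin d × Fin (N + 1), cellFn N k y ≤ d := by
  rw [Fintype.sum_prod_type]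
  calc _ ≤ ∑ _γ : Fin d, (1 : ℝ) := Finset.sum_le_sum fun γ _ => sum_cell_le_one N (y γ)
    _ = d := by simp

lemma integrable_of_abs_le {E : Type*} [MeasurableSpace E] {μ : Measure E} [IsFiniteMeasure μ]
    {g : E → ℝ} (hg : Measurable g) {B : ℝ} (hB : ∀ y, |g y| ≤ B) : Integrable g μ :=
  Integrable.of_bound hg.aestronglyMeasurable B (Eventually.of_forall hB)

lemma abs_mul_le_of_abs_le {a b A B : ℝ} (ha : |a| ≤ A) (hb : |b| ≤ B) : |a * b| ≤ A * B := by
  rw [abs_mul]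
  exact mul_le_mul ha hb (abs_nonneg _) ((abs_nonneg _).trans ha)

lemma abs_sum_mul_cellFn_le (δ : Fin d × Fin (N + 1) → ℝ) (y : Fin d → ℝ) :
    |∑ k, δ k * cellFn N k y| ≤ ∑ k, |δ k| := by
  refine (Finset.abs_sum_le_sum_abs _ _).trans (Finset.sum_le_sum fun k _ => ?_)
  simpa using abs_mul_le_of_abs_le (le_refl |δ k|) (abs_cellFn_le_one k y)

lemma measurable_sum_mul_cellFn (δ : Fin d × Fin (N + 1) → ℝ) :
    Measurable fun y => ∑ k, δ k * cellFn N k y :=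
  Finset.measurable_sum _ fun k _ => (measurable_cellFn k).const_mul _

variable [IsProbabilityMeasure (densityLaw f)]

lemma integral_mul_sum_cellFn (u δ : Fin d × Fin (N + 1) → ℝ) :
    ∫ y, (∑ k, u k * cellFn N k y) * (∑ k, δ k * cellFn N k y) ∂densityLaw f =
      ∑ k, ∑ l, u k * δ l * gram f N k l := by
  have hi : ∀ k l : Fin d × Fin (N + 1), Integrable (fun y => cellFn N k y * cellFn N l y)
      (densityLaw f) := fun k l =>
    integrable_of_abs_le ((measurable_cellFn k).mul (measurable_cellFn l))
      fun y => abs_mul_le_of_abs_le (abs_cellFn_le_one k y) (abs_cellFn_le_one l y)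
  have h1 : ∀ y, (∑ k, u k * cellFn N k y) * (∑ k, δ k * cellFn N k y) =
      ∑ k, ∑ l, u k * δ l * (cellFn N k y * cellFn N l y) := fun y => by
    rw [Finset.sum_mul_sum]
    exact Finset.sum_congr rfl fun _ _ => Finset.sum_congr rfl fun _ _ => by ring
  simp only [h1]
  rw [integral_finsetSum _ fun k _ => integrable_finsetSum _ fun l _ => (hi k l).const_mul _]
  refine Finset.sum_congr rfl fun k _ => ?_
  rw [integral_finsetSum _ fun l _ => (hi k l).const_mul _]
  exact Finset.sum_congr rfl fun l _ => integral_const_mul _ _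

lemma integral_sum_cellFn_mul (u : Fin d × Fin (N + 1) → ℝ) (l : Fin d × Fin (N + 1)) :
    ∫ y, (∑ k, u k * cellFn N k y) * cellFn N l y ∂densityLaw f = ∑ k, u k * gram f N k l := by
  classical
  have h := integral_mul_sum_cellFn (f := f) u fun k => if k = l then 1 else 0
  simpa using h

lemma sum_gram_nonneg (u : Fin d × Fin (N + 1) → ℝ) :
    0 ≤ ∑ k, ∑ l, u k * u l * gram f N k l := by
  rw [← integral_mul_sum_cellFn]
  exact integral_nonneg fun y => mul_self_nonneg _

lemma integral_sum_mul_cell (δ : Fin d × Fin (N + 1) → ℝ) (γ : Fin d) :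
    ∫ y, ∑ J, δ (γ, J) * cell N J (y γ) ∂densityLaw f = ∑ k, δ k * cellMean f N γ k := by
  simp only [cellMean, mul_ite, mul_zero]
  rw [sum_ite_fst_eq γ fun k => δ k * ∫ y, cellFn N k y ∂densityLaw f,
    integral_finsetSum (f := fun (J : Fin (N + 1)) (y : Fin d → ℝ) => δ (γ, J) * cell N J (y γ)) _
      fun J _ => (integrable_of_abs_le (measurable_cellFn (γ, J))
        (abs_cellFn_le_one (γ, J))).const_mul _]
  exact Finset.sum_congr rfl fun J _ => integral_const_mul _ _

lemma integral_sq_sum_mul_cell_unitLaw (a : Fin (N + 1) → ℝ) :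
    ∫ t, (∑ J, a J * cell N J t) ^ 2 ∂unitLaw = ((N : ℝ) + 1)⁻¹ * ∑ J, a J ^ 2 := by
  simp only [sq_sum_mul_cell]
  rw [integral_finsetSum (f := fun (J : Fin (N + 1)) t => a J ^ 2 * cell N J t) _
    fun J _ => (integrable_of_abs_le (measurable_cell N J) (abs_cell_le_one N J)).const_mul _,
    Finset.mul_sum]
  refine Finset.sum_congr rfl fun J _ => ?_
  rw [integral_const_mul, integral_cell J.2, mul_comm]

/-- Stability of the additive spline basis. -/
lemma sum_sq_le_gram (hf : ContinuousOn f (cube d)) (hc₁ : 0 < c₁)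
    (hb : ∀ x ∈ cube d, c₁ ≤ f x ∧ f x ≤ c₂) (hc₂ : 0 ≤ c₂) (δ : Fin d × Fin (N + 1) → ℝ) :
    ((N : ℝ) + 1)⁻¹ * ∑ k, δ k ^ 2 ≤ ((1 + 2 * c₂) / c₁ + 2) *
      (∑ k, ∑ l, δ k * δ l * gram f N k l + ∑ γ, (∑ k, δ k * cellMean f N γ k) ^ 2) := by
  have hB : ∀ (γ : Fin d) t, |∑ J, δ (γ, J) * cell N J t| ≤ ∑ k, |δ k| := by
    intro γ t
    have : ∑ J, |δ (γ, J)| ≤ ∑ k, |δ k| := by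
      rw [Fintype.sum_prod_type]
      exact Finset.single_le_sum (f := fun γ => ∑ J, |δ (γ, J)|)
        (fun _ _ => Finset.sum_nonneg fun _ _ => abs_nonneg _) (Finset.mem_univ γ)
    refine (Finset.abs_sum_le_sum_abs _ _).trans (le_trans (Finset.sum_le_sum fun J _ => ?_) this)
    simpa using abs_mul_le_of_abs_le (le_refl |δ (γ, J)|) (abs_cell_le_one N J t)
  have h := sum_integral_sq_le hf hc₁ hb hc₂ (g := fun γ t => ∑ J, δ (γ, J) * cell N J t)
    (fun γ => Finset.measurable_sum _ fun J _ => (measurable_cell N J).const_mul _) hB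
  simp only [integral_sum_mul_cell, ← sum_mul_cellFn] at h
  simp only [sq (∑ k, δ k * cellFn N k _), integral_mul_sum_cellFn] at h
  refine le_trans (le_of_eq ?_) h
  rw [Fintype.sum_prod_type, Finset.mul_sum]
  exact Finset.sum_congr rfl fun γ _ => (integral_sq_sum_mul_cell_unitLaw fun J => δ (γ, J)).symm

variable {K : ℝ → ℝ} {x : Fin d → ℝ} {h : ℝ} {α β : Fin d}

omit [IsProbabilityMeasure (densityLaw f)] in
-- As `α ≠ β`, the kernel and the cell are independent under the uniform law: the kernel integrates
-- to one and only the length of the cell remains, without any `1/h`.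
lemma kernelCoeff_mem (hf : ContinuousOn f (cube d)) (hc₁ : 0 ≤ c₁)
    (hb : ∀ x ∈ cube d, c₁ ≤ f x ∧ f x ≤ c₂) (hK : KernelAssumption K)
    (hh : 0 < h) (h₁ : h ≤ x α) (h₂ : x α + h ≤ 1) (hαβ : α ≠ β) (J : Fin (N + 1)) :
    0 ≤ kernelCoeff K f x h N α β (β, J) ∧
      kernelCoeff K f x h N α β (β, J) ≤ c₂ * ((N : ℝ) + 1)⁻¹ := by
  obtain ⟨C, hC0, hC⟩ := hK.exists_bound
  have hm : Measurable fun y : Fin d → ℝ => scaledKernel K h (y α - x α) :=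
    (measurable_scaledKernel hK.measurable h (x α)).comp (measurable_pi_apply α)
  have h0 : ∀ y : Fin d → ℝ, 0 ≤ scaledKernel K h (y α - x α) * cellFn N (β, J) y := fun y =>
    mul_nonneg (hK.scaledKernel_nonneg hh _) (cellFn_nonneg _ _)
  simp only [kernelCoeff, if_true]
  refine ⟨integral_nonneg h0, (integral_densityLaw_le hf hc₁ hb (integrable_of_abs_le
    (hm.mul (measurable_cellFn _)) (fun y => abs_mul_le_of_abs_le (abs_scaledKernel_le hC hh _)
    (abs_cellFn_le_one _ y))) h0).trans (le_of_eq ?_)⟩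
  have := integral_mul_eval_cubeLaw hαβ (measurable_scaledKernel hK.measurable h (x α))
    (measurable_cell N J)
  rw [hK.integral_scaledKernel hh h₁ h₂, integral_cell J.2, one_mul] at this
  rw [← this]
  rfl

omit [IsProbabilityMeasure (densityLaw f)] in
-- There are `N + 1` coefficients of size at most `c₂/(N+1)`, so Cauchy-Schwarz bounds the
-- functional by the `L²` norm of the step function, uniformly in `N` and in the admissible `h`.
lemma abs_sum_kernelCoeff_mul_le (hf : ContinuousOn f (cube d)) (hc₁ : 0 ≤ c₁)
    (hb : ∀ x ∈ cube d, c₁ ≤ f x ∧ f x ≤ c₂) (hc₂ : 0 ≤ c₂) (hK : KernelAssumption K)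
    (hh : 0 < h) (h₁ : h ≤ x α) (h₂ : x α + h ≤ 1) (hαβ : α ≠ β)
    (δ : Fin d × Fin (N + 1) → ℝ) :
    |∑ k, kernelCoeff K f x h N α β k * δ k| ≤
      c₂ * Real.sqrt (((N : ℝ) + 1)⁻¹ * ∑ k, δ k ^ 2) := by
  have hN : (0 : ℝ) < (N : ℝ) + 1 := by positivity
  have e : ∑ k, kernelCoeff K f x h N α β k * δ k =
      ∑ J, kernelCoeff K f x h N α β (β, J) * δ (β, J) := by
    rw [← sum_ite_fst_eq β fun k => kernelCoeff K f x h N α β k * δ k]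
    refine Finset.sum_congr rfl fun k _ => ?_
    split_ifs with hk
    · rfl
    · simp [kernelCoeff, hk]
  rw [e]
  have hle : |∑ J, kernelCoeff K f x h N α β (β, J) * δ (β, J)| ≤
      c₂ * (((N : ℝ) + 1)⁻¹ * ∑ J, |δ (β, J)|) := by
    refine (Finset.abs_sum_le_sum_abs _ _).trans ?_
    rw [← mul_assoc, Finset.mul_sum]
    refine Finset.sum_le_sum fun J _ => ?_
    have := kernelCoeff_mem hf hc₁ hb hK hh h₁ h₂ hαβ J
    rw [abs_mul, abs_of_nonneg this.1]
    exact mul_le_mul_of_nonneg_right this.2 (abs_nonneg _)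
  refine hle.trans (mul_le_mul_of_nonneg_left (Real.le_sqrt_of_sq_le ?_) hc₂)
  have h3 := sq_sum_le_card_mul_sum_sq (s := Finset.univ) (f := fun J : Fin (N + 1) => |δ (β, J)|)
  simp only [Finset.card_univ, Fintype.card_fin, sq_abs] at h3
  have h4 : ∑ J, δ (β, J) ^ 2 ≤ ∑ k, δ k ^ 2 := by
    rw [Fintype.sum_prod_type]
    exact Finset.single_le_sum (f := fun γ => ∑ J, δ (γ, J) ^ 2)
      (fun _ _ => Finset.sum_nonneg fun _ _ => sq_nonneg _) (Finset.mem_univ β)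
  push_cast at h3
  calc (((N : ℝ) + 1)⁻¹ * ∑ J, |δ (β, J)|) ^ 2
      ≤ (((N : ℝ) + 1)⁻¹) ^ 2 * (((N : ℝ) + 1) * ∑ J, δ (β, J) ^ 2) := by
        rw [mul_pow]; gcongr
    _ = ((N : ℝ) + 1)⁻¹ * ∑ J, δ (β, J) ^ 2 := by field_simp
    _ ≤ _ := by gcongr

/-- The spline that represents the kernel-weighted mean of the component `β`. -/
lemma exists_kernel_representer (hf : ContinuousOn f (cube d)) (hc₁ : 0 < c₁)
    (hb : ∀ x ∈ cube d, c₁ ≤ f x ∧ f x ≤ c₂) (hc₂ : 0 ≤ c₂) (hK : KernelAssumption K)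
    (hh : 0 < h) (h₁ : h ≤ x α) (h₂ : x α + h ≤ 1) (hαβ : α ≠ β) (N : ℕ) :
    ∃ u : Fin d × Fin (N + 1) → ℝ,
      (∀ δ : Fin d × Fin (N + 1) → ℝ, ∑ k, ∑ l, u k * δ l * gram f N k l +
        ∑ γ, (∑ k, u k * cellMean f N γ k) * (∑ k, δ k * cellMean f N γ k) =
          ∑ k, kernelCoeff K f x h N α β k * δ k) ∧
      ((N : ℝ) + 1)⁻¹ * ∑ k, u k ^ 2 ≤ (((1 + 2 * c₂) / c₁ + 2) * c₂) ^ 2 ∧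
      ∑ k, ∑ l, u k * u l * gram f N k l + ∑ γ, (∑ k, u k * cellMean f N γ k) ^ 2 ≤
        ((1 + 2 * c₂) / c₁ + 2) * c₂ ^ 2 :=
  exists_representer (by positivity) (by positivity) (sum_sq_le_gram hf hc₁ hb hc₂) _ hc₂
    (abs_sum_kernelCoeff_mul_le hf hc₁.le hb hc₂ hK hh h₁ h₂ hαβ)

lemma sum_abs_sq_le (u : Fin d × Fin (N + 1) → ℝ) :
    (∑ k, |u k|) ^ 2 ≤ d * ((N : ℝ) + 1) * ∑ k, u k ^ 2 := by
  have h3 := sq_sum_le_card_mul_sum_sq (s := Finset.univ)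
    (f := fun k : Fin d × Fin (N + 1) => |u k|)
  simpa only [Finset.card_univ, Fintype.card_prod, Fintype.card_fin, sq_abs, Nat.cast_mul,
    Nat.cast_add, Nat.cast_one] using h3

end Population

/-! ### Rates of the knots and of the bandwidth. -/

section KnotRates

open Topology Asymptotics

/-- The exponent `41/100` exceeds `2/5` by `1/100`, which absorbs the logarithm. -/
lemma KnotAssumption.isBigO_add_one {N : ℕ → ℕ} (hN : KnotAssumption N) :
    (fun n => (N n : ℝ) + 1) =O[atTop] fun n : ℕ => (n : ℝ) ^ (41 / 100 : ℝ) := by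
  obtain ⟨c₁, hc₁, c₂, hc₂, hN⟩ := hN
  have h1 : (fun n : ℕ => (n : ℝ) ^ (2 / 5 : ℝ) * Real.log n) =O[atTop]
      fun n : ℕ => (n : ℝ) ^ (41 / 100 : ℝ) :=
    isBigO_mul_rpow (ν := fun n => n) tendsto_id (isBigO_refl _ _)
      (((isLittleO_log_rpow_atTop (by norm_num : (0 : ℝ) < 1 / 100)).comp_tendsto
        tendsto_natCast_atTop_atTop).isBigO) (by norm_num)
  refine IsBigO.add (IsBigO.trans (IsBigO.of_bound c₂ ?_) h1) ?_
  · filter_upwards [hN] with n hn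
    rw [Real.norm_of_nonneg (by positivity)]
    exact hn.2.trans (mul_le_mul_of_nonneg_left (le_abs_self _) hc₂.le)
  · simpa using isBigO_natCast_rpow (by norm_num : (0 : ℝ) ≤ 41 / 100)

/-- The logarithm in the number of knots makes the approximation error of constant splines
`o(n^{-2/5})` instead of merely `O(n^{-2/5})`. -/
lemma KnotAssumption.inv_isLittleO {N : ℕ → ℕ} (hN : KnotAssumption N) :
    (fun n => ((N n : ℝ) + 1)⁻¹) =o[atTop] fun n : ℕ => (n : ℝ) ^ (-(2 / 5) : ℝ) := by
  obtain ⟨c₁, hc₁, c₂, hc₂, hN⟩ := hN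
  have hlog : Tendsto (fun n : ℕ => (c₁ * Real.log n)⁻¹) atTop (𝓝 0) :=
    ((Real.tendsto_log_atTop.comp tendsto_natCast_atTop_atTop).const_mul_atTop hc₁).inv_tendsto_atTop
  have h1 : (fun n : ℕ => (c₁ * Real.log n)⁻¹ * (n : ℝ) ^ (-(2 / 5) : ℝ)) =o[atTop]
      fun n : ℕ => (n : ℝ) ^ (-(2 / 5) : ℝ) := by
    simpa using ((isLittleO_one_iff ℝ).2 hlog).mul_isBigO
      (isBigO_refl (fun n : ℕ => (n : ℝ) ^ (-(2 / 5) : ℝ)) atTop)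
  refine IsBigO.trans_isLittleO (IsBigO.of_bound 1 ?_) h1
  filter_upwards [hN, eventually_gt_atTop 1] with n hn hn1
  have hn' : (1 : ℝ) < n := by exact_mod_cast hn1
  have hl : 0 < Real.log n := Real.log_pos hn'
  have hp : 0 < (n : ℝ) ^ (2 / 5 : ℝ) := by positivity
  rw [Real.norm_of_nonneg (by positivity), Real.norm_of_nonneg (by positivity), one_mul,
    Real.rpow_neg (by positivity), ← mul_inv]
  refine inv_anti₀ (by positivity) ?_
  nlinarith [hn.1]

lemma KnotAssumption.rpow_isBigO_inv {N : ℕ → ℕ} (hN : KnotAssumption N) :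
    (fun n : ℕ => (n : ℝ) ^ (-(41 / 100) : ℝ)) =O[atTop] fun n => ((N n : ℝ) + 1)⁻¹ := by
  have := hN.isBigO_add_one.inv_rev (Eventually.of_forall fun n h =>
    absurd h (by positivity : (N n : ℝ) + 1 ≠ 0))
  refine this.congr' (Eventually.of_forall fun n => ?_) EventuallyEq.rfl
  simp only [Real.rpow_neg (Nat.cast_nonneg n)]

lemma BandwidthAssumption.isBigO {h : ℕ → ℝ} (hh : BandwidthAssumption h) :
    h =O[atTop] fun n : ℕ => (n : ℝ) ^ (-(1 / 5) : ℝ) := by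
  obtain ⟨c₁, hc₁, c₂, hc₂, hh⟩ := hh
  refine IsBigO.of_bound c₂ ?_
  filter_upwards [hh] with n hn
  have : 0 ≤ (n : ℝ) ^ (-(1 / 5) : ℝ) := by positivity
  rw [Real.norm_of_nonneg (le_trans (by positivity) hn.1), Real.norm_of_nonneg this]
  exact hn.2

lemma BandwidthAssumption.isBigO_inv {h : ℕ → ℝ} (hh : BandwidthAssumption h) :
    (fun n => (h n)⁻¹) =O[atTop] fun n : ℕ => (n : ℝ) ^ (1 / 5 : ℝ) := by
  obtain ⟨c₁, hc₁, c₂, hc₂, hh⟩ := hh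
  refine IsBigO.of_bound c₁⁻¹ ?_
  filter_upwards [hh, eventually_gt_atTop 0] with n hn hn0
  have hn0' : (0 : ℝ) < n := by exact_mod_cast hn0
  have : 0 < (n : ℝ) ^ (-(1 / 5) : ℝ) := by positivity
  have hpos : 0 < h n := lt_of_lt_of_le (by positivity) hn.1
  rw [Real.norm_of_nonneg (by positivity), Real.norm_of_nonneg (by positivity)]
  refine (inv_anti₀ (by positivity) hn.1).trans (le_of_eq ?_)
  rw [mul_inv, Real.rpow_neg hn0'.le, inv_inv]

lemma BandwidthAssumption.sqrt_isBigO {h : ℕ → ℝ} (hh : BandwidthAssumption h) :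
    (fun n : ℕ => Real.sqrt (n * h n)) =O[atTop] fun n : ℕ => (n : ℝ) ^ (2 / 5 : ℝ) := by
  have h1 : (fun n : ℕ => (n : ℝ)) =O[atTop] fun n : ℕ => (n : ℝ) ^ (1 : ℝ) := by
    simpa using isBigO_refl (fun n : ℕ => (n : ℝ)) atTop
  exact isBigO_sqrt_rpow (isBigO_mul_rpow (ν := fun n => n) tendsto_id h1 hh.isBigO le_rfl)
    (by norm_num)

end KnotRates

/-! ### Second moments of kernel weights. -/

section KernelMoments

variable {d : ℕ} {f : (Fin d → ℝ) → ℝ} {c₁ c₂ : ℝ} {K : ℝ → ℝ} {x : Fin d → ℝ} {h : ℝ}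
  {α : Fin d}

/-- The kernel weight in the coordinate `α`, as a function of the predictors. -/
noncomputable def kernelFn (K : ℝ → ℝ) (x : Fin d → ℝ) (h : ℝ) (α : Fin d) (y : Fin d → ℝ) : ℝ :=
  scaledKernel K h (y α - x α)

lemma measurable_kernelFn (hK : Measurable K) (x : Fin d → ℝ) (h : ℝ) (α : Fin d) :
    Measurable (kernelFn K x h α) :=
  (measurable_scaledKernel hK h (x α)).comp (measurable_pi_apply α)

/-- `K_h² ≤ (C/h) K_h`, and `K_h` has integral one under the uniform law. -/
lemma integral_sq_kernelFn_le (hf : ContinuousOn f (cube d)) (hc₁ : 0 ≤ c₁)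
    (hb : ∀ x ∈ cube d, c₁ ≤ f x ∧ f x ≤ c₂) (hc₂ : 0 ≤ c₂) (hK : KernelAssumption K) {C : ℝ}
    (hC : ∀ u, |K u| ≤ C) (hh : 0 < h) (h₁ : h ≤ x α) (h₂ : x α + h ≤ 1) :
    ∫ y, kernelFn K x h α y ^ 2 ∂densityLaw f ≤ c₂ * C * h⁻¹ := by
  have hm := measurable_kernelFn hK.measurable x h α
  have hle : ∀ y, |kernelFn K x h α y| ≤ C / h := fun y => abs_scaledKernel_le hC hh _
  have hi : Integrable (kernelFn K x h α) (cubeLaw d) := integrable_of_abs_le hm hle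
  have hi2 : Integrable (fun y => kernelFn K x h α y ^ 2) (cubeLaw d) :=
    integrable_of_abs_le (hm.pow_const 2) (B := (C / h) ^ 2) fun y => by
      rw [abs_pow]; exact pow_le_pow_left₀ (abs_nonneg _) (hle y) 2
  refine (integral_densityLaw_le hf hc₁ hb hi2 fun y => sq_nonneg _).trans ?_
  rw [mul_assoc]
  refine mul_le_mul_of_nonneg_left ?_ hc₂
  have h1 : ∫ y, kernelFn K x h α y ∂cubeLaw d = 1 := by
    rw [← hK.integral_scaledKernel hh h₁ h₂]
    exact integral_eval_cubeLaw α (measurable_scaledKernel hK.measurable h (x α))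
  calc ∫ y, kernelFn K x h α y ^ 2 ∂cubeLaw d ≤ ∫ y, C / h * kernelFn K x h α y ∂cubeLaw d := by
        refine integral_mono hi2 (hi.const_mul _) fun y => ?_
        have h0 : 0 ≤ kernelFn K x h α y := hK.scaledKernel_nonneg hh _
        have := (le_abs_self _).trans (hle y)
        simp only [sq]
        exact mul_le_mul_of_nonneg_right this h0
    _ = C * h⁻¹ := by rw [integral_const_mul, h1, mul_one, div_eq_mul_inv]

/-- Bounding the sum of squares pointwise, before integrating, is what exploits the disjointness of
the cells. -/
lemma sum_integral_sq_le_integral {E J : Type*} [MeasurableSpace E] {μ : Measure E}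
    [IsFiniteMeasure μ] [Fintype J] {φ : J → E → ℝ} (hφ : ∀ j, Measurable (φ j)) {B : ℝ}
    (hB : ∀ j y, |φ j y| ≤ B) {b : E → ℝ} (hb : Integrable b μ)
    (h : ∀ y, ∑ j, φ j y ^ 2 ≤ b y) : ∑ j, ∫ y, φ j y ^ 2 ∂μ ≤ ∫ y, b y ∂μ := by
  have hi : ∀ j, Integrable (fun y => φ j y ^ 2) μ := fun j =>
    integrable_of_abs_le ((hφ j).pow_const 2) (B := B ^ 2) fun y => by
      rw [abs_pow]; exact pow_le_pow_left₀ (abs_nonneg _) (hB j y) 2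
  rw [← integral_finsetSum _ fun j _ => hi j]
  exact integral_mono (integrable_finsetSum _ fun j _ => hi j) hb h

end KernelMoments

/-! ### Deviations of the sample forms from the population forms. -/

section Deviations

open Topology Asymptotics

variable {Ω : Type*} [MeasurableSpace Ω] {P : Measure Ω} [IsProbabilityMeasure P] {d : ℕ}
  {X : ℕ → Ω → Fin d → ℝ} {ε : ℕ → Ω → ℝ} {s f : (Fin d → ℝ) → ℝ} {m : Fin d → ℝ → ℝ}
  {K : ℝ → ℝ} {h : ℕ → ℝ} {N : ℕ → ℕ} {x : Fin d → ℝ}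

/-- The component `β` of the regression function, extended by zero. -/
noncomputable def compFn (m : Fin d → ℝ → ℝ) (β : Fin d) (y : Fin d → ℝ) : ℝ :=
  (Set.Icc (0 : ℝ) 1).indicator (m β) (y β)

lemma measurable_compFn (hm : ∀ β, ContDiffOn ℝ 2 (m β) (Set.Icc 0 1)) (β : Fin d) :
    Measurable (compFn m β) :=
  (measurable_indicator_of_continuousOn (hm β).continuousOn measurableSet_Icc).comp
    (measurable_pi_apply β)

lemma exists_abs_compFn_le (hm : ∀ β, ContDiffOn ℝ 2 (m β) (Set.Icc 0 1)) (β : Fin d) :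
    ∃ M, 0 ≤ M ∧ ∀ y, |compFn m β y| ≤ M := by
  obtain ⟨M, hM⟩ := isCompact_Icc.exists_bound_of_continuousOn (hm β).continuousOn
  refine ⟨|M|, abs_nonneg M, fun y => ?_⟩
  unfold compFn
  by_cases hy : y β ∈ Set.Icc (0 : ℝ) 1
  · rw [Set.indicator_of_mem hy]; exact (hM _ hy).trans (le_abs_self M)
  · rw [Set.indicator_of_notMem hy]; simp

/-- Piecewise constant splines see only this much smoothness; second derivatives matter only for the
bias of the kernel smoother. -/
lemma exists_lipschitz (hm : ∀ β, ContDiffOn ℝ 2 (m β) (Set.Icc 0 1)) :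
    ∃ L, 0 ≤ L ∧ ∀ β, ∀ t ∈ Set.Icc (0 : ℝ) 1, ∀ t' ∈ Set.Icc (0 : ℝ) 1,
      |m β t - m β t'| ≤ L * |t - t'| := by
  have h1 : ∀ β, ∃ L : NNReal, LipschitzOnWith L (m β) (Set.Icc 0 1) := fun β =>
    ((hm β).of_le (by norm_num)).exists_lipschitzOnWith one_ne_zero (convex_Icc 0 1) isCompact_Icc
  choose L hL using h1
  refine ⟨∑ β, (L β : ℝ), Finset.sum_nonneg fun β _ => (L β).2, fun β t ht t' ht' => ?_⟩
  have h2 := (hL β).dist_le_mul t ht t' ht'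
  rw [Real.dist_eq, Real.dist_eq] at h2
  exact h2.trans (mul_le_mul_of_nonneg_right (Finset.single_le_sum (f := fun β => (L β : ℝ))
    (fun β _ => (L β).2) (Finset.mem_univ β)) (abs_nonneg _))

/-- The standard deviation of the noise, extended by zero. -/
noncomputable def sdFn (s : (Fin d → ℝ) → ℝ) : (Fin d → ℝ) → ℝ := (cube d).indicator s

omit [IsProbabilityMeasure P] in
lemma NoiseAssumption.measurable_sdFn (hnoise : NoiseAssumption P X ε s) :
    Measurable (sdFn s) :=
  measurable_indicator_of_continuousOn hnoise.continuous_s measurableSet_cube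

omit [IsProbabilityMeasure P] in
lemma NoiseAssumption.exists_abs_sdFn_le (hnoise : NoiseAssumption P X ε s) :
    ∃ S, 0 ≤ S ∧ ∀ y, |sdFn s y| ≤ S := by
  obtain ⟨S, hS⟩ := exists_bound_of_continuousOn hnoise.continuous_s
  exact ⟨|S|, abs_nonneg S,
    abs_indicator_le (abs_nonneg S) fun y hy => (hS y hy).trans (le_abs_self S)⟩

omit [IsProbabilityMeasure P] in
lemma DensityAssumption.exists_bounds (hd : DensityAssumption P X f) :
    ∃ c₁ c₂ : ℝ, 0 < c₁ ∧ 0 ≤ c₂ ∧ ∀ x ∈ cube d, c₁ ≤ f x ∧ f x ≤ c₂ := by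
  obtain ⟨c₁, hc₁, c₂, hb⟩ := hd.bounds_f
  exact ⟨c₁, |c₂|, hc₁, abs_nonneg _, fun x hx => ⟨(hb x hx).1, (hb x hx).2.trans (le_abs_self _)⟩⟩

lemma eventually_window_bandwidth (hh : BandwidthAssumption h)
    (hx : ∀ α, x α ∈ Set.Ioo (0 : ℝ) 1) (α : Fin d) :
    ∀ᶠ n in atTop, 0 < h n ∧ h n ≤ x α ∧ x α + h n ≤ 1 :=
  hh.tendsto.eventually (eventually_window (hx α))

omit [IsProbabilityMeasure P] in
lemma isBigO_integral_sq_kernelFn (hd : DensityAssumption P X f) (hK : KernelAssumption K)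
    (hh : BandwidthAssumption h) (hx : ∀ α, x α ∈ Set.Ioo (0 : ℝ) 1) (α : Fin d) :
    (fun n => ∫ y, kernelFn K x (h n) α y ^ 2 ∂densityLaw f) =O[atTop]
      fun n : ℕ => (n : ℝ) ^ (1 / 5 : ℝ) := by
  obtain ⟨c₁, c₂, hc₁, hc₂, hb⟩ := hd.exists_bounds
  obtain ⟨C, hC0, hC⟩ := hK.exists_bound
  refine IsBigO.trans (IsBigO.of_bound (c₂ * C) ?_) hh.isBigO_inv
  filter_upwards [eventually_window_bandwidth hh hx α] with n ⟨hn, h₁, h₂⟩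
  rw [Real.norm_of_nonneg (integral_nonneg fun y => sq_nonneg _),
    Real.norm_of_nonneg (by positivity)]
  exact integral_sq_kernelFn_le hd.continuous_f hc₁.le hb hc₂ hK hC hn h₁ h₂

lemma isBigO_card_cells (hN : KnotAssumption N) :
    (fun n => (Fintype.card (Fin d × Fin (N n + 1)) : ℝ)) =O[atTop]
      fun n : ℕ => (n : ℝ) ^ (41 / 100 : ℝ) := by
  simpa using hN.isBigO_add_one.const_mul_left (d : ℝ)

lemma isBigO_const_rpow (c : ℝ) {a : ℝ} (ha : 0 ≤ a) :
    (fun _ : ℕ => c) =O[atTop] fun n : ℕ => (n : ℝ) ^ a :=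
  (isBigO_const_const c one_ne_zero _).trans (by simpa using isBigO_natCast_rpow ha)

lemma isBigO_of_nonneg_of_le {A : ℕ → ℝ} {c a : ℝ} (ha : 0 ≤ a) (h0 : ∀ n, 0 ≤ A n)
    (h : ∀ n, A n ≤ c) : A =O[atTop] fun n : ℕ => (n : ℝ) ^ a :=
  (IsBigO.of_bound 1 (Eventually.of_forall fun n => by
    rw [Real.norm_of_nonneg (h0 n), one_mul]; exact (h n).trans (le_abs_self c))).trans
    (isBigO_const_rpow c ha)

/-- The squares of all products of two cells sum to at most `d²` at each point, so `q = 0` in spite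
of the many entries, and `-1 + 1/100 < -98/100`. -/
lemma isBigO_gram_sub (hX : ∀ i, Measurable (X i)) (hε : ∀ i, Measurable (ε i))
    (hmixing : GeometricMixing P X ε) (hd : DensityAssumption P X f) (hN : KnotAssumption N) :
    (fun p : ℕ × Ω => ∑ k, ∑ l, (avg p.1 (fun i => cellFn (N p.1) k (X i p.2) *
      cellFn (N p.1) l (X i p.2)) - gram f (N p.1) k l) ^ 2) =O[whp P]
      fun p => (p.1 : ℝ) ^ (-(98 / 100) : ℝ) := by
  have := hd.isProbabilityMeasure hX
  have hB : ∀ n (k : (Fin d × Fin (N n + 1)) × (Fin d × Fin (N n + 1))) y,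
      |cellFn (N n) k.1 y * cellFn (N n) k.2 y| ≤ 1 := fun n k y => by
    simpa using abs_mul_le_of_abs_le (abs_cellFn_le_one k.1 y) (abs_cellFn_le_one k.2 y)
  have hm : ∀ n (k : (Fin d × Fin (N n + 1)) × (Fin d × Fin (N n + 1))),
      Measurable fun y => cellFn (N n) k.1 y * cellFn (N n) k.2 y := fun n k =>
    (measurable_cellFn k.1).mul (measurable_cellFn k.2)
  have h := isBigO_sum_sq_avg_sub (J := fun n => (Fin d × Fin (N n + 1)) × (Fin d × Fin (N n + 1)))
    (φ := fun n k y => cellFn (N n) k.1 y * cellFn (N n) k.2 y) (B := fun _ => 1) (q := 0)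
    (D := 82 / 100) (r := -(98 / 100)) hX hε hmixing hd hm hB
    (isBigO_of_nonneg_of_le (c := (d : ℝ) ^ 2) le_rfl
      (fun n => Finset.sum_nonneg fun _ _ => integral_nonneg fun _ => sq_nonneg _) fun n => by
        refine (sum_integral_sq_le_integral (hm n) (hB n) (integrable_const ((d : ℝ) ^ 2))
          fun y => ?_).trans (by simp)
        rw [Fintype.sum_prod_type]
        simp only [mul_pow, cellFn_sq]
        rw [← Finset.sum_mul_sum, ← sq]
        exact pow_le_pow_left₀ (Finset.sum_nonneg fun k _ => cellFn_nonneg k y)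
          (sum_cellFn_le y) 2)
    (by
      have := isBigO_mul_rpow (ν := fun n => n) tendsto_id (isBigO_card_cells (d := d) hN)
        (isBigO_card_cells (d := d) hN) (c := 82 / 100) (by norm_num)
      simpa using this) (by norm_num)
  refine h.congr_left fun p => ?_
  rw [Fintype.sum_prod_type]
  rfl

lemma isBigO_cellMean_sub (hX : ∀ i, Measurable (X i)) (hε : ∀ i, Measurable (ε i))
    (hmixing : GeometricMixing P X ε) (hd : DensityAssumption P X f) (hN : KnotAssumption N) :
    (fun p : ℕ × Ω => ∑ k, (avg p.1 (fun i => cellFn (N p.1) k (X i p.2)) -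
      ∫ y, cellFn (N p.1) k y ∂densityLaw f) ^ 2) =O[whp P]
      fun p => (p.1 : ℝ) ^ (-(98 / 100) : ℝ) := by
  have := hd.isProbabilityMeasure hX
  refine isBigO_sum_sq_avg_sub (J := fun n => Fin d × Fin (N n + 1))
    (φ := fun n k => cellFn (N n) k) (B := fun _ => 1) (q := 0) (D := 41 / 100) hX hε hmixing hd
    (fun n k => measurable_cellFn k) (fun n k => abs_cellFn_le_one k)
    (isBigO_of_nonneg_of_le (c := d) le_rfl
      (fun n => Finset.sum_nonneg fun _ _ => integral_nonneg fun _ => sq_nonneg _) fun n => ?_)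
    (by simpa using isBigO_card_cells (d := d) hN) (by norm_num)
  refine (sum_integral_sq_le_integral (fun k => measurable_cellFn k)
    (fun k => abs_cellFn_le_one k) (integrable_const (d : ℝ)) fun y => ?_).trans (by simp)
  simp only [cellFn_sq]
  exact sum_cellFn_le y

/-- Summed over the disjoint cells, the squares are at most `K_h²`, with mean of order `1/h`; hence
`q = 1/5`. -/
lemma isBigO_kernelCoeff_sub (hX : ∀ i, Measurable (X i)) (hε : ∀ i, Measurable (ε i))
    (hmixing : GeometricMixing P X ε) (hd : DensityAssumption P X f) (hN : KnotAssumption N)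
    (hK : KernelAssumption K) (hh : BandwidthAssumption h) (hx : ∀ α, x α ∈ Set.Ioo (0 : ℝ) 1)
    (α β : Fin d) :
    (fun p : ℕ × Ω => ∑ J, (avg p.1 (fun i => kernelFn K x (h p.1) α (X i p.2) *
      cellFn (N p.1) (β, J) (X i p.2)) - kernelCoeff K f x (h p.1) (N p.1) α β (β, J)) ^ 2)
      =O[whp P] fun p => (p.1 : ℝ) ^ (-(78 / 100) : ℝ) := by
  have := hd.isProbabilityMeasure hX
  obtain ⟨C, hC0, hC⟩ := hK.exists_bound
  have hκ : ∀ n y, |kernelFn K x (h n) α y| ≤ C / |h n| := fun n y =>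
    abs_scaledKernel_le_abs hC _ _
  have hκm := fun n => measurable_kernelFn hK.measurable x (h n) α
  have hm : ∀ n (J : Fin (N n + 1)), Measurable fun y => kernelFn K x (h n) α y *
      cellFn (N n) (β, J) y := fun n J => (hκm n).mul (measurable_cellFn (β, J))
  have hB : ∀ n (J : Fin (N n + 1)) y, |kernelFn K x (h n) α y * cellFn (N n) (β, J) y| ≤
      C / |h n| := fun n J y => by
    simpa using abs_mul_le_of_abs_le (hκ n y) (abs_cellFn_le_one (β, J) y)
  have h := isBigO_sum_sq_avg_sub (J := fun n => Fin (N n + 1))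
    (φ := fun n J y => kernelFn K x (h n) α y * cellFn (N n) (β, J) y)
    (B := fun n => C / |h n|) (q := 1 / 5) (D := 81 / 100) (r := -(78 / 100)) hX hε hmixing hd hm hB
    (IsBigO.trans (IsBigO.of_bound 1 (Eventually.of_forall fun n => by
        rw [one_mul, Real.norm_of_nonneg
          (Finset.sum_nonneg fun _ _ => integral_nonneg fun _ => sq_nonneg _)]
        refine le_trans ?_ (le_abs_self _)
        refine sum_integral_sq_le_integral (hm n) (hB n) (integrable_of_abs_le
          ((hκm n).pow_const 2) (B := (C / |h n|) ^ 2) fun y => ?_) fun y => ?_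
        · rw [abs_pow]; exact pow_le_pow_left₀ (abs_nonneg _) (hκ n y) 2
        · simp only [mul_pow, cellFn_sq]
          rw [← Finset.mul_sum]
          exact mul_le_of_le_one_right (sq_nonneg _) (sum_cell_le_one (N n) (y β))))
      (isBigO_integral_sq_kernelFn hd hK hh hx α))
    (by
      have h1 : (fun n => C / |h n|) =O[atTop] fun n : ℕ => (n : ℝ) ^ (1 / 5 : ℝ) := by
        simpa [div_eq_mul_inv] using (hh.isBigO_inv.norm_left.const_mul_left C)
      have h2 := isBigO_mul_rpow (ν := fun n => n) tendsto_id h1 h1 (c := 2 / 5) (by norm_num)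
      have h3 := isBigO_mul_rpow (ν := fun n => n) tendsto_id hN.isBigO_add_one h2
        (c := 81 / 100) (by norm_num)
      simpa [sq] using h3) (by norm_num)
  refine h.congr_left fun p => ?_
  simp [kernelCoeff, kernelFn]

/-- The deviation of a single sample average from its mean. -/
lemma isBigO_avg_sub (hX : ∀ i, Measurable (X i)) (hε : ∀ i, Measurable (ε i))
    (hmixing : GeometricMixing P X ε) (hd : DensityAssumption P X f)
    {φ : ℕ → (Fin d → ℝ) → ℝ} (hφ : ∀ n, Measurable (φ n)) {B : ℕ → ℝ}
    (hB : ∀ n y, |φ n y| ≤ B n) {q D r : ℝ}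
    (hQ : (fun n => ∫ y, φ n y ^ 2 ∂densityLaw f) =O[atTop] fun n : ℕ => (n : ℝ) ^ q)
    (hD : B =O[atTop] fun n : ℕ => (n : ℝ) ^ D) (hr : q - 1 + 1 / 100 < 2 * r) :
    (fun p : ℕ × Ω => avg p.1 (fun i => φ p.1 (X i p.2)) - ∫ y, φ p.1 y ∂densityLaw f)
      =O[whp P] fun p => (p.1 : ℝ) ^ r := by
  have h := isBigO_sum_sq_avg_sub (J := fun _ => Unit) (φ := fun n _ => φ n) (r := 2 * r)
    hX hε hmixing hd (fun n _ => hφ n) (fun n _ => hB n) (by simpa using hQ)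
    (by simpa [sq] using isBigO_mul_rpow (ν := fun n => n) tendsto_id hD hD (c := D + D) le_rfl) hr
  have h2 := isBigO_sqrt_rpow (c := r) h (by ring)
  simp only [Finset.univ_unique, Finset.sum_singleton, Real.sqrt_sq_eq_abs] at h2
  exact h2.of_abs_left

lemma isBigO_avg_noise (hX : ∀ i, Measurable (X i)) (hε : ∀ i, Measurable (ε i))
    (hnoise : NoiseAssumption P X ε s) (hd : DensityAssumption P X f)
    {φ : ℕ → (Fin d → ℝ) → ℝ} (hφ : ∀ n, Measurable (φ n)) {B : ℕ → ℝ}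
    (hB : ∀ n y, |φ n y| ≤ B n) {q r : ℝ}
    (hQ : (fun n => ∫ y, φ n y ^ 2 ∂densityLaw f) =O[atTop] fun n : ℕ => (n : ℝ) ^ q)
    (hr : q - 1 < 2 * r) :
    (fun p : ℕ × Ω => avg p.1 (fun i => φ p.1 (X i p.2) * (sdFn s (X i p.2) * ε i p.2)))
      =O[whp P] fun p => (p.1 : ℝ) ^ r := by
  have := hd.isProbabilityMeasure hX
  obtain ⟨S, hS0, hS⟩ := hnoise.exists_abs_sdFn_le
  have hBφ : ∀ n (j : Unit) y, |φ n y * sdFn s y| ≤ B n * S := fun n _ y =>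
    abs_mul_le_of_abs_le (hB n y) (hS y)
  have h := isBigO_sum_sq_avg_noise (J := fun _ => Unit) (φ := fun n _ y => φ n y * sdFn s y)
    (r := 2 * r) (q := q) hX hε hnoise hd (fun n _ => (hφ n).mul hnoise.measurable_sdFn) hBφ
    (IsBigO.trans (IsBigO.of_bound (S ^ 2) (Eventually.of_forall fun n => by
      rw [Real.norm_of_nonneg (Finset.sum_nonneg fun _ _ => integral_nonneg fun _ => sq_nonneg _),
        Real.norm_of_nonneg (integral_nonneg fun _ => sq_nonneg _), ← integral_const_mul]
      refine sum_integral_sq_le_integral (fun _ => (hφ n).mul hnoise.measurable_sdFn) (hBφ n)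
        ((integrable_of_abs_le ((hφ n).pow_const 2) (B := B n ^ 2) fun y => ?_).const_mul _)
        fun y => ?_
      · rw [abs_pow]; exact pow_le_pow_left₀ (abs_nonneg _) (hB n y) 2
      · have hsd : sdFn s y ^ 2 ≤ S ^ 2 := by
          rw [← sq_abs]; exact pow_le_pow_left₀ (abs_nonneg _) (hS y) 2
        simpa [mul_pow, mul_comm] using mul_le_mul_of_nonneg_left hsd (sq_nonneg (φ n y)))) hQ) hr
  have h2 := isBigO_sqrt_rpow (c := r) h (by ring)
  simp only [Finset.univ_unique, Finset.sum_singleton, Real.sqrt_sq_eq_abs] at h2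
  simpa only [mul_assoc] using h2.of_abs_left

lemma isBigO_noise_cells (hX : ∀ i, Measurable (X i)) (hε : ∀ i, Measurable (ε i))
    (hnoise : NoiseAssumption P X ε s) (hd : DensityAssumption P X f) :
    (fun p : ℕ × Ω => ∑ k, avg p.1 (fun i => sdFn s (X i p.2) * ε i p.2 *
      cellFn (N p.1) k (X i p.2)) ^ 2) =O[whp P] fun p => (p.1 : ℝ) ^ (-(98 / 100) : ℝ) := by
  have := hd.isProbabilityMeasure hX
  obtain ⟨S, hS0, hS⟩ := hnoise.exists_abs_sdFn_le
  have hB : ∀ n (k : Fin d × Fin (N n + 1)) y, |sdFn s y * cellFn (N n) k y| ≤ S * 1 :=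
    fun n k y => abs_mul_le_of_abs_le (hS y) (abs_cellFn_le_one k y)
  have hm : ∀ n (k : Fin d × Fin (N n + 1)), Measurable fun y => sdFn s y * cellFn (N n) k y :=
    fun n k => hnoise.measurable_sdFn.mul (measurable_cellFn k)
  have h := isBigO_sum_sq_avg_noise (J := fun n => Fin d × Fin (N n + 1))
    (φ := fun n k y => sdFn s y * cellFn (N n) k y) (B := fun _ => S * 1) (q := 0)
    (r := -(98 / 100)) hX hε hnoise hd hm hB
    (isBigO_of_nonneg_of_le (c := S ^ 2 * d) le_rfl
      (fun n => Finset.sum_nonneg fun _ _ => integral_nonneg fun _ => sq_nonneg _) fun n => by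
        refine (sum_integral_sq_le_integral (hm n) (hB n) (integrable_const (S ^ 2 * (d : ℝ)))
          fun y => ?_).trans (by simp)
        simp only [mul_pow, cellFn_sq]
        rw [← Finset.mul_sum, ← sq_abs]
        exact mul_le_mul (pow_le_pow_left₀ (abs_nonneg _) (hS y) 2) (sum_cellFn_le y)
          (Finset.sum_nonneg fun k _ => cellFn_nonneg k y) (sq_nonneg _)) (by norm_num)
  refine h.congr_left fun p => Finset.sum_congr rfl fun k _ => ?_
  congr 2; ext i; ring

/-- The spline of `u` is deterministic with bounded second moment, so `q = 0` again. Using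
`isBigO_gram_sub` and Cauchy-Schwarz instead would cost `√(∑ u²)`, up to `n^{0.205}`; with the
coefficient bound `n^{-0.08}` this yields only `n^{-0.365}`, short of `n^{-2/5}`. -/
lemma isBigO_representer_sub (hX : ∀ i, Measurable (X i)) (hε : ∀ i, Measurable (ε i))
    (hmixing : GeometricMixing P X ε) (hd : DensityAssumption P X f) (hN : KnotAssumption N)
    {u : ∀ n, Fin d × Fin (N n + 1) → ℝ} {C : ℝ}
    (hu : ∀ᶠ n in atTop, ((N n : ℝ) + 1)⁻¹ * ∑ k, u n k ^ 2 ≤ C)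
    (hG : ∀ᶠ n in atTop, ∑ k, ∑ l, u n k * u n l * gram f (N n) k l ≤ C) :
    (fun p : ℕ × Ω => ∑ l, (avg p.1 (fun i => (∑ k, u p.1 k * cellFn (N p.1) k (X i p.2)) *
      cellFn (N p.1) l (X i p.2)) - ∑ k, u p.1 k * gram f (N p.1) k l) ^ 2) =O[whp P]
      fun p => (p.1 : ℝ) ^ (-(98 / 100) : ℝ) := by
  have := hd.isProbabilityMeasure hX
  have hB : ∀ n (l : Fin d × Fin (N n + 1)) y,
      |(∑ k, u n k * cellFn (N n) k y) * cellFn (N n) l y| ≤ ∑ k, |u n k| := fun n l y => by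
    simpa using abs_mul_le_of_abs_le (abs_sum_mul_cellFn_le (u n) y) (abs_cellFn_le_one l y)
  have hm : ∀ n (l : Fin d × Fin (N n + 1)), Measurable fun y =>
      (∑ k, u n k * cellFn (N n) k y) * cellFn (N n) l y := fun n l =>
    (measurable_sum_mul_cellFn (u n)).mul (measurable_cellFn l)
  have h := isBigO_sum_sq_avg_sub (J := fun n => Fin d × Fin (N n + 1))
    (φ := fun n l y => (∑ k, u n k * cellFn (N n) k y) * cellFn (N n) l y)
    (B := fun n => ∑ k, |u n k|) (q := 0) (D := 123 / 100 + 41 / 100) (r := -(98 / 100))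
    hX hε hmixing hd hm hB
    (IsBigO.trans (IsBigO.of_bound (d * C) (by
      filter_upwards [hG] with n hn
      rw [Real.norm_of_nonneg (Finset.sum_nonneg fun _ _ => integral_nonneg fun _ => sq_nonneg _),
        norm_one, mul_one]
      refine (sum_integral_sq_le_integral (hm n) (hB n)
        (b := fun y => d * ((∑ k, u n k * cellFn (N n) k y) * (∑ k, u n k * cellFn (N n) k y)))
        ((integrable_of_abs_le ((measurable_sum_mul_cellFn _).mul (measurable_sum_mul_cellFn _))
          fun y => abs_mul_le_of_abs_le (abs_sum_mul_cellFn_le (u n) y)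
            (abs_sum_mul_cellFn_le (u n) y)).const_mul _) fun y => ?_).trans ?_
      · simp only [mul_pow, cellFn_sq]
        rw [← Finset.mul_sum, mul_comm, ← sq]
        exact mul_le_mul_of_nonneg_right (sum_cellFn_le y) (sq_nonneg _)
      · rw [integral_const_mul, integral_mul_sum_cellFn]
        exact mul_le_mul_of_nonneg_left hn (Nat.cast_nonneg d)))
      (isBigO_const_rpow 1 le_rfl))
    (by
      refine isBigO_mul_rpow (ν := fun n => n) tendsto_id (a := 41 / 100) (b := 123 / 100)
        (isBigO_card_cells hN) ?_ (by norm_num)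
      have h1 := isBigO_mul_rpow (ν := fun n => n) tendsto_id hN.isBigO_add_one
        hN.isBigO_add_one (c := 123 / 100) (by norm_num)
      refine IsBigO.trans (IsBigO.of_bound (d * C) ?_) h1
      filter_upwards [hu] with n hn
      rw [Real.norm_of_nonneg (by positivity), Real.norm_of_nonneg (by positivity)]
      have hpos : (0 : ℝ) < (N n : ℝ) + 1 := by positivity
      rw [inv_mul_le_iff₀ hpos] at hn
      calc _ ≤ _ := sum_abs_sq_le (u n)
        _ ≤ d * ((N n : ℝ) + 1) * (((N n : ℝ) + 1) * C) := by gcongr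
        _ = _ := by ring) (by norm_num)
  refine h.congr_left fun p => Finset.sum_congr rfl fun l _ => ?_
  rw [integral_sum_cellFn_mul]

/-- The noise of the whole pilot fit enters the functional through this single average with a weight
of bounded norm, hence at nearly the parametric rate. -/
lemma isBigO_representer_noise (hX : ∀ i, Measurable (X i)) (hε : ∀ i, Measurable (ε i))
    (hnoise : NoiseAssumption P X ε s) (hd : DensityAssumption P X f)
    {u : ∀ n, Fin d × Fin (N n + 1) → ℝ} {C : ℝ}
    (hG : ∀ᶠ n in atTop, ∑ k, ∑ l, u n k * u n l * gram f (N n) k l ≤ C) :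
    (fun p : ℕ × Ω => avg p.1 (fun i => (∑ k, u p.1 k * cellFn (N p.1) k (X i p.2)) *
      (sdFn s (X i p.2) * ε i p.2))) =O[whp P] fun p => (p.1 : ℝ) ^ (-(49 / 100) : ℝ) := by
  have := hd.isProbabilityMeasure hX
  refine isBigO_avg_noise (φ := fun n y => ∑ k, u n k * cellFn (N n) k y) (q := 0) hX hε hnoise hd
    (fun n => measurable_sum_mul_cellFn (u n)) (fun n => abs_sum_mul_cellFn_le (u n))
    (IsBigO.trans (IsBigO.of_bound C ?_) (isBigO_const_rpow 1 le_rfl)) (by norm_num)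
  filter_upwards [hG] with n hn
  rw [Real.norm_of_nonneg (integral_nonneg fun _ => sq_nonneg _), norm_one, mul_one]
  simpa only [sq, integral_mul_sum_cellFn] using hn

end Deviations

/-! ### Almost sure properties of the data. -/

section DataEvents

variable {Ω : Type*} [MeasurableSpace Ω] {P : Measure Ω} [IsProbabilityMeasure P] {d : ℕ}
  {X : ℕ → Ω → Fin d → ℝ} {ε Y : ℕ → Ω → ℝ} {s f : (Fin d → ℝ) → ℝ} {m : Fin d → ℝ → ℝ}
  {c : ℝ}

omit [IsProbabilityMeasure P] in
-- The half-open cells miss the right endpoint, which is a null set for each coordinate.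
lemma DensityAssumption.ae_mem_Ico (hd : DensityAssumption P X f) (hX : ∀ i, Measurable (X i)) :
    ∀ᵐ ω ∂P, ∀ i α, X i ω α ∈ Set.Ico (0 : ℝ) 1 := by
  rw [ae_all_iff]
  intro i
  rw [ae_all_iff]
  intro α
  have h1 : ∀ᵐ t ∂unitLaw, t ∈ Set.Ico (0 : ℝ) 1 := by
    have h2 : ∀ᵐ t ∂unitLaw, t ≠ 1 := by
      rw [ae_iff]
      simp [unitLaw]
    filter_upwards [ae_mem_unit, h2] with t ht ht1
    exact ⟨ht.1, lt_of_le_of_ne ht.2 ht1⟩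
  have h2 := ae_densityLaw_of_ae (f := f)
    ((measurePreserving_eval_cubeLaw α).quasiMeasurePreserving.ae h1)
  rw [← hd.law i] at h2
  exact ae_of_ae_map (hX i).aemeasurable h2

lemma compFn_eq {β : Fin d} {y : Fin d → ℝ} (hy : y β ∈ Set.Ico (0 : ℝ) 1) :
    compFn m β y = m β (y β) := Set.indicator_of_mem (Set.Ico_subset_Icc_self hy) _

lemma sdFn_eq {y : Fin d → ℝ} (hy : ∀ α, y α ∈ Set.Ico (0 : ℝ) 1) : sdFn s y = s y :=
  Set.indicator_of_mem (show y ∈ cube d from fun α => Set.Ico_subset_Icc_self (hy α)) _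

omit [IsProbabilityMeasure P] in
/-- The model equation holds with all the functions extended by zero. -/
lemma ae_model (hmodel : AdditiveModel P X ε Y c m s) (hd : DensityAssumption P X f) :
    ∀ᵐ ω ∂P, ∀ i, (∀ α, X i ω α ∈ Set.Ico (0 : ℝ) 1) ∧
      Y i ω = c + ∑ β, compFn m β (X i ω) + sdFn s (X i ω) * ε i ω := by
  filter_upwards [hd.ae_mem_Ico hmodel.measurable_X, ae_all_iff.2 hmodel.model] with ω h1 h2 i
  refine ⟨h1 i, ?_⟩
  rw [h2 i, additive, sdFn_eq (h1 i)]
  simp only [compFn_eq (h1 i _)]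

omit [IsProbabilityMeasure P] in
lemma integral_compFn (hmodel : AdditiveModel P X ε Y c m s) (hd : DensityAssumption P X f)
    (β : Fin d) : ∫ y, compFn m β y ∂densityLaw f = 0 := by
  rw [← hd.integral_comp hmodel.measurable_X (measurable_compFn hmodel.smooth β) 0,
    ← hmodel.centered 0 β]
  refine integral_congr_ae ?_
  filter_upwards [hd.ae_mem_Ico hmodel.measurable_X] with ω hω
  exact compFn_eq (hω 0 β)

end DataEvents

/-! ### The pilot fit relative to the interpolation at the knots. -/

section LeastSquaresCoefficients

variable {d N n : ℕ} {ν : Measure (Fin d → ℝ)} {X : ℕ → Fin d → ℝ} {Y e : ℕ → ℝ} {l₀ c L : ℝ}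
  {l : Fin d → Fin N → ℝ} {m : Fin d → ℝ → ℝ}

/-- The interpolation of the component `γ` of the regression function at the knots. -/
noncomputable def knotFn (m : Fin d → ℝ → ℝ) (N : ℕ) (γ : Fin d) (y : Fin d → ℝ) : ℝ :=
  ∑ J : Fin (N + 1), m γ ((J : ℕ) * ((N : ℝ) + 1)⁻¹) * cell N J (y γ)

/-- The sample version of `cellMean`. -/
noncomputable def empCellMean (X : ℕ → Fin d → ℝ) (N n : ℕ) (γ : Fin d) (k : Fin d × Fin (N + 1)) :
    ℝ := if k.1 = γ then avg n fun i => cellFn N k (X i) else 0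

lemma abs_knotFn_sub_le (hL : ∀ β, ∀ t ∈ Set.Icc (0 : ℝ) 1, ∀ t' ∈ Set.Icc (0 : ℝ) 1,
    |m β t - m β t'| ≤ L * |t - t'|) (hL0 : 0 ≤ L) (γ : Fin d) {y : Fin d → ℝ}
    (hy : y γ ∈ Set.Ico (0 : ℝ) 1) :
    |knotFn m N γ y - compFn m γ y| ≤ L * ((N : ℝ) + 1)⁻¹ := by
  have hN : (0 : ℝ) < (N : ℝ) + 1 := by positivity
  rw [compFn_eq hy, knotFn,
    sum_mul_cell (fun J : Fin (N + 1) => m γ ((J : ℕ) * ((N : ℝ) + 1)⁻¹)) hy]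
  have h0 : 0 ≤ y γ * ((N : ℝ) + 1) := mul_nonneg hy.1 hN.le
  have h1 := Nat.floor_le h0
  have h2 := Nat.lt_floor_add_one (y γ * ((N : ℝ) + 1))
  set J : ℕ := ⌊y γ * ((N : ℝ) + 1)⌋₊
  have e1 : (J : ℝ) * ((N : ℝ) + 1)⁻¹ ≤ y γ := by
    rw [← div_eq_mul_inv, div_le_iff₀ hN]; exact h1
  have e2 : y γ - J * ((N : ℝ) + 1)⁻¹ ≤ ((N : ℝ) + 1)⁻¹ := by
    have : y γ < (J + 1) * ((N : ℝ) + 1)⁻¹ := by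
      rw [← div_eq_mul_inv, lt_div_iff₀ hN]; exact h2
    linarith
  refine (hL γ _ ⟨by positivity, e1.trans hy.2.le⟩ _ (Set.Ico_subset_Icc_self hy)).trans ?_
  refine mul_le_mul_of_nonneg_left ?_ hL0
  rw [abs_sub_comm, abs_of_nonneg (by linarith)]
  exact e2

lemma sum_mul_empCellMean (δ : Fin d × Fin (N + 1) → ℝ) (γ : Fin d) :
    ∑ k, δ k * empCellMean X N n γ k =
      avg n fun i => ∑ J, δ (γ, J) * cell N J (X i γ) := by
  simp only [empCellMean, mul_ite, mul_zero]
  rw [sum_ite_fst_eq γ fun k => δ k * avg n fun i => cellFn N k (X i), avg_sum]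
  exact Finset.sum_congr rfl fun J _ => (avg_const_mul _).symm

/-- The coefficients of the spline estimator relative to the interpolation of the regression
function. -/
lemma IsLeastSquares.exists_coeff (hls : IsLeastSquares ν N n X Y l₀ l) (hn : 0 < n)
    (hpos : ∀ α, ∀ J < N + 1, 0 < theoNorm ν α (cell N J))
    (hpos' : ∀ α J, theoNorm ν α (splineb ν N α J) ≠ 0)
    (hL : ∀ β, ∀ t ∈ Set.Icc (0 : ℝ) 1, ∀ t' ∈ Set.Icc (0 : ℝ) 1,
      |m β t - m β t'| ≤ L * |t - t'|) (hL0 : 0 ≤ L)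
    (hdata : ∀ i, (∀ α, X i α ∈ Set.Ico (0 : ℝ) 1) ∧ Y i = c + ∑ β, compFn m β (X i) + e i) :
    ∃ (δ : Fin d × Fin (N + 1) → ℝ) (ρ : ℕ → ℝ),
      (∀ i < n, ∀ γ, pilot ν N n X l γ (X i γ) =
        ∑ J, δ (γ, J) * cell N J (X i γ) + knotFn m N γ (X i)) ∧
      (∀ γ, ∑ k, δ k * empCellMean X N n γ k = - avg n fun i => knotFn m N γ (X i)) ∧
      (∀ k, avg n (fun i => (ρ i + e i - ∑ l, δ l * cellFn N l (X i)) * cellFn N k (X i)) = 0) ∧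
      ∀ i < n, |ρ i| ≤ |sampleMean n Y - c| + d * (L * ((N : ℝ) + 1)⁻¹) := by
  obtain ⟨a, h1, h2, h3⟩ := hls.exists_pilot_eq hn (fun i _ => (hdata i).1) hpos hpos'
  -- After this subtraction the responses are the noise plus an error `ρ` made of the error of the
  -- sample mean and the interpolation errors, which is uniformly small at the data.
  set δ : Fin d × Fin (N + 1) → ℝ := fun k => a k - m k.1 ((k.2 : ℕ) * ((N : ℝ) + 1)⁻¹) with hδ
  have hsplit : ∀ i γ, ∑ J, a (γ, J) * cell N J (X i γ) =
      ∑ J, δ (γ, J) * cell N J (X i γ) + knotFn m N γ (X i) := by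
    intro i γ
    rw [knotFn, ← Finset.sum_add_distrib]
    refine Finset.sum_congr rfl fun J _ => ?_
    simp only [hδ]; ring
  refine ⟨δ, fun i => (c - sampleMean n Y) + ∑ γ, (compFn m γ (X i) - knotFn m N γ (X i)),
    fun i hi γ => by rw [h1 i hi γ, hsplit], fun γ => ?_, fun k => ?_, fun i _ => ?_⟩
  · rw [sum_mul_empCellMean, eq_neg_iff_add_eq_zero, ← avg_add]
    simp only [← hsplit]
    rw [avg, h2 γ, mul_zero]
  · rw [avg, ← mul_zero (n : ℝ)⁻¹, ← h3 k]
    congr 1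
    refine Finset.sum_congr rfl fun i _ => ?_
    rw [sum_mul_cellFn, (hdata i).2]
    simp only [hsplit, Finset.sum_sub_distrib, Finset.sum_add_distrib, cellFn]
    ring
  · refine (abs_add_le _ _).trans (add_le_add (abs_sub_comm _ _).le ?_)
    refine (Finset.abs_sum_le_sum_abs _ _).trans ?_
    calc _ ≤ ∑ _γ : Fin d, L * ((N : ℝ) + 1)⁻¹ := Finset.sum_le_sum fun γ _ => by
          rw [abs_sub_comm]; exact abs_knotFn_sub_le hL hL0 γ ((hdata i).1 γ)
      _ = _ := by simp

end LeastSquaresCoefficients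

/-! ### Ingredients of the oracle smoother. -/

section SingleAverages

open Topology Asymptotics

variable {Ω : Type*} [MeasurableSpace Ω] {P : Measure Ω} [IsProbabilityMeasure P] {d : ℕ}
  {X : ℕ → Ω → Fin d → ℝ} {ε Y : ℕ → Ω → ℝ} {s f : (Fin d → ℝ) → ℝ} {m : Fin d → ℝ → ℝ}
  {K : ℝ → ℝ} {h : ℕ → ℝ} {N : ℕ → ℕ} {x : Fin d → ℝ} {c : ℝ}

lemma isBigO_avg_compFn (hmodel : AdditiveModel P X ε Y c m s) (hmixing : GeometricMixing P X ε)
    (hd : DensityAssumption P X f) (β : Fin d) :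
    (fun p : ℕ × Ω => avg p.1 fun i => compFn m β (X i p.2)) =O[whp P]
      fun p => (p.1 : ℝ) ^ (-(49 / 100) : ℝ) := by
  obtain ⟨M, hM0, hM⟩ := exists_abs_compFn_le hmodel.smooth β
  have h1 := isBigO_avg_sub hmodel.measurable_X hmodel.measurable_ε hmixing hd
    (φ := fun _ => compFn m β) (B := fun _ => M) (q := 0) (D := 0) (r := -(49 / 100))
    (fun _ => measurable_compFn hmodel.smooth β) (fun _ => hM) (isBigO_const_rpow _ le_rfl)
    (isBigO_const_rpow _ le_rfl) (by norm_num)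
  simpa only [integral_compFn hmodel hd, sub_zero] using h1

lemma isBigO_sampleMean_sub (hmodel : AdditiveModel P X ε Y c m s)
    (hmixing : GeometricMixing P X ε) (hnoise : NoiseAssumption P X ε s)
    (hd : DensityAssumption P X f) :
    (fun p : ℕ × Ω => sampleMean p.1 (fun i => Y i p.2) - c) =O[whp P]
      fun p => (p.1 : ℝ) ^ (-(49 / 100) : ℝ) := by
  have h1 := isBigO_avg_noise hmodel.measurable_X hmodel.measurable_ε hnoise hd
    (φ := fun _ _ => 1) (B := fun _ => 1) (q := 0) (r := -(49 / 100)) (fun _ => measurable_const)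
    (fun _ _ => by simp) (isBigO_const_rpow _ le_rfl) (by norm_num)
  have h2 : (fun p : ℕ × Ω => ∑ β, avg p.1 fun i => compFn m β (X i p.2)) =O[whp P]
      fun p => (p.1 : ℝ) ^ (-(49 / 100) : ℝ) :=
    IsBigO.fun_sum fun β _ => isBigO_avg_compFn hmodel hmixing hd β
  refine (h2.add h1).congr' ?_ EventuallyEq.rfl
  filter_upwards [eventually_whp_of_ae fun _ => ae_model hmodel hd,
    tendsto_fst_whp.eventually (eventually_gt_atTop 0)] with p hp hn
  rw [← avg_sum, ← avg_add, eq_sub_iff_add_eq, ← avg_const hn c, ← avg_add]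
  refine avg_congr fun i _ => ?_
  rw [(hp i).2]; ring

omit [IsProbabilityMeasure P] in
lemma isBigO_kernel_integral_sub (hd : DensityAssumption P X f)
    (hK : KernelAssumption K) (hh : BandwidthAssumption h) (hx : ∀ α, x α ∈ Set.Ioo (0 : ℝ) 1) (α : Fin d) :
    (fun n => ∫ y, kernelFn K x (h n) α y ∂densityLaw f - marginalDensity f α (x α)) =O[atTop]
      fun n : ℕ => (n : ℝ) ^ (-(1 / 5) : ℝ) := by
  obtain ⟨c₁, c₂, hc₁, hc₂, hb⟩ := hd.exists_bounds
  obtain ⟨C, hC0, hC⟩ := hK.exists_bound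
  have h1 := ((hK.density_isBigO (hd.smooth_marginal α) (hx α)).comp_tendsto hh.tendsto).trans
    hh.isBigO
  refine h1.congr_left fun n => ?_
  simp only [Function.comp_apply]
  congr 1
  exact (integral_eval_densityLaw hd.continuous_f (fun x hx => hc₁.le.trans (hb x hx).1) α
    (φ := fun t => scaledKernel K (h n) (t - x α)) (integrable_of_abs_le ((measurable_scaledKernel hK.measurable (h n) (x α)).comp
      (measurable_pi_apply α)) fun y => abs_scaledKernel_le_abs hC _ _)).symm

/-- The bias, bounded by `h`, sets the rate; the random deviation is smaller. This suffices because
the error of the denominator only multiplies terms that are already close to `n^{-2/5}`. -/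
lemma isBigO_density_estimator (hmodel : AdditiveModel P X ε Y c m s)
    (hmixing : GeometricMixing P X ε) (hd : DensityAssumption P X f)
    (hK : KernelAssumption K) (hh : BandwidthAssumption h) (hx : ∀ α, x α ∈ Set.Ioo (0 : ℝ) 1)
    (α : Fin d) :
    (fun p : ℕ × Ω => avg p.1 (fun i => kernelFn K x (h p.1) α (X i p.2)) -
      marginalDensity f α (x α)) =O[whp P] fun p => (p.1 : ℝ) ^ (-(1 / 5) : ℝ) := by
  obtain ⟨C, hC0, hC⟩ := hK.exists_bound
  have hB : (fun n => C / |h n|) =O[atTop] fun n : ℕ => (n : ℝ) ^ (1 / 5 : ℝ) := by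
    simpa [div_eq_mul_inv] using (hh.isBigO_inv.norm_left.const_mul_left C)
  have h1 := isBigO_avg_sub hmodel.measurable_X hmodel.measurable_ε hmixing hd
    (φ := fun n => kernelFn K x (h n) α) (r := -(1 / 5))
    (fun n => measurable_kernelFn hK.measurable x (h n) α)
    (fun n y => abs_scaledKernel_le_abs hC _ _) (isBigO_integral_sq_kernelFn hd hK hh hx α) hB
    (by norm_num)
  have h2 := (isBigO_kernel_integral_sub hd hK hh hx α).comp_tendsto
    (tendsto_fst_whp (P := P))
  refine (h1.add h2).congr_left fun p => ?_
  simp only [Function.comp_apply]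
  ring

lemma isBigO_kernel_noise (hmodel : AdditiveModel P X ε Y c m s)
    (hnoise : NoiseAssumption P X ε s) (hd : DensityAssumption P X f)
    (hK : KernelAssumption K) (hh : BandwidthAssumption h) (hx : ∀ α, x α ∈ Set.Ioo (0 : ℝ) 1)
    (α : Fin d) :
    (fun p : ℕ × Ω => avg p.1 (fun i => kernelFn K x (h p.1) α (X i p.2) *
      (sdFn s (X i p.2) * ε i p.2))) =O[whp P] fun p => (p.1 : ℝ) ^ (-(39 / 100) : ℝ) := by
  obtain ⟨C, hC0, hC⟩ := hK.exists_bound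
  exact isBigO_avg_noise hmodel.measurable_X hmodel.measurable_ε hnoise hd
    (φ := fun n => kernelFn K x (h n) α)
    (fun n => measurable_kernelFn hK.measurable x (h n) α)
    (fun n y => abs_scaledKernel_le_abs hC _ _) (isBigO_integral_sq_kernelFn hd hK hh hx α)
    (by norm_num)

/-- The bias of the oracle smoother. -/
lemma isLittleO_kernel_bias (hmodel : AdditiveModel P X ε Y c m s)
    (hmixing : GeometricMixing P X ε) (hd : DensityAssumption P X f)
    (hK : KernelAssumption K) (hh : BandwidthAssumption h) (hx : ∀ α, x α ∈ Set.Ioo (0 : ℝ) 1)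
    (α : Fin d) :
    (fun p : ℕ × Ω => avg p.1 (fun i => kernelFn K x (h p.1) α (X i p.2) *
        (compFn m α (X i p.2) - m α (x α))) -
      (∫ u, u ^ 2 * K u) *
        (iteratedDerivWithin 2 (m α) (Set.Icc 0 1) (x α) * marginalDensity f α (x α) / 2
          + derivWithin (m α) (Set.Icc 0 1) (x α) *
            derivWithin (marginalDensity f α) (Set.Icc 0 1) (x α)) * h p.1 ^ 2) =o[whp P]
      fun p => (p.1 : ℝ) ^ (-(2 / 5) : ℝ) := by
  obtain ⟨C, hC0, hC⟩ := hK.exists_bound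
  obtain ⟨M, hM0, hM⟩ := exists_abs_compFn_le hmodel.smooth α
  obtain ⟨L, hL0, hL⟩ := exists_lipschitz hmodel.smooth
  obtain ⟨c₁, c₂, hc₁, hc₂, hb⟩ := hd.exists_bounds
  have := hd.isProbabilityMeasure hmodel.measurable_X
  have hm : ∀ n, Measurable fun y => kernelFn K x (h n) α y * (compFn m α y - m α (x α)) :=
    fun n => (measurable_kernelFn hK.measurable x (h n) α).mul
      ((measurable_compFn hmodel.smooth α).sub_const _)
  have hBd : ∀ n y, |kernelFn K x (h n) α y * (compFn m α y - m α (x α))| ≤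
      C / |h n| * (M + |m α (x α)|) := fun n y =>
    abs_mul_le_of_abs_le (abs_scaledKernel_le_abs hC _ _)
      ((abs_sub _ _).trans (add_le_add (hM y) le_rfl))
  have hh2 := isBigO_mul_rpow (ν := fun n => n) tendsto_id hh.isBigO hh.isBigO
    (c := -(2 / 5)) (by norm_num)
  have hD : (fun n => C / |h n| * (M + |m α (x α)|)) =O[atTop]
      fun n : ℕ => (n : ℝ) ^ (1 / 5 : ℝ) := by
    have h1 := (hh.isBigO_inv.norm_left.const_mul_left (C * (M + |m α (x α)|)))
    refine h1.congr_left fun n => ?_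
    rw [norm_inv, Real.norm_eq_abs]; ring
  -- Inside the window the increment of `m α` is at most `L h`, so the second moment is of order `h²
  -- / h`, that is `n^{-1/5}`, and the deviation of the average is `O(n^{-59/100})`.
  have hQ : (fun n => ∫ y, (kernelFn K x (h n) α y * (compFn m α y - m α (x α))) ^ 2
      ∂densityLaw f) =O[atTop] fun n : ℕ => (n : ℝ) ^ (-(1 / 5) : ℝ) := by
    refine IsBigO.trans (IsBigO.of_bound (L ^ 2) ?_) (isBigO_mul_rpow (ν := fun n => n)
      tendsto_id hh2 (isBigO_integral_sq_kernelFn hd hK hh hx α) (by norm_num))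
    filter_upwards [eventually_window_bandwidth hh hx α] with n ⟨hn, h₁, h₂⟩
    rw [Real.norm_of_nonneg (integral_nonneg fun _ => sq_nonneg _), Real.norm_of_nonneg
      (mul_nonneg (mul_self_nonneg _) (integral_nonneg fun _ => sq_nonneg _)),
      ← integral_const_mul, ← integral_const_mul]
    have hi2 : Integrable (fun y => kernelFn K x (h n) α y ^ 2) (densityLaw f) :=
      integrable_of_abs_le ((measurable_kernelFn hK.measurable x (h n) α).pow_const 2)
        (B := (C / |h n|) ^ 2) fun y => by
          rw [abs_pow]
          exact pow_le_pow_left₀ (abs_nonneg _) (abs_scaledKernel_le_abs hC _ _) 2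
    refine integral_mono (integrable_of_abs_le ((hm n).pow_const 2)
      (B := (C / |h n| * (M + |m α (x α)|)) ^ 2) fun y => by
        rw [abs_pow]; exact pow_le_pow_left₀ (abs_nonneg _) (hBd n y) 2)
      ((hi2.const_mul _).const_mul _) fun y => ?_
    simp only [mul_pow]
    by_cases hy : |y α - x α| ≤ h n
    · obtain ⟨hy1, hy2⟩ := abs_le.1 hy
      have hmem : y α ∈ Set.Icc (0 : ℝ) 1 := ⟨by linarith, by linarith⟩
      have h3 := hL α (y α) hmem (x α) (Set.Ioo_subset_Icc_self (hx α))
      have h4 : (compFn m α y - m α (x α)) ^ 2 ≤ (L * h n) ^ 2 := by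
        rw [compFn, Set.indicator_of_mem hmem, ← sq_abs]
        exact pow_le_pow_left₀ (abs_nonneg _)
          (h3.trans (mul_le_mul_of_nonneg_left hy hL0)) 2
      nlinarith [mul_le_mul_of_nonneg_left h4 (sq_nonneg (kernelFn K x (h n) α y))]
    · have h0 : kernelFn K x (h n) α y = 0 := by
        rw [kernelFn, scaledKernel, hK.support, zero_div]
        intro hu
        apply hy
        have h5 := abs_le.2 ⟨hu.1, hu.2⟩
        rwa [abs_div, abs_of_pos hn, div_le_one hn] at h5
      simp [h0]
  have h1 := isBigO_avg_sub hmodel.measurable_X hmodel.measurable_ε hmixing hd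
    (r := -(59 / 100)) hm hBd hQ hD (by norm_num)
  have h2 := ((hK.bias_isLittleO (hmodel.smooth α) (hd.smooth_marginal α) (hx α)).comp_tendsto
    (hh.tendsto.comp (tendsto_fst_whp (P := P)))).trans_isBigO
    ((hh2.comp_tendsto (tendsto_fst_whp (P := P))).congr_left
      (f₂ := fun p : ℕ × Ω => h p.1 ^ 2) fun p => (sq (h p.1)).symm)
  refine ((h1.trans_isLittleO ((isLittleO_natCast_rpow (by norm_num)).comp_tendsto
    tendsto_fst_whp)).add h2).congr_left fun p => ?_
  simp only [Function.comp_apply]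
  have h3 : ∫ y, kernelFn K x (h p.1) α y * (compFn m α y - m α (x α)) ∂densityLaw f =
      ∫ t, scaledKernel K (h p.1) (t - x α) * ((m α t - m α (x α)) * marginalDensity f α t)
        ∂unitLaw := by
    refine (integral_eval_densityLaw (φ := fun t => scaledKernel K (h p.1) (t - x α) *
      ((Set.Icc (0 : ℝ) 1).indicator (m α) t - m α (x α))) hd.continuous_f
      (fun x hx => hc₁.le.trans (hb x hx).1) α
      (integrable_of_abs_le (hm p.1) (hBd p.1))).trans ?_
    refine integral_congr_ae ?_
    filter_upwards [ae_mem_unit] with t ht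
    rw [Set.indicator_of_mem ht]; ring
  rw [h3]
  ring

end SingleAverages

/-! ### Negligibility of the pilot error. -/

section SplineRemainder

open Topology Asymptotics

variable {Ω : Type*} [MeasurableSpace Ω] {P : Measure Ω} [IsProbabilityMeasure P] {d : ℕ}
  {X : ℕ → Ω → Fin d → ℝ} {ε Y : ℕ → Ω → ℝ} {s f : (Fin d → ℝ) → ℝ} {m : Fin d → ℝ → ℝ}
  {K : ℝ → ℝ} {h : ℕ → ℝ} {N : ℕ → ℕ} {x : Fin d → ℝ} {c : ℝ}
  {δ : ∀ p : ℕ × Ω, Fin d × Fin (N p.1 + 1) → ℝ} {ρ : ℕ × Ω → ℕ → ℝ} {b : ℕ × Ω → ℝ}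

lemma isBigO_sum_empCellMean_sub (hX : ∀ i, Measurable (X i)) (hε : ∀ i, Measurable (ε i))
    (hmixing : GeometricMixing P X ε) (hd : DensityAssumption P X f) (hN : KnotAssumption N) :
    (fun p : ℕ × Ω => ∑ γ, ∑ k, (empCellMean (fun i => X i p.2) (N p.1) p.1 γ k -
      cellMean f (N p.1) γ k) ^ 2) =O[whp P] fun p => (p.1 : ℝ) ^ (-(98 / 100) : ℝ) := by
  refine (isBigO_cellMean_sub hX hε hmixing hd hN).congr_left fun p => ?_
  rw [Finset.sum_comm]
  refine Finset.sum_congr rfl fun k _ => ?_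
  rw [Finset.sum_eq_single k.1]
  · simp [empCellMean, cellMean]
  · intro γ _ hγ
    simp [empCellMean, cellMean, hγ.symm]
  · simp

/-- The size of the error of the spline estimator, up to the approximation error of the splines. -/
lemma isBigO_sum_sq_coeff (hX : ∀ i, Measurable (X i)) (hε : ∀ i, Measurable (ε i))
    (hmixing : GeometricMixing P X ε) (hnoise : NoiseAssumption P X ε s)
    (hd : DensityAssumption P X f) (hN : KnotAssumption N)
    (hmean : (fun p => ∑ γ, (∑ k, δ p k *
      empCellMean (fun i => X i p.2) (N p.1) p.1 γ k) ^ 2) =O[whp P]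
        fun p => (p.1 : ℝ) ^ (-(4 / 5) : ℝ))
    (hnormal : ∀ᶠ p in whp P, ∀ k, avg p.1 (fun i => (ρ p i + sdFn s (X i p.2) * ε i p.2 -
      ∑ l, δ p l * cellFn (N p.1) l (X i p.2)) * cellFn (N p.1) k (X i p.2)) = 0)
    (hρ : ∀ᶠ p in whp P, ∀ i < p.1, |ρ p i| ≤ b p)
    (hb : b =O[whp P] fun p => (p.1 : ℝ) ^ (-(2 / 5) : ℝ)) :
    (fun p => ∑ k, δ p k ^ 2) =O[whp P] fun p => (p.1 : ℝ) ^ (-(16 / 100) : ℝ) := by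
  have := hd.isProbabilityMeasure hX
  obtain ⟨c₁, c₂, hc₁, hc₂, hbd⟩ := hd.exists_bounds
  set C : ℝ := (1 + 2 * c₂) / c₁ + 2 with hC
  have hC0 : 0 ≤ C := by positivity
  have hfst := tendsto_fst_whp (P := P)
  have hinv : (fun p : ℕ × Ω => (N p.1 : ℝ) + 1) =O[whp P]
      fun p => (p.1 : ℝ) ^ (41 / 100 : ℝ) := hN.isBigO_add_one.comp_tendsto hfst
  have hgram := isBigO_gram_sub hX hε hmixing hd hN
  have hcell := isBigO_sum_empCellMean_sub hX hε hmixing hd hN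
  have hnoi := isBigO_noise_cells (N := N) hX hε hnoise hd
  -- the sample form is close to the population form
  have hsmall : (fun p : ℕ × Ω => C * (Real.sqrt (∑ k, ∑ l,
      (avg p.1 (fun i => cellFn (N p.1) k (X i p.2) * cellFn (N p.1) l (X i p.2)) -
        gram f (N p.1) k l) ^ 2) + 2 * ∑ γ, ∑ k, (empCellMean (fun i => X i p.2) (N p.1) p.1 γ k -
          cellMean f (N p.1) γ k) ^ 2)) =o[whp P] fun p => ((N p.1 : ℝ) + 1)⁻¹ := by
    -- The Frobenius deviation `n^{-49/100}` must lie below the coercivity constant `1/(N+1)`, which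
    -- is at least of order `n^{-41/100}`.
    have e1 := isBigO_sqrt_rpow (c := -(49 / 100)) hgram (by norm_num)
    have e2 := (hcell.const_mul_left 2).trans
      ((isBigO_natCast_rpow (by norm_num : -(98 / 100 : ℝ) ≤ -(49 / 100))).comp_tendsto hfst)
    exact (((e1.add e2).const_mul_left C).trans_isLittleO ((isLittleO_natCast_rpow
      (by norm_num : -(49 / 100 : ℝ) < -(41 / 100))).comp_tendsto hfst)).trans_isBigO
      (hN.rpow_isBigO_inv.comp_tendsto hfst)
  have hmain : ∀ᶠ p in whp P, ∑ k, δ p k ^ 2 ≤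
      4 * C * (b p ^ 2 + 2 * ∑ γ, (∑ k, δ p k *
        empCellMean (fun i => X i p.2) (N p.1) p.1 γ k) ^ 2) / ((N p.1 : ℝ) + 1)⁻¹ +
      16 * C ^ 2 * (∑ k, avg p.1 (fun i => sdFn s (X i p.2) * ε i p.2 *
        cellFn (N p.1) k (X i p.2)) ^ 2) / (((N p.1 : ℝ) + 1)⁻¹) ^ 2 := by
    filter_upwards [hfst.eventually (eventually_gt_atTop 0), hnormal, hρ,
      hsmall.bound (by norm_num : (0 : ℝ) < 1 / 2)] with p hp h1 h2 h3
    refine sum_sq_le_of_normal_equations (G := gram f (N p.1)) (μ := cellMean f (N p.1))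
      (ψ := fun k i => cellFn (N p.1) k (X i p.2)) hp (by positivity) hC0
      (sum_sq_le_gram hd.continuous_f hc₁ hbd hc₂ (δ p)) h2 h1 ?_
    have h4 := (le_abs_self _).trans h3
    rw [Real.norm_of_nonneg (by positivity)] at h4
    linarith
  have t1 : (fun p => 4 * C * (b p ^ 2 + 2 * ∑ γ, (∑ k, δ p k *
      empCellMean (fun i => X i p.2) (N p.1) p.1 γ k) ^ 2) / ((N p.1 : ℝ) + 1)⁻¹) =O[whp P]
      fun p => (p.1 : ℝ) ^ (-(16 / 100) : ℝ) := by
    have e1 := isBigO_mul_rpow hfst hb hb (c := -(4 / 5)) (by norm_num)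
    have e2 := (e1.add (hmean.const_mul_left 2)).const_mul_left (4 * C)
    have e3 := isBigO_mul_rpow hfst e2 hinv (c := -(16 / 100)) (by norm_num)
    refine e3.congr_left fun p => ?_
    rw [div_inv_eq_mul]; ring
  -- The noise term sets the rate: `-98/100 + 2 * 41/100 = -16/100`. The bias term would give `-4/5
  -- + 41/100`.
  have t2 : (fun p : ℕ × Ω => 16 * C ^ 2 * (∑ k, avg p.1 (fun i => sdFn s (X i p.2) * ε i p.2 *
      cellFn (N p.1) k (X i p.2)) ^ 2) / (((N p.1 : ℝ) + 1)⁻¹) ^ 2) =O[whp P]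
      fun p => (p.1 : ℝ) ^ (-(16 / 100) : ℝ) := by
    have e1 := isBigO_mul_rpow hfst hinv hinv (c := 82 / 100) (by norm_num)
    have e2 := isBigO_mul_rpow hfst (hnoi.const_mul_left (16 * C ^ 2)) e1 (c := -(16 / 100))
      (by norm_num)
    refine e2.congr_left fun p => ?_
    rw [inv_pow, div_inv_eq_mul]; ring
  refine IsBigO.trans (IsBigO.of_bound 1 (hmain.mono fun p hp => ?_)) (t1.add t2)
  rw [Real.norm_of_nonneg (Finset.sum_nonneg fun _ _ => sq_nonneg _), one_mul]
  exact hp.trans (le_abs_self _)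

/-- The kernel-weighted mean of the error of the spline estimator. -/
lemma isLittleO_sum_kernelCoeff (hX : ∀ i, Measurable (X i)) (hε : ∀ i, Measurable (ε i))
    (hmixing : GeometricMixing P X ε) (hnoise : NoiseAssumption P X ε s)
    (hd : DensityAssumption P X f) (hN : KnotAssumption N) (hK : KernelAssumption K)
    (hh : BandwidthAssumption h) (hx : ∀ α, x α ∈ Set.Ioo (0 : ℝ) 1) {α β : Fin d} (hαβ : α ≠ β)
    (hmean : (fun p => Real.sqrt (∑ γ, (∑ k, δ p k *
      empCellMean (fun i => X i p.2) (N p.1) p.1 γ k) ^ 2)) =o[whp P]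
        fun p => (p.1 : ℝ) ^ (-(2 / 5) : ℝ))
    (hnormal : ∀ᶠ p in whp P, ∀ k, avg p.1 (fun i => (ρ p i + sdFn s (X i p.2) * ε i p.2 -
      ∑ l, δ p l * cellFn (N p.1) l (X i p.2)) * cellFn (N p.1) k (X i p.2)) = 0)
    (hρ : ∀ᶠ p in whp P, ∀ i < p.1, |ρ p i| ≤ b p) (hb0 : ∀ p, 0 ≤ b p)
    (hb : b =o[whp P] fun p => (p.1 : ℝ) ^ (-(2 / 5) : ℝ))
    (hδ : (fun p => Real.sqrt (∑ k, δ p k ^ 2)) =O[whp P]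
      fun p => (p.1 : ℝ) ^ (-(8 / 100) : ℝ)) :
    (fun p => ∑ k, kernelCoeff K f x (h p.1) (N p.1) α β k * δ p k) =o[whp P]
      fun p => (p.1 : ℝ) ^ (-(2 / 5) : ℝ) := by
  have := hd.isProbabilityMeasure hX
  obtain ⟨c₁, c₂, hc₁, hc₂, hbd⟩ := hd.exists_bounds
  have hfst := tendsto_fst_whp (P := P)
  set C : ℝ := (1 + 2 * c₂) / c₁ + 2 with hC
  -- Adding one makes `B` at least one, so that a quantity tending to zero is eventually below it
  -- even when `C * c₂ ^ 2` is small.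
  set B : ℝ := C * c₂ ^ 2 + 1 with hB
  have hB1 : 1 ≤ B := by
    have : 0 ≤ C * c₂ ^ 2 := by positivity
    linarith
  have hB0 : 0 ≤ B := by linarith
  -- The representer is available only once the window lies inside `[0,1]`; for the remaining `n`
  -- the value zero is a dummy.
  have hex : ∀ n, ∃ u : Fin d × Fin (N n + 1) → ℝ, (0 < h n ∧ h n ≤ x α ∧ x α + h n ≤ 1) →
      ((∀ δ : Fin d × Fin (N n + 1) → ℝ, ∑ k, ∑ l, u k * δ l * gram f (N n) k l +
        ∑ γ, (∑ k, u k * cellMean f (N n) γ k) * (∑ k, δ k * cellMean f (N n) γ k) =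
          ∑ k, kernelCoeff K f x (h n) (N n) α β k * δ k) ∧
      ((N n : ℝ) + 1)⁻¹ * ∑ k, u k ^ 2 ≤ (C * c₂) ^ 2 ∧
      ∑ k, ∑ l, u k * u l * gram f (N n) k l + ∑ γ, (∑ k, u k * cellMean f (N n) γ k) ^ 2 ≤
        C * c₂ ^ 2) := fun n => by
    by_cases hn : 0 < h n ∧ h n ≤ x α ∧ x α + h n ≤ 1
    · obtain ⟨u, hu⟩ := exists_kernel_representer hd.continuous_f hc₁ hbd hc₂ hK hn.1 hn.2.1
        hn.2.2 hαβ (N n)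
      exact ⟨u, fun _ => hu⟩
    · exact ⟨0, fun h => absurd h hn⟩
  choose u hu using hex
  have hwin := eventually_window_bandwidth hh hx α
  set C' : ℝ := max ((C * c₂) ^ 2) (C * c₂ ^ 2)
  have hu1 : ∀ᶠ n in atTop, ((N n : ℝ) + 1)⁻¹ * ∑ k, u n k ^ 2 ≤ C' :=
    hwin.mono fun n hn => (hu n hn).2.1.trans (le_max_left _ _)
  have hu2 : ∀ᶠ n in atTop, ∑ k, ∑ l, u n k * u n l * gram f (N n) k l ≤ C' :=
    hwin.mono fun n hn => (le_add_of_nonneg_right (Finset.sum_nonneg fun _ _ => sq_nonneg _)).trans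
      ((hu n hn).2.2.trans (le_max_right _ _))
  have hgram := isBigO_sqrt_rpow (c := -(49 / 100)) (isBigO_gram_sub hX hε hmixing hd hN)
    (by norm_num)
  have hcell := isBigO_sqrt_rpow (c := -(49 / 100))
    (isBigO_sum_empCellMean_sub hX hε hmixing hd hN) (by norm_num)
  have hrep := isBigO_sqrt_rpow (c := -(49 / 100))
    (isBigO_representer_sub hX hε hmixing hd hN hu1 hu2) (by norm_num)
  have hrepn := isBigO_representer_noise hX hε hnoise hd hu2
  -- the sample form is close to the population form
  have hsmall : (fun p : ℕ × Ω => (∑ k, u p.1 k ^ 2) * Real.sqrt (∑ k, ∑ l,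
      (avg p.1 (fun i => cellFn (N p.1) k (X i p.2) * cellFn (N p.1) l (X i p.2)) -
        gram f (N p.1) k l) ^ 2)) =o[whp P] fun _ => (1 : ℝ) := by
    have e1 : (fun p : ℕ × Ω => ∑ k, u p.1 k ^ 2) =O[whp P]
        fun p => (p.1 : ℝ) ^ (41 / 100 : ℝ) := by
      refine IsBigO.comp_tendsto (f := fun n => ∑ k, u n k ^ 2) (IsBigO.trans
        (IsBigO.of_bound C' (hu1.mono fun n hn => ?_)) hN.isBigO_add_one) hfst
      have hpos : (0 : ℝ) < (N n : ℝ) + 1 := by positivity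
      rw [Real.norm_of_nonneg (Finset.sum_nonneg fun _ _ => sq_nonneg _),
        Real.norm_of_nonneg hpos.le, mul_comm]
      rwa [inv_mul_le_iff₀ hpos] at hn
    have e2 := isBigO_mul_rpow hfst e1 hgram (c := -(8 / 100)) (by norm_num)
    refine e2.trans_isLittleO ?_
    simpa only [Function.comp_def, Real.rpow_zero] using
      (isLittleO_natCast_rpow (by norm_num : -(8 / 100 : ℝ) < 0)).comp_tendsto hfst
  have hrate : ∀ {A : ℕ × Ω → ℝ} {r : ℝ}, A =O[whp P] (fun p => (p.1 : ℝ) ^ r) → r < -(2 / 5) →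
      A =o[whp P] fun p => (p.1 : ℝ) ^ (-(2 / 5) : ℝ) := fun hA hr =>
    hA.trans_isLittleO ((isLittleO_natCast_rpow hr).comp_tendsto hfst)
  have t1 := hrate (isBigO_mul_rpow hfst hδ hrep le_rfl) (by norm_num)
  have t2 : (fun p => b p * Real.sqrt (2 * B)) =o[whp P]
      fun p => (p.1 : ℝ) ^ (-(2 / 5) : ℝ) := by
    simpa only [mul_comm] using hb.const_mul_left (Real.sqrt (2 * B))
  have t3 := hrate hrepn.abs_left (by norm_num)
  have t4 := (hmean.add (hrate (isBigO_mul_rpow hfst hδ hcell le_rfl) (by norm_num))).const_mul_left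
    (Real.sqrt B)
  refine IsBigO.trans_isLittleO (IsBigO.of_bound 1 ?_) (((t1.add t2).add t3).add t4)
  filter_upwards [hfst.eventually (eventually_gt_atTop 0), hnormal, hρ, hfst.eventually hwin,
    hsmall.bound one_pos] with p hp h1 h2 h3 h4
  obtain ⟨hu3, -, hu5⟩ := hu p.1 h3
  rw [one_mul]
  refine le_trans ?_ (le_abs_self _)
  refine abs_functional_le (G := gram f (N p.1)) (μ := cellMean f (N p.1))
      (ψ := fun k i => cellFn (N p.1) k (X i p.2)) hp hB0 (hu3 (δ p)) (by linarith)
      (sum_gram_nonneg (u p.1)) (hb0 p) h2 h1 ?_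
  rw [one_mul, norm_one] at h4
  exact ((le_abs_self _).trans h4).trans hB1

/-- The spline estimator of the other components affects the kernel smoother only at a smaller
order than the rate of convergence. -/
theorem isLittleO_kernel_pilot (hmodel : AdditiveModel P X ε Y c m s)
    (hmixing : GeometricMixing P X ε) (hnoise : NoiseAssumption P X ε s)
    (hd : DensityAssumption P X f) (hN : KnotAssumption N) (hK : KernelAssumption K)
    (hh : BandwidthAssumption h) (hx : ∀ α, x α ∈ Set.Ioo (0 : ℝ) 1)
    {lam₀ : ℕ → Ω → ℝ} {lam : ∀ n, Ω → Fin d → Fin (N n) → ℝ}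
    (hls : ∀ n, ∀ᵐ ω ∂P, IsLeastSquares (densityLaw f) (N n) n (fun i => X i ω) (fun i => Y i ω)
      (lam₀ n ω) (lam n ω)) {α β : Fin d} (hαβ : α ≠ β) :
    (fun p : ℕ × Ω => avg p.1 fun i => kernelFn K x (h p.1) α (X i p.2) *
      (pilot (densityLaw f) (N p.1) p.1 (fun i => X i p.2) (lam p.1 p.2) β (X i p.2 β) -
        compFn m β (X i p.2))) =o[whp P] fun p => (p.1 : ℝ) ^ (-(2 / 5) : ℝ) := by
  have hX := hmodel.measurable_X
  have hε := hmodel.measurable_ε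
  have := hd.isProbabilityMeasure hX
  obtain ⟨c₁, c₂, hc₁, hc₂, hbd⟩ := hd.exists_bounds
  obtain ⟨L, hL0, hL⟩ := exists_lipschitz hmodel.smooth
  have hfst := tendsto_fst_whp (P := P)
  set b : ℕ × Ω → ℝ := fun p => |sampleMean p.1 (fun i => Y i p.2) - c| +
    d * (L * ((N p.1 : ℝ) + 1)⁻¹) with hbdef
  -- The choice is made separately for each pair `(n, ω)`, with zero off the good event. Nothing is
  -- claimed about measurability in `ω`: the filter `whp` only uses outer measure.
  have hex : ∀ p : ℕ × Ω, ∃ (δ : Fin d × Fin (N p.1 + 1) → ℝ) (ρ : ℕ → ℝ),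
      (0 < p.1 ∧ IsLeastSquares (densityLaw f) (N p.1) p.1 (fun i => X i p.2) (fun i => Y i p.2)
        (lam₀ p.1 p.2) (lam p.1 p.2) ∧ ∀ i, (∀ α, X i p.2 α ∈ Set.Ico (0 : ℝ) 1) ∧
        Y i p.2 = c + ∑ β, compFn m β (X i p.2) + sdFn s (X i p.2) * ε i p.2) →
      (∀ i < p.1, ∀ γ, pilot (densityLaw f) (N p.1) p.1 (fun i => X i p.2) (lam p.1 p.2) γ
        (X i p.2 γ) = ∑ J, δ (γ, J) * cell (N p.1) J (X i p.2 γ) + knotFn m (N p.1) γ (X i p.2)) ∧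
      (∀ γ, ∑ k, δ k * empCellMean (fun i => X i p.2) (N p.1) p.1 γ k =
        - avg p.1 fun i => knotFn m (N p.1) γ (X i p.2)) ∧
      (∀ k, avg p.1 (fun i => (ρ i + sdFn s (X i p.2) * ε i p.2 -
        ∑ l, δ l * cellFn (N p.1) l (X i p.2)) * cellFn (N p.1) k (X i p.2)) = 0) ∧
      ∀ i < p.1, |ρ i| ≤ b p := fun p => by
    by_cases hp : 0 < p.1 ∧ IsLeastSquares (densityLaw f) (N p.1) p.1 (fun i => X i p.2)
        (fun i => Y i p.2) (lam₀ p.1 p.2) (lam p.1 p.2) ∧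
        ∀ i, (∀ α, X i p.2 α ∈ Set.Ico (0 : ℝ) 1) ∧
        Y i p.2 = c + ∑ β, compFn m β (X i p.2) + sdFn s (X i p.2) * ε i p.2
    · obtain ⟨δ, ρ, hδ⟩ := hp.2.1.exists_coeff hp.1
        (fun α J hJ => theoNorm_cell_pos hd.continuous_f hc₁ hbd α hJ)
        (fun α J => (theoNorm_splineb_pos hd.continuous_f hc₁ hbd α J).ne') hL hL0 hp.2.2
      exact ⟨δ, ρ, fun _ => hδ⟩
    · exact ⟨0, 0, fun h => absurd h hp⟩
  choose δ ρ hδρ using hex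
  have hgood : ∀ᶠ p : ℕ × Ω in whp P, 0 < p.1 ∧ IsLeastSquares (densityLaw f) (N p.1) p.1
      (fun i => X i p.2) (fun i => Y i p.2) (lam₀ p.1 p.2) (lam p.1 p.2) ∧
      ∀ i, (∀ α, X i p.2 α ∈ Set.Ico (0 : ℝ) 1) ∧
        Y i p.2 = c + ∑ β, compFn m β (X i p.2) + sdFn s (X i p.2) * ε i p.2 :=
    (hfst.eventually (eventually_gt_atTop 0)).and
      ((eventually_whp_of_ae hls).and (eventually_whp_of_ae fun _ => ae_model hmodel hd))
  have hprop := hgood.mono fun p hp => hδρ p hp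
  have hH : (fun p : ℕ × Ω => ((N p.1 : ℝ) + 1)⁻¹) =o[whp P]
      fun p => (p.1 : ℝ) ^ (-(2 / 5) : ℝ) := hN.inv_isLittleO.comp_tendsto hfst
  have hrate : ∀ {A : ℕ × Ω → ℝ} {r : ℝ}, A =O[whp P] (fun p => (p.1 : ℝ) ^ r) → r < -(2 / 5) →
      A =o[whp P] fun p => (p.1 : ℝ) ^ (-(2 / 5) : ℝ) := fun hA hr =>
    hA.trans_isLittleO ((isLittleO_natCast_rpow hr).comp_tendsto hfst)
  have hb : b =o[whp P] fun p => (p.1 : ℝ) ^ (-(2 / 5) : ℝ) :=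
    ((hrate (isBigO_sampleMean_sub hmodel hmixing hnoise hd) (by norm_num)).abs_left).add
      ((hH.const_mul_left L).const_mul_left _)
  have hb0 : ∀ p, 0 ≤ b p := fun p => by positivity
  -- The interpolation is close to a component of mean zero, so its sample mean is small. By the
  -- empirical centering of the pilot, this controls the sample means of the splines with
  -- coefficients `δ`.
  have hknot : ∀ γ, (fun p : ℕ × Ω => avg p.1 fun i => knotFn m (N p.1) γ (X i p.2)) =o[whp P]
      fun p => (p.1 : ℝ) ^ (-(2 / 5) : ℝ) := fun γ => by
    have e1 : (fun p : ℕ × Ω => avg p.1 fun i => knotFn m (N p.1) γ (X i p.2) -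
        compFn m γ (X i p.2)) =o[whp P] fun p => (p.1 : ℝ) ^ (-(2 / 5) : ℝ) := by
      refine IsBigO.trans_isLittleO (IsBigO.of_bound L ?_) hH
      filter_upwards [hgood] with p hp
      rw [Real.norm_of_nonneg (by positivity : (0 : ℝ) ≤ ((N p.1 : ℝ) + 1)⁻¹)]
      refine abs_avg_le.trans ?_
      rw [← avg_const hp.1 (L * ((N p.1 : ℝ) + 1)⁻¹)]
      exact avg_mono fun i _ => abs_knotFn_sub_le hL hL0 γ ((hp.2.2 i).1 γ)
    refine (e1.add (hrate (isBigO_avg_compFn hmodel hmixing hd γ) (by norm_num))).congr_left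
      fun p => ?_
    rw [← avg_add]; simp
  have hmean2 : (fun p => ∑ γ, (∑ k, δ p k *
      empCellMean (fun i => X i p.2) (N p.1) p.1 γ k) ^ 2) =o[whp P]
        fun p => ((p.1 : ℝ) ^ (-(2 / 5) : ℝ)) ^ 2 := by
    refine IsLittleO.congr' (f₁ := fun p => ∑ γ, (avg p.1 fun i => knotFn m (N p.1) γ
      (X i p.2)) ^ 2) (IsLittleO.fun_sum fun γ _ => (hknot γ).pow two_pos) ?_ EventuallyEq.rfl
    filter_upwards [hprop] with p hp
    exact Finset.sum_congr rfl fun γ _ => by rw [hp.2.1 γ, neg_sq]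
  have hmean : (fun p => Real.sqrt (∑ γ, (∑ k, δ p k *
      empCellMean (fun i => X i p.2) (N p.1) p.1 γ k) ^ 2)) =o[whp P]
        fun p => (p.1 : ℝ) ^ (-(2 / 5) : ℝ) := by
    refine IsLittleO.of_pow (n := 2) (hmean2.congr_left fun p => ?_) two_ne_zero
    rw [Pi.pow_apply, Real.sq_sqrt (Finset.sum_nonneg fun _ _ => sq_nonneg _)]
  have hD := isBigO_sqrt_rpow (c := -(8 / 100)) (isBigO_sum_sq_coeff hX hε hmixing hnoise hd hN
    (hmean2.isBigO.congr_right fun p => by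
      rw [← Real.rpow_natCast, ← Real.rpow_mul (Nat.cast_nonneg _)]; norm_num)
    (hprop.mono fun p hp => hp.2.2.1) (hprop.mono fun p hp => hp.2.2.2) hb.isBigO) (by norm_num)
  have hw := isLittleO_sum_kernelCoeff hX hε hmixing hnoise hd hN hK hh hx hαβ hmean
    (hprop.mono fun p hp => hp.2.2.1) (hprop.mono fun p hp => hp.2.2.2) hb0 hb hD
  have hA3 := isBigO_sqrt_rpow (c := -(39 / 100))
    (isBigO_kernelCoeff_sub hX hε hmixing hd hN hK hh hx α β) (by norm_num)
  have t2 := hrate (isBigO_mul_rpow hfst hD hA3 le_rfl) (by norm_num)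
  have t2' : (fun p : ℕ × Ω => ∑ J, δ p (β, J) * (avg p.1 (fun i =>
      kernelFn K x (h p.1) α (X i p.2) * cellFn (N p.1) (β, J) (X i p.2)) -
        kernelCoeff K f x (h p.1) (N p.1) α β (β, J))) =o[whp P]
      fun p => (p.1 : ℝ) ^ (-(2 / 5) : ℝ) := by
    refine IsBigO.trans_isLittleO (IsBigO.of_bound 1 (Eventually.of_forall fun p => ?_)) t2
    rw [one_mul]
    refine le_trans ?_ (le_abs_self _)
    refine (abs_sum_mul_le_sqrt _ _).trans
      (mul_le_mul_of_nonneg_right (Real.sqrt_le_sqrt ?_) (Real.sqrt_nonneg _))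
    rw [Fintype.sum_prod_type]
    exact Finset.single_le_sum (f := fun γ => ∑ J, δ p (γ, J) ^ 2)
      (fun _ _ => Finset.sum_nonneg fun _ _ => sq_nonneg _) (Finset.mem_univ β)
  have t3 : (fun p : ℕ × Ω => avg p.1 fun i => kernelFn K x (h p.1) α (X i p.2) *
      (knotFn m (N p.1) β (X i p.2) - compFn m β (X i p.2))) =o[whp P]
      fun p => (p.1 : ℝ) ^ (-(2 / 5) : ℝ) := by
    have e1 : (fun p : ℕ × Ω => avg p.1 fun i => kernelFn K x (h p.1) α (X i p.2)) =O[whp P]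
        fun _ => (1 : ℝ) := by
      have e2 := isBigO_density_estimator hmodel hmixing hd hK hh hx α
      have e3 : (fun p : ℕ × Ω => (p.1 : ℝ) ^ (-(1 / 5) : ℝ)) =O[whp P] fun _ => (1 : ℝ) := by
        simpa only [Function.comp_def, Real.rpow_zero] using
          (isBigO_natCast_rpow (by norm_num : -(1 / 5 : ℝ) ≤ 0)).comp_tendsto hfst
      simpa using (e2.trans e3).add
        (isBigO_const_const (marginalDensity f α (x α)) one_ne_zero (whp P))
    have e2 := (hH.const_mul_left L).mul_isBigO e1
    simp only [mul_one] at e2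
    refine IsBigO.trans_isLittleO (IsBigO.of_bound 1 ?_) e2
    filter_upwards [hgood, hfst.eventually (eventually_window_bandwidth hh hx α)] with p hp hw
    rw [one_mul]
    refine le_trans ?_ (le_abs_self _)
    refine abs_avg_le.trans ?_
    rw [← avg_const_mul]
    refine avg_mono fun i _ => ?_
    have h0 : 0 ≤ kernelFn K x (h p.1) α (X i p.2) := hK.scaledKernel_nonneg hw.1 _
    rw [abs_mul, abs_of_nonneg h0, mul_comm]
    exact mul_le_mul_of_nonneg_right (abs_knotFn_sub_le hL hL0 β ((hp.2.2 i).1 β)) h0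
  -- The three parts are the population functional of `δ`, its sampling error, of order at most
  -- `n^{-8/100 - 39/100}`, and the interpolation error.
  refine ((hw.add t2').add t3).congr' ?_ EventuallyEq.rfl
  filter_upwards [hprop] with p hp
  have e1 : ∑ k, kernelCoeff K f x (h p.1) (N p.1) α β k * δ p k =
      ∑ J, δ p (β, J) * kernelCoeff K f x (h p.1) (N p.1) α β (β, J) := by
    rw [← sum_ite_fst_eq β fun k => δ p k * kernelCoeff K f x (h p.1) (N p.1) α β k]
    refine Finset.sum_congr rfl fun k _ => ?_
    split_ifs with hk
    · ring
    · simp [kernelCoeff, hk]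
  rw [e1, ← Finset.sum_add_distrib]
  have e2 : ∀ J : Fin (N p.1 + 1), δ p (β, J) * kernelCoeff K f x (h p.1) (N p.1) α β (β, J) +
      δ p (β, J) * (avg p.1 (fun i => kernelFn K x (h p.1) α (X i p.2) *
        cellFn (N p.1) (β, J) (X i p.2)) - kernelCoeff K f x (h p.1) (N p.1) α β (β, J)) =
      avg p.1 (fun i => δ p (β, J) * (kernelFn K x (h p.1) α (X i p.2) *
        cellFn (N p.1) (β, J) (X i p.2))) := fun J => by
    rw [avg_const_mul]; ring
  simp only [e2]
  rw [← avg_sum, ← avg_add]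
  refine avg_congr fun i hi => ?_
  rw [hp.1 i hi β, add_sub_assoc, mul_add, Finset.mul_sum]
  congr 1
  refine Finset.sum_congr rfl fun J _ => ?_
  simp only [cellFn]; ring

end SplineRemainder

/-! ### Measurability of the estimator. -/

section Measurability

variable {Ω : Type*} [MeasurableSpace Ω] {d N n : ℕ} {ν : Measure (Fin d → ℝ)} {K : ℝ → ℝ}
  {X : ℕ → Ω → Fin d → ℝ} {Y : ℕ → Ω → ℝ} {l : Ω → Fin d → Fin N → ℝ}

lemma measurable_sampleMean (hY : ∀ i, Measurable (Y i)) :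
    Measurable fun ω => sampleMean n fun i => Y i ω :=
  (Finset.measurable_sum _ fun i _ => hY i).const_mul _

lemma measurable_splineComponent (hX : ∀ i, Measurable (X i)) (hl : Measurable l) (γ : Fin d)
    (i : ℕ) : Measurable fun ω => splineComponent ν N (l ω) γ (X i ω γ) :=
  Finset.measurable_sum _ fun J _ =>
    ((measurable_pi_apply J).comp ((measurable_pi_apply γ).comp hl)).mul
      (((measurable_splineb ν γ J).div_const _).comp ((measurable_pi_apply γ).comp (hX i)))

lemma measurable_spbk (hX : ∀ i, Measurable (X i)) (hY : ∀ i, Measurable (Y i))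
    (hl : Measurable l) (hK : Measurable K) (h : ℝ) (x : Fin d → ℝ) :
    Measurable fun ω => spbk ν K h N n (fun i => X i ω) (fun i => Y i ω) (l ω) x := by
  have hpilot : ∀ γ i, Measurable fun ω => pilot ν N n (fun i => X i ω) (l ω) γ (X i ω γ) :=
    fun γ i => (measurable_splineComponent hX hl γ i).sub
      ((Finset.measurable_sum _ fun i _ => measurable_splineComponent hX hl γ i).const_mul _)
  have hκ : ∀ α i, Measurable fun ω => scaledKernel K h (X i ω α - x α) := fun α i =>
    (measurable_scaledKernel hK h (x α)).comp ((measurable_pi_apply α).comp (hX i))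
  refine (measurable_sampleMean hY).add (Finset.measurable_sum _ fun α _ =>
    Measurable.div (Finset.measurable_sum _ fun i _ => (hκ α i).mul ?_)
      (Finset.measurable_sum _ fun i _ => hκ α i))
  exact ((hY i).sub (measurable_sampleMean hY)).sub (Finset.measurable_sum _ fun β _ => hpilot β i)

end Measurability

/-! ### Expansion of the estimation error. -/

section Remainder

open Topology Asymptotics

variable {Ω : Type*} [MeasurableSpace Ω] {P : Measure Ω} [IsProbabilityMeasure P] {d : ℕ}
  {X : ℕ → Ω → Fin d → ℝ} {ε Y : ℕ → Ω → ℝ} {s f : (Fin d → ℝ) → ℝ} {m : Fin d → ℝ → ℝ}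
  {K : ℝ → ℝ} {h : ℕ → ℝ} {N : ℕ → ℕ} {x : Fin d → ℝ} {c : ℝ}

/-- The decomposition of the error of the smoother of the pseudo-responses. -/
lemma spbkComponent_eq {ν : Measure (Fin d → ℝ)} {N n : ℕ} {h : ℝ} {X : ℕ → Fin d → ℝ}
    {Y e : ℕ → ℝ} {l : Fin d → Fin N → ℝ} {α : Fin d} (hn : 0 < n)
    (hY : ∀ i, Y i = c + ∑ β, compFn m β (X i) + e i)
    (h0 : avg n (fun i => kernelFn K x h α (X i)) ≠ 0) :
    spbkComponent ν K h N n X Y l α (x α) - m α (x α) - (c - sampleMean n Y) =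
      (avg n (fun i => kernelFn K x h α (X i) * (compFn m α (X i) - m α (x α))) +
        avg n (fun i => kernelFn K x h α (X i) * e i) -
        ∑ β ∈ Finset.univ.erase α, avg n (fun i => kernelFn K x h α (X i) *
          (pilot ν N n X l β (X i β) - compFn m β (X i)))) /
      avg n (fun i => kernelFn K x h α (X i)) := by
  have hn0 : ((n : ℝ))⁻¹ ≠ 0 := by positivity
  have e1 : spbkComponent ν K h N n X Y l α (x α) =
      avg n (fun i => kernelFn K x h α (X i) * pseudoResponse ν N n X Y l α i) /
        avg n (fun i => kernelFn K x h α (X i)) := by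
    rw [spbkComponent, avg, avg, mul_div_mul_left _ _ hn0]
    rfl
  have e2 : avg n (fun i => kernelFn K x h α (X i) * pseudoResponse ν N n X Y l α i) =
      avg n (fun i => kernelFn K x h α (X i) * (compFn m α (X i) - m α (x α))) +
        avg n (fun i => kernelFn K x h α (X i) * e i) -
        ∑ β ∈ Finset.univ.erase α, avg n (fun i => kernelFn K x h α (X i) *
          (pilot ν N n X l β (X i β) - compFn m β (X i))) +
      (m α (x α) + (c - sampleMean n Y)) * avg n (fun i => kernelFn K x h α (X i)) := by
    rw [← avg_sum, ← avg_const_mul, ← avg_add, ← avg_sub, ← avg_add]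
    refine avg_congr fun i _ => ?_
    rw [pseudoResponse, hY i, ← Finset.add_sum_erase _ _ (Finset.mem_univ α), ← Finset.mul_sum,
      Finset.sum_sub_distrib]
    ring
  rw [e1, e2, add_div, mul_div_cancel_right₀ _ h0]
  ring

/-- The estimation error is the asymptotic bias plus a weighted mean of the noise, up to a
smaller order than the rate of convergence. -/
theorem isLittleO_spbk_sub (hmodel : AdditiveModel P X ε Y c m s)
    (hmixing : GeometricMixing P X ε) (hnoise : NoiseAssumption P X ε s)
    (hd : DensityAssumption P X f) (hN : KnotAssumption N) (hK : KernelAssumption K)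
    (hh : BandwidthAssumption h) (hx : ∀ α, x α ∈ Set.Ioo (0 : ℝ) 1)
    {lam₀ : ℕ → Ω → ℝ} {lam : ∀ n, Ω → Fin d → Fin (N n) → ℝ}
    (hls : ∀ n, ∀ᵐ ω ∂P, IsLeastSquares (densityLaw f) (N n) n (fun i => X i ω) (fun i => Y i ω)
      (lam₀ n ω) (lam n ω)) :
    (fun p : ℕ × Ω => spbk (densityLaw f) K (h p.1) (N p.1) p.1 (fun i => X i p.2)
        (fun i => Y i p.2) (lam p.1 p.2) x - additive c m x - bias K m f x * h p.1 ^ 2 -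
      ∑ α, (marginalDensity f α (x α))⁻¹ * avg p.1 fun i => kernelFn K x (h p.1) α (X i p.2) *
        (sdFn s (X i p.2) * ε i p.2)) =o[whp P] fun p => (p.1 : ℝ) ^ (-(2 / 5) : ℝ) := by
  have hfst := tendsto_fst_whp (P := P)
  obtain ⟨c₁, c₂, hc₁, hc₂, hbd⟩ := hd.exists_bounds
  have hfpos : ∀ α, 0 < marginalDensity f α (x α) := fun α => hc₁.trans_le
    (sliceIntegral_mem hd.continuous_f hbd α (Set.Ioo_subset_Icc_self (hx α))).1
  set g : Fin d → ℝ := fun α => marginalDensity f α (x α) with hg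
  set F : Fin d → ℕ × Ω → ℝ := fun α p =>
    avg p.1 fun i => kernelFn K x (h p.1) α (X i p.2) with hF
  set V : Fin d → ℕ × Ω → ℝ := fun α p => avg p.1 fun i => kernelFn K x (h p.1) α (X i p.2) *
    (sdFn s (X i p.2) * ε i p.2) with hV
  set B : Fin d → ℕ × Ω → ℝ := fun α p => avg p.1 fun i => kernelFn K x (h p.1) α (X i p.2) *
    (compFn m α (X i p.2) - m α (x α)) with hB
  set T : Fin d → ℕ × Ω → ℝ := fun α p => ∑ β ∈ Finset.univ.erase α, avg p.1 fun i =>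
    kernelFn K x (h p.1) α (X i p.2) * (pilot (densityLaw f) (N p.1) p.1 (fun i => X i p.2)
      (lam p.1 p.2) β (X i p.2 β) - compFn m β (X i p.2)) with hT
  set a : Fin d → ℝ := fun α => (∫ u, u ^ 2 * K u) *
    (iteratedDerivWithin 2 (m α) (Set.Icc 0 1) (x α) * g α / 2
      + derivWithin (m α) (Set.Icc 0 1) (x α) *
        derivWithin (marginalDensity f α) (Set.Icc 0 1) (x α)) with ha
  have hrate : ∀ {A : ℕ × Ω → ℝ} {r : ℝ}, A =O[whp P] (fun p => (p.1 : ℝ) ^ r) → r < -(2 / 5) →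
      A =o[whp P] fun p => (p.1 : ℝ) ^ (-(2 / 5) : ℝ) := fun hA hr =>
    hA.trans_isLittleO ((isLittleO_natCast_rpow hr).comp_tendsto hfst)
  have hFO : ∀ α, (fun p => F α p - g α) =O[whp P] fun p => (p.1 : ℝ) ^ (-(1 / 5) : ℝ) :=
    fun α => isBigO_density_estimator hmodel hmixing hd hK hh hx α
  have hFlim : ∀ α, Tendsto (F α) (whp P) (𝓝 (g α)) := fun α => by
    have h1 := (hFO α).trans_tendsto ((tendsto_natCast_rpow_of_neg
      (by norm_num : -(1 / 5 : ℝ) < 0)).comp hfst)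
    simpa using h1.add_const (g α)
  have hF0 : ∀ α, ∀ᶠ p in whp P, F α p ≠ 0 := fun α =>
    (hFlim α).eventually_ne (hfpos α).ne'
  have hFinv : ∀ α, (fun p => (F α p)⁻¹) =O[whp P] fun _ => (1 : ℝ) := fun α =>
    ((hFlim α).inv₀ (hfpos α).ne').isBigO_one ℝ
  -- By the identity `1/F - 1/g = -(F - g)/(g F)`, with `1/F` bounded along the filter because `g`
  -- is positive.
  have hFinv' : ∀ α, (fun p => (F α p)⁻¹ - (g α)⁻¹) =O[whp P]
      fun p => (p.1 : ℝ) ^ (-(1 / 5) : ℝ) := fun α => by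
    have h1 := ((hFinv α).mul (hFO α)).const_mul_left (-(g α)⁻¹)
    simp only [one_mul] at h1
    refine h1.congr' ?_ EventuallyEq.rfl
    filter_upwards [hF0 α] with p hp
    have := (hfpos α).ne'
    have hgα : g α ≠ 0 := this
    field_simp
    ring
  have hh2 : (fun p : ℕ × Ω => h p.1 ^ 2) =O[whp P] fun p => (p.1 : ℝ) ^ (-(2 / 5) : ℝ) := by
    have h1 := hh.isBigO.comp_tendsto hfst
    simpa only [sq, Function.comp_apply] using isBigO_mul_rpow hfst h1 h1 (c := -(2 / 5)) (by norm_num)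
  -- What is left of `(B + V - T) / F` after removing `a h² / g` and `V / g`. Replacing `F` by `g`
  -- costs a factor `n^{-1/5}` on terms of order `n^{-2/5}` and `n^{-39/100}`.
  have hterm : ∀ α, (fun p => (B α p - a α * h p.1 ^ 2) * (F α p)⁻¹ +
      a α * h p.1 ^ 2 * ((F α p)⁻¹ - (g α)⁻¹) - T α p * (F α p)⁻¹ +
      V α p * ((F α p)⁻¹ - (g α)⁻¹)) =o[whp P] fun p => (p.1 : ℝ) ^ (-(2 / 5) : ℝ) := fun α => by
    have e1 : (fun p => (B α p - a α * h p.1 ^ 2) * (F α p)⁻¹) =o[whp P]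
        fun p => (p.1 : ℝ) ^ (-(2 / 5) : ℝ) := by
      simpa only [mul_one] using
        (isLittleO_kernel_bias hmodel hmixing hd hK hh hx α).mul_isBigO (hFinv α)
    have e2 := hrate (isBigO_mul_rpow hfst (hh2.const_mul_left (a α)) (hFinv' α) le_rfl)
      (by norm_num)
    have e3 : (fun p => T α p * (F α p)⁻¹) =o[whp P] fun p => (p.1 : ℝ) ^ (-(2 / 5) : ℝ) := by
      have hTo : T α =o[whp P] fun p => (p.1 : ℝ) ^ (-(2 / 5) : ℝ) :=
        IsLittleO.fun_sum fun β hβ => isLittleO_kernel_pilot hmodel hmixing hnoise hd hN hK hh hx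
          hls (Finset.ne_of_mem_erase hβ).symm
      simpa only [mul_one] using hTo.mul_isBigO (hFinv α)
    have e4 := hrate (isBigO_mul_rpow hfst (isBigO_kernel_noise hmodel hnoise hd hK hh hx α)
      (hFinv' α) le_rfl) (by norm_num)
    exact ((e1.add e2).sub e3).add e4
  -- The factor `1 - d`: the sample mean is added once to the estimator and subtracted once in each
  -- of the `d` smoothed components.
  have hsum := ((hrate (isBigO_sampleMean_sub hmodel hmixing hnoise hd)
    (by norm_num)).const_mul_left (1 - (d : ℝ))).add
      (IsLittleO.fun_sum fun α (_ : α ∈ Finset.univ) => hterm α)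
  refine hsum.congr' ?_ EventuallyEq.rfl
  filter_upwards [hfst.eventually (eventually_gt_atTop 0), eventually_all.2 hF0,
    eventually_whp_of_ae fun _ => ae_model hmodel hd] with p hp h0 hY
  have hcomp : ∀ α, spbkComponent (densityLaw f) K (h p.1) (N p.1) p.1 (fun i => X i p.2)
      (fun i => Y i p.2) (lam p.1 p.2) α (x α) =
      (B α p + V α p - T α p) / F α p + m α (x α) + (c - sampleMean p.1 fun i => Y i p.2) :=
    fun α => by
      rw [← spbkComponent_eq (m := m) (e := fun i => sdFn s (X i p.2) * ε i p.2) hp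
        (fun i => (hY i).2) (h0 α)]
      ring
  have hbias : bias K m f x = ∑ α, a α / g α := rfl
  rw [spbk, additive, hbias]
  simp only [hcomp, Finset.sum_add_distrib, Finset.sum_const, Finset.card_univ, Fintype.card_fin,
    nsmul_eq_mul, Finset.sum_mul]
  have hfin : ∑ α, (B α p + V α p - T α p) / F α p = ∑ α, ((B α p - a α * h p.1 ^ 2) * (F α p)⁻¹ +
      a α * h p.1 ^ 2 * ((F α p)⁻¹ - (g α)⁻¹) - T α p * (F α p)⁻¹ +
      V α p * ((F α p)⁻¹ - (g α)⁻¹)) + ∑ α, a α / g α * h p.1 ^ 2 + ∑ α, (g α)⁻¹ * V α p := by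
    rw [← Finset.sum_add_distrib, ← Finset.sum_add_distrib]
    refine Finset.sum_congr rfl fun α _ => ?_
    simp only [div_eq_mul_inv]
    ring
  rw [hfin]
  simp only [Finset.sum_add_distrib, Finset.sum_sub_distrib]
  ring

end Remainder

end SPBK

/-! ### Conclusion by Slutsky's argument. -/

theorem corollary2p1 {Ω : Type*} [MeasurableSpace Ω] (P : Measure Ω) [IsProbabilityMeasure P]
    (d : ℕ) (X : ℕ → Ω → Fin d → ℝ) (ε Y : ℕ → Ω → ℝ)
    (c : ℝ) (m : Fin d → ℝ → ℝ) (s f : (Fin d → ℝ) → ℝ)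
    (K : ℝ → ℝ) (h : ℕ → ℝ) (N : ℕ → ℕ)
    (hmodel : SPBK.AdditiveModel P X ε Y c m s)
    (hmixing : SPBK.GeometricMixing P X ε)
    (hnoise : SPBK.NoiseAssumption P X ε s)
    (hdensity : SPBK.DensityAssumption P X f)
    (hkernel : SPBK.KernelAssumption K)
    (hbandwidth : SPBK.BandwidthAssumption h)
    (hknots : SPBK.KnotAssumption N)
    -- measurable solutions of the least squares problems, for all sample sizes
    (lam₀ : ℕ → Ω → ℝ) (lam : (n : ℕ) → Ω → Fin d → Fin (N n) → ℝ)
    (hlam₀ : ∀ n, Measurable (lam₀ n)) (hlam : ∀ n, Measurable (lam n))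
    (hls : ∀ n, ∀ᵐ ω ∂P, SPBK.IsLeastSquares (SPBK.densityLaw f) (N n) n
      (fun i => X i ω) (fun i => Y i ω) (lam₀ n ω) (lam n ω))
    (x : Fin d → ℝ) (hx : ∀ α, x α ∈ Set.Ioo (0 : ℝ) 1) :
    TendstoInDistribution
      (fun (n : ℕ) (ω : Ω) =>
        Real.sqrt ((n : ℝ) * h n) *
          (SPBK.spbk (SPBK.densityLaw f) K (h n) (N n) n
              (fun i => X i ω) (fun i => Y i ω) (lam n ω) x
            - SPBK.additive c m x - SPBK.bias K m f x * h n ^ 2))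
      atTop (id : ℝ → ℝ) (fun _ => P)
      (gaussianReal 0 (Real.toNNReal (SPBK.variance K s f x))) := by
  refine tendstoInDistribution_of_tendstoInMeasure_sub _ _
    (SPBK.tendstoInDistribution_noise hmodel.measurable_X hmodel.measurable_ε hmixing hnoise
      hdensity hkernel hbandwidth hx) (SPBK.tendstoInMeasure_of_whp ?_) fun n =>
    ((((SPBK.measurable_spbk hmodel.measurable_X hmodel.measurable_Y (hlam n) hkernel.measurable
      (h n) x).sub_const _).sub_const _).const_mul _).aemeasurable
  -- `√(nh) = O(n^{2/5})` exactly compensates the order `o(n^{-2/5})` of the remainder.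
  have h1 := (hbandwidth.sqrt_isBigO.comp_tendsto (SPBK.tendsto_fst_whp (P := P))).mul_isLittleO
    (SPBK.isLittleO_spbk_sub hmodel hmixing hnoise hdensity hknots hkernel hbandwidth hx hls)
  have h2 := h1.trans_isBigO (k := fun _ => (1 : ℝ)) (Asymptotics.IsBigO.of_bound 1 ?_)
  · refine ((Asymptotics.isLittleO_one_iff ℝ).1 h2).congr fun p => ?_
    simp only [Function.comp_apply, Pi.sub_apply]
    rw [mul_sub]
    congr 1
    simp only [SPBK.noiseWeight, SPBK.avg, SPBK.kernelFn, SPBK.sdFn, Finset.mul_sum,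
      Finset.sum_mul]
    rw [Finset.sum_comm, Real.sqrt_mul (Nat.cast_nonneg _)]
    refine Finset.sum_congr rfl fun i _ => Finset.sum_congr rfl fun α _ => ?_
    -- This turns `√(nh)/n` into the normalization `√h/√n` of the central limit theorem; it also
    -- holds at `n = 0`, where both sides vanish.
    have hn : (Real.sqrt (p.1 : ℝ))⁻¹ = Real.sqrt (p.1 : ℝ) * (p.1 : ℝ)⁻¹ := by
      rw [← div_eq_mul_inv, Real.sqrt_div_self']
      rw [one_div]
    rw [hn]
    ring
  · filter_upwards [SPBK.tendsto_fst_whp.eventually (eventually_gt_atTop 0)] with p hp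
    have hp' : (0 : ℝ) < p.1 := by exact_mod_cast hp
    simp only [Function.comp_apply]
    rw [← Real.rpow_add hp']
    norm_num
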